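/- Let $k\ge 2$ be an integer, let $\delta\le 0$ be real, and write $\langle x\rangle=(1+|x|^2)^{1/2}$. Let $H^k_\delta(\mathbb{R}^3)$ be the space of real-valued functions $u$ on $\mathbb{R}^3$ (modulo equality almost everywhere) whose weak derivatives $\partial^\alpha u$ of all orders $|\alpha|\le k$ exist and for which the norm $$\|u\|_{H^k_\delta}=\Big[\sum_{|\alpha|\le k}\int_{\mathbb{R}^3}|\partial^\alpha u|^2\,\langle x\rangle^{-3-2\delta+2|\alpha|}\,dx\Big]^{1/2}$$ is finite. Let $P=\{u\in H^k_\delta(\mathbb{R}^3): u>-1\}$, where $u>-1$ means that the continuous representative of $u$ is greater than $-1$ at every point of $\mathbb{R}^3$. Then $P$ is an open subset of $H^k_\delta(\mathbb{R}^3)$, for every $u\in P$ the function $\frac{1}{1+u}-1$ belongs to $H^k_\delta(\mathbb{R}^3)$, and the map $$P\to H^k_\delta(\mathbb{R}^3),\qquad u\mapsto \frac{1}{1+u}-1,$$ is continuously differentiable. -/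

import Mathlib

open MeasureTheory
open scoped ContDiff

namespace WeightedSobolev

/-- Euclidean three-space. -/
abbrev E3 : Type := EuclideanSpace ℝ (Fin 3)

/-- The classical partial derivative `∂ᵢ f`. -/
noncomputable def pderiv (i : Fin 3) (f : E3 → ℝ) : E3 → ℝ :=
  fun x => fderiv ℝ f x (EuclideanSpace.single i 1)

/-- The classical derivative `∂^α f = ∂₀^(α₀) ∂₁^(α₁) ∂₂^(α₂) f`
for a multi-index `α` (used only for smooth `f`). -/
noncomputable def mderiv (α : Fin 3 → ℕ) (f : E3 → ℝ) : E3 → ℝ :=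
  (pderiv 0)^[α 0] ((pderiv 1)^[α 1] ((pderiv 2)^[α 2] f))

/-- The order `|α| = α₀ + α₁ + α₂` of a multi-index. -/
def order (α : Fin 3 → ℕ) : ℕ := ∑ i, α i

/-- The finite set of the multi-indices of order at most `k`. -/
def multiIdx (k : ℕ) : Finset (Fin 3 → ℕ) :=
  (Fintype.piFinset fun _ : Fin 3 => Finset.range (k + 1)).filter fun α => order α ≤ k

theorem mem_multiIdx {k : ℕ} {α : Fin 3 → ℕ} : α ∈ multiIdx k ↔ order α ≤ k := by
  simp only [multiIdx, Finset.mem_filter, Fintype.mem_piFinset, Finset.mem_range,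
    and_iff_right_iff_imp]
  intro h i
  have : α i ≤ order α := Finset.single_le_sum (f := α) (fun _ _ => Nat.zero_le _)
    (Finset.mem_univ i)
  omega

/-- `v` is the weak (distributional) derivative `∂^α u` on `ℝ³`. -/
def IsWeakDeriv (α : Fin 3 → ℕ) (u v : E3 → ℝ) : Prop :=
  LocallyIntegrable u ∧ LocallyIntegrable v ∧
    ∀ φ : E3 → ℝ, ContDiff ℝ ∞ φ → HasCompactSupport φ →
      ∫ x, u x * mderiv α φ x = (-1) ^ order α * ∫ x, v x * φ x

/-- The weight `⟨x⟩^(-3 - 2δ + 2m)` with `⟨x⟩ = (1 + |x|²)^(1/2)`. -/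
noncomputable def weight (δ : ℝ) (m : ℕ) (x : E3) : ℝ :=
  (Real.sqrt (1 + ‖x‖ ^ 2)) ^ (-3 - 2 * δ + 2 * (m : ℝ))

theorem weight_pos (δ : ℝ) (m : ℕ) (x : E3) : 0 < weight δ m x :=
  Real.rpow_pos_of_pos (Real.sqrt_pos.2 (by positivity)) _

theorem continuous_weight (δ : ℝ) (m : ℕ) : Continuous (weight δ m) := by
  unfold weight
  refine Continuous.rpow_const (by fun_prop) fun x => Or.inl ?_
  exact (Real.sqrt_pos.2 (by positivity)).ne'

theorem contDiff_pderiv (i : Fin 3) {f : E3 → ℝ} (hf : ContDiff ℝ ∞ f) :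
    ContDiff ℝ ∞ (pderiv i f) :=
  (hf.fderiv_right (m := ∞) (by simp)).clm_apply contDiff_const

theorem hasCompactSupport_pderiv (i : Fin 3) {f : E3 → ℝ} (hf : HasCompactSupport f) :
    HasCompactSupport (pderiv i f) :=
  hf.fderiv_apply ℝ _

theorem pderiv_iterate (i : Fin 3) (n : ℕ) {f : E3 → ℝ}
    (hf : ContDiff ℝ ∞ f ∧ HasCompactSupport f) :
    ContDiff ℝ ∞ ((pderiv i)^[n] f) ∧ HasCompactSupport ((pderiv i)^[n] f) := by
  induction n with
  | zero => exact hf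
  | succ n ih =>
    rw [Function.iterate_succ_apply']
    exact ⟨contDiff_pderiv i ih.1, hasCompactSupport_pderiv i ih.2⟩

theorem mderiv_test (α : Fin 3 → ℕ) {f : E3 → ℝ}
    (hf : ContDiff ℝ ∞ f) (hc : HasCompactSupport f) :
    ContDiff ℝ ∞ (mderiv α f) ∧ HasCompactSupport (mderiv α f) :=
  pderiv_iterate 0 _ (pderiv_iterate 1 _ (pderiv_iterate 2 _ ⟨hf, hc⟩))

theorem integrable_mul_test {u φ : E3 → ℝ} (hu : LocallyIntegrable u)
    (hφ : Continuous φ) (hc : HasCompactSupport φ) : Integrable fun x => u x * φ x := by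
  simpa [mul_comm] using hu.integrable_smul_left_of_hasCompactSupport hφ hc

theorem IsWeakDeriv.congr {α : Fin 3 → ℕ} {u v u' v' : E3 → ℝ} (h : IsWeakDeriv α u v)
    (hu : u =ᵐ[volume] u') (hv : v =ᵐ[volume] v') : IsWeakDeriv α u' v' := by
  refine ⟨h.1.congr hu, h.2.1.congr hv, fun φ hφ hc => ?_⟩
  have h1 : ∫ x, u x * mderiv α φ x = ∫ x, u' x * mderiv α φ x :=
    integral_congr_ae (hu.mul (ae_eq_refl (mderiv α φ)))
  have h2 : ∫ x, v x * φ x = ∫ x, v' x * φ x := integral_congr_ae (hv.mul (ae_eq_refl φ))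
  rw [← h1, ← h2]
  exact h.2.2 φ hφ hc

theorem IsWeakDeriv.add {α : Fin 3 → ℕ} {u v u' v' : E3 → ℝ} (h : IsWeakDeriv α u v)
    (h' : IsWeakDeriv α u' v') : IsWeakDeriv α (u + u') (v + v') := by
  refine ⟨h.1.add h'.1, h.2.1.add h'.2.1, fun φ hφ hc => ?_⟩
  have hm := mderiv_test α hφ hc
  simp only [Pi.add_apply, add_mul]
  rw [integral_add (integrable_mul_test h.1 hm.1.continuous hm.2)
      (integrable_mul_test h'.1 hm.1.continuous hm.2),
    integral_add (integrable_mul_test h.2.1 hφ.continuous hc)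
      (integrable_mul_test h'.2.1 hφ.continuous hc), h.2.2 φ hφ hc, h'.2.2 φ hφ hc, mul_add]

theorem IsWeakDeriv.smul {α : Fin 3 → ℕ} {u v : E3 → ℝ} (c : ℝ) (h : IsWeakDeriv α u v) :
    IsWeakDeriv α (c • u) (c • v) := by
  refine ⟨h.1.smul c, h.2.1.smul c, fun φ hφ hc => ?_⟩
  simp only [Pi.smul_apply, smul_eq_mul, mul_assoc]
  rw [integral_const_mul, integral_const_mul, h.2.2 φ hφ hc]
  ring

theorem IsWeakDeriv.zero (α : Fin 3 → ℕ) : IsWeakDeriv α 0 0 :=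
  ⟨locallyIntegrable_zero, locallyIntegrable_zero, fun φ _ _ => by simp⟩

theorem IsWeakDeriv.unique {α : Fin 3 → ℕ} {u v w : E3 → ℝ} (h : IsWeakDeriv α u v)
    (h' : IsWeakDeriv α u w) : v =ᵐ[volume] w := by
  refine ae_eq_of_integral_contDiff_smul_eq h.2.1 h'.2.1 fun φ hφ hc => ?_
  have := (h.2.2 φ hφ hc).symm.trans (h'.2.2 φ hφ hc)
  have := mul_left_cancel₀ (pow_ne_zero _ (by norm_num)) this
  simpa [mul_comm] using this

open Classical in
/-- The weak derivative `∂^α u` as an almost everywhere class (zero if there is none). -/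
noncomputable def weakDeriv (α : Fin 3 → ℕ) (u : E3 →ₘ[volume] ℝ) : E3 →ₘ[volume] ℝ :=
  if h : ∃ v : E3 →ₘ[volume] ℝ, IsWeakDeriv α u v then h.choose else 0

theorem weakDeriv_eq {α : Fin 3 → ℕ} {u v : E3 →ₘ[volume] ℝ} (h : IsWeakDeriv α u v) :
    weakDeriv α u = v := by
  have hex : ∃ v : E3 →ₘ[volume] ℝ, IsWeakDeriv α u v := ⟨v, h⟩
  rw [weakDeriv, dif_pos hex]
  exact AEEqFun.ext (hex.choose_spec.unique h)

theorem isWeakDeriv_add {α : Fin 3 → ℕ} {u v u' v' : E3 →ₘ[volume] ℝ}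
    (h : IsWeakDeriv α u v) (h' : IsWeakDeriv α u' v') :
    IsWeakDeriv α (u + u' : E3 →ₘ[volume] ℝ) (v + v' : E3 →ₘ[volume] ℝ) :=
  (h.add h').congr (AEEqFun.coeFn_add _ _).symm (AEEqFun.coeFn_add _ _).symm

theorem isWeakDeriv_smul {α : Fin 3 → ℕ} {u v : E3 →ₘ[volume] ℝ} (c : ℝ)
    (h : IsWeakDeriv α u v) :
    IsWeakDeriv α (c • u : E3 →ₘ[volume] ℝ) (c • v : E3 →ₘ[volume] ℝ) :=
  (h.smul c).congr (AEEqFun.coeFn_smul _ _).symm (AEEqFun.coeFn_smul _ _).symm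

/-- `v` has finite weighted `L²` norm: `∫ |v|² ⟨x⟩^(-3 - 2δ + 2m) dx < ∞`. -/
def WeightedL2 (δ : ℝ) (m : ℕ) (v : E3 →ₘ[volume] ℝ) : Prop :=
  Integrable fun x => (v x) ^ 2 * weight δ m x

/-- The function `⟨x⟩^((-3 - 2δ + 2m)/2) v`, whose square is the weighted integrand. -/
noncomputable def scaled (δ : ℝ) (m : ℕ) (v : E3 →ₘ[volume] ℝ) : E3 → ℝ :=
  fun x => Real.sqrt (weight δ m x) * v x

theorem scaled_sq (δ : ℝ) (m : ℕ) (v : E3 →ₘ[volume] ℝ) (x : E3) :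
    scaled δ m v x ^ 2 = (v x) ^ 2 * weight δ m x := by
  rw [scaled, mul_pow, Real.sq_sqrt (weight_pos δ m x).le, mul_comm]

theorem aestronglyMeasurable_scaled (δ : ℝ) (m : ℕ) (v : E3 →ₘ[volume] ℝ) :
    AEStronglyMeasurable (scaled δ m v) volume :=
  ((continuous_weight δ m).sqrt.aestronglyMeasurable).mul v.aestronglyMeasurable

theorem memLp_scaled {δ : ℝ} {m : ℕ} {v : E3 →ₘ[volume] ℝ} :
    MemLp (scaled δ m v) 2 volume ↔ WeightedL2 δ m v := by
  rw [memLp_two_iff_integrable_sq (aestronglyMeasurable_scaled δ m v)]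
  simp only [scaled_sq, WeightedL2]

theorem scaled_add (δ : ℝ) (m : ℕ) (v w : E3 →ₘ[volume] ℝ) :
    scaled δ m (v + w) =ᵐ[volume] scaled δ m v + scaled δ m w := by
  filter_upwards [AEEqFun.coeFn_add v w] with x hx
  simp [scaled, hx, mul_add]

theorem scaled_smul (δ : ℝ) (m : ℕ) (c : ℝ) (v : E3 →ₘ[volume] ℝ) :
    scaled δ m (c • v) =ᵐ[volume] c • scaled δ m v := by
  filter_upwards [AEEqFun.coeFn_smul c v] with x hx
  simp [scaled, hx]
  ring

theorem WeightedL2.add {δ : ℝ} {m : ℕ} {v w : E3 →ₘ[volume] ℝ} (hv : WeightedL2 δ m v)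
    (hw : WeightedL2 δ m w) : WeightedL2 δ m (v + w) :=
  memLp_scaled.1 (((memLp_scaled.2 hv).add (memLp_scaled.2 hw)).ae_eq (scaled_add δ m v w).symm)

theorem WeightedL2.smul {δ : ℝ} {m : ℕ} {v : E3 →ₘ[volume] ℝ} (c : ℝ)
    (hv : WeightedL2 δ m v) : WeightedL2 δ m (c • v) :=
  memLp_scaled.1 (((memLp_scaled.2 hv).const_smul c).ae_eq (scaled_smul δ m c v).symm)

/-- The almost everywhere classes `u` all of whose weak derivatives of order `|α| ≤ k` exist and
satisfy `∫ |∂^α u|² ⟨x⟩^(-3 - 2δ + 2|α|) dx < ∞`. -/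
noncomputable def Hsub (k : ℕ) (δ : ℝ) : Submodule ℝ (E3 →ₘ[volume] ℝ) where
  carrier := {u | ∀ α ∈ multiIdx k, ∃ v : E3 →ₘ[volume] ℝ,
    IsWeakDeriv α u v ∧ WeightedL2 δ (order α) v}
  add_mem' := by
    intro a b ha hb α hα
    obtain ⟨v, hv, hv'⟩ := ha α hα
    obtain ⟨w, hw, hw'⟩ := hb α hα
    exact ⟨v + w, isWeakDeriv_add hv hw, hv'.add hw'⟩
  zero_mem' := by
    intro α _
    refine ⟨0, (IsWeakDeriv.zero α).congr AEEqFun.coeFn_zero.symm AEEqFun.coeFn_zero.symm, ?_⟩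
    refine (integrable_zero E3 ℝ volume).congr ?_
    filter_upwards [AEEqFun.coeFn_zero (α := E3) (β := ℝ) (μ := volume)] with x hx
    simp [hx]
  smul_mem' := by
    intro c a ha α hα
    obtain ⟨v, hv, hv'⟩ := ha α hα
    exact ⟨c • v, isWeakDeriv_smul c hv, hv'.smul c⟩

/-- The weighted Sobolev space `H^k_δ(ℝ³)`. -/
def H (k : ℕ) (δ : ℝ) : Type := Hsub k δ

noncomputable instance (k : ℕ) (δ : ℝ) : AddCommGroup (H k δ) :=
  inferInstanceAs (AddCommGroup (Hsub k δ))

noncomputable instance (k : ℕ) (δ : ℝ) : Module ℝ (H k δ) :=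
  inferInstanceAs (Module ℝ (Hsub k δ))

/-- The underlying almost everywhere class. -/
def H.toAE {k : ℕ} {δ : ℝ} (u : H k δ) : E3 →ₘ[volume] ℝ := u.1

noncomputable instance (k : ℕ) (δ : ℝ) : CoeFun (H k δ) (fun _ => E3 → ℝ) :=
  ⟨fun u => (u.toAE : E3 → ℝ)⟩

/-- The norm `(∑_{|α| ≤ k} ∫ |∂^α u|² ⟨x⟩^(-3 - 2δ + 2|α|) dx)^(1/2)`. -/
noncomputable instance (k : ℕ) (δ : ℝ) : Norm (H k δ) :=
  ⟨fun u => Real.sqrt (∑ α ∈ multiIdx k,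
    ∫ x, (weakDeriv α u.toAE x) ^ 2 * weight δ (order α) x)⟩

theorem H.norm_def {k : ℕ} {δ : ℝ} (u : H k δ) :
    ‖u‖ = Real.sqrt (∑ α ∈ multiIdx k,
      ∫ x, (weakDeriv α u.toAE x) ^ 2 * weight δ (order α) x) := rfl

theorem H.isWeakDeriv {k : ℕ} {δ : ℝ} (u : H k δ) {α : Fin 3 → ℕ} (hα : α ∈ multiIdx k) :
    IsWeakDeriv α u.toAE (weakDeriv α u.toAE) := by
  obtain ⟨v, hv, -⟩ := u.2 α hα
  have := weakDeriv_eq (u := u.toAE) hv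
  rw [this]
  exact hv

theorem H.weightedL2 {k : ℕ} {δ : ℝ} (u : H k δ) {α : Fin 3 → ℕ} (hα : α ∈ multiIdx k) :
    WeightedL2 δ (order α) (weakDeriv α u.toAE) := by
  obtain ⟨v, hv, hv'⟩ := u.2 α hα
  have := weakDeriv_eq (u := u.toAE) hv
  rw [this]
  exact hv'

/-- The family of the weighted weak derivatives, as an element of an `ℓ²` sum of `L²` spaces. -/
noncomputable def H.embed {k : ℕ} {δ : ℝ} :
    H k δ →ₗ[ℝ] PiLp 2 (fun _ : multiIdx k => Lp ℝ 2 (volume : Measure E3)) where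
  toFun u := WithLp.toLp 2 fun α => (memLp_scaled.2 (u.weightedL2 α.2)).toLp _
  map_add' u v := by
    ext1 α
    change _ = (memLp_scaled.2 (u.weightedL2 α.2)).toLp _ +
      (memLp_scaled.2 (v.weightedL2 α.2)).toLp _
    rw [← MemLp.toLp_add]
    refine MemLp.toLp_congr (memLp_scaled.2 ((u + v).weightedL2 α.2)) _ ?_
    have : weakDeriv α.1 (u + v).toAE = weakDeriv α.1 u.toAE + weakDeriv α.1 v.toAE :=
      weakDeriv_eq (isWeakDeriv_add (u.isWeakDeriv α.2) (v.isWeakDeriv α.2))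
    rw [this]
    exact scaled_add _ _ _ _
  map_smul' c u := by
    ext1 α
    change _ = c • (memLp_scaled.2 (u.weightedL2 α.2)).toLp _
    rw [← MemLp.toLp_const_smul]
    refine MemLp.toLp_congr (memLp_scaled.2 ((c • u).weightedL2 α.2)) _ ?_
    have : weakDeriv α.1 (c • u).toAE = c • weakDeriv α.1 u.toAE :=
      weakDeriv_eq (isWeakDeriv_smul c (u.isWeakDeriv α.2))
    rw [this]
    exact scaled_smul _ _ _ _

theorem norm_toLp_sq {f : E3 → ℝ} (hf : MemLp f 2 volume) :
    ‖hf.toLp f‖ ^ 2 = ∫ x, f x ^ 2 := by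
  rw [← real_inner_self_eq_norm_sq, L2.inner_def]
  refine integral_congr_ae ?_
  filter_upwards [hf.coeFn_toLp] with x hx
  simp [hx, sq]

theorem H.norm_embed {k : ℕ} {δ : ℝ} (u : H k δ) : ‖H.embed u‖ = ‖u‖ := by
  rw [PiLp.norm_eq_of_L2, H.norm_def, ← Finset.sum_coe_sort (multiIdx k)]
  congr 1
  refine Fintype.sum_congr _ _ fun α => ?_
  refine (norm_toLp_sq (memLp_scaled.2 (u.weightedL2 α.2))).trans ?_
  simp only [scaled_sq]

theorem H.eq_zero_of_embed {k : ℕ} {δ : ℝ} {u : H k δ} (h : H.embed u = 0) : u = 0 := by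
  have h0 : (0 : Fin 3 → ℕ) ∈ multiIdx k := mem_multiIdx.2 (by simp [order])
  have h1 : (memLp_scaled.2 (u.weightedL2 h0)).toLp _ = 0 :=
    congrArg (fun f : PiLp 2 (fun _ : multiIdx k => Lp ℝ 2 (volume : Measure E3)) =>
      f.ofLp ⟨0, h0⟩) h
  have h2 := (Lp.eq_zero_iff_ae_eq_zero.1 h1)
  have h3 : (weakDeriv 0 u.toAE : E3 → ℝ) =ᵐ[volume] 0 := by
    filter_upwards [h2, (memLp_scaled.2 (u.weightedL2 h0)).coeFn_toLp] with x hx hx'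
    rw [hx'] at hx
    exact (mul_eq_zero.1 hx).resolve_left (Real.sqrt_pos.2 (weight_pos _ _ _)).ne'
  have hloc := (u.isWeakDeriv h0).1
  have h4 : IsWeakDeriv 0 u.toAE u.toAE :=
    ⟨hloc, hloc, fun φ _ _ => by simp [order, mderiv]⟩
  have h5 : (u.toAE : E3 → ℝ) =ᵐ[volume] 0 := (h4.unique (u.isWeakDeriv h0)).trans h3
  have h6 : u.toAE = 0 := AEEqFun.ext (h5.trans AEEqFun.coeFn_zero.symm)
  exact Subtype.ext h6

theorem H.core (k : ℕ) (δ : ℝ) : NormedSpace.Core ℝ (H k δ) where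
  norm_nonneg u := Real.sqrt_nonneg _
  norm_smul c u := by rw [← H.norm_embed, map_smul, norm_smul, H.norm_embed]
  norm_triangle u v := by
    rw [← H.norm_embed, map_add, ← H.norm_embed u, ← H.norm_embed v]
    exact norm_add_le _ _
  norm_eq_zero_iff u := by
    rw [← H.norm_embed, norm_eq_zero]
    exact ⟨H.eq_zero_of_embed, fun h => by rw [h, map_zero]⟩

noncomputable instance (k : ℕ) (δ : ℝ) : NormedAddCommGroup (H k δ) :=
  NormedAddCommGroup.ofCore (H.core k δ)

noncomputable instance (k : ℕ) (δ : ℝ) : NormedSpace ℝ (H k δ) :=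
  NormedSpace.ofCore (H.core k δ)

/-- The set `{u ∈ H^k_δ(ℝ³) : u > -1}`. The inequality is required at every point of `ℝ³`, for the
continuous representative of `u` (elements of `H^k_δ(ℝ³)`, `k ≥ 2`, are continuous). -/
def P (k : ℕ) (δ : ℝ) : Set (H k δ) :=
  {u | ∃ f : E3 → ℝ, Continuous f ∧ u =ᵐ[volume] f ∧ ∀ x, -1 < f x}

end WeightedSobolev

namespace WeightedSobolev

open scoped Topology Convolution

/-! ### Calculus of iterated partial derivatives -/

/-! For `k ≥ 2` and `δ ≤ 0` the space `H^k_δ` consists of continuous functions vanishing at infinity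
and is closed under multiplication, with a bounded bilinear product `B` (`exists_continuous_rep`,
`exists_mulL`). Since `1/(1+u) - 1 = -u/(1+u)`, the map is `u ↦ -(1 + B u)⁻¹ u`. It is composed of
the affine map `u ↦ 1 + B u`, inversion in the Banach algebra of operators, and evaluation at `u`,
hence differentiable as soon as `1 + B u` is invertible for `u ∈ P` (`isUnit_one_add_mulL`).
Openness of `P` follows from the sup bound: decay at infinity turns `u > -1` into `1 + u ≥ c > 0`,
which survives small perturbations.

Invertibility is proved by perturbation. For a test function `φ` near `u` the function `w = 1/(1+φ)
- 1` is again a test function and `(1 + B φ)(1 + B w) = 1`. Then `(1 + B u)(1 + B w) = 1 - B(φ -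
u)(1 + B w)` is a Neumann series, provided `‖w‖` is bounded independently of how close `φ` is to
`u`. This is the a priori estimate `snorm_inverse_le`. No chain rule for weak derivatives is needed.

All inequalities are proved for test functions and extended by density (`exists_test_near`) and
completeness. They rest on the weighted embedding `jet_le_snorm`, obtained by a Hardy-type
inequality on rays averaged over the sphere, and on an `L⁴` bound for first derivatives
(`integral_pderiv_pow_four_le`) that covers the product of two first derivatives when `k = 2`. -/

theorem pderiv_comm (i j : Fin 3) {f : E3 → ℝ} (hf : ContDiff ℝ ∞ f) :
    pderiv i (pderiv j f) = pderiv j (pderiv i f) := by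
  have key : ∀ (a b : Fin 3) (x : E3), pderiv a (pderiv b f) x =
      fderiv ℝ (fderiv ℝ f) x (EuclideanSpace.single a 1) (EuclideanSpace.single b 1) := by
    intro a b x
    have hd : DifferentiableAt ℝ (fderiv ℝ f) x :=
      ((hf.fderiv_right (m := ∞) (by simp)).differentiable (by simp)) x
    unfold pderiv
    rw [fderiv_clm_apply hd (differentiableAt_const _)]
    simp
  funext x
  rw [key, key]
  exact (hf.contDiffAt.isSymmSndFDerivAt (by
    rw [minSmoothness_of_isRCLikeNormedField]
    exact WithTop.coe_le_coe.2 (le_top (a := (2 : ℕ∞))))).eq _ _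

theorem contDiff_pderiv_iterate (i : Fin 3) (n : ℕ) {f : E3 → ℝ} (hf : ContDiff ℝ ∞ f) :
    ContDiff ℝ ∞ ((pderiv i)^[n] f) := by
  induction n with
  | zero => exact hf
  | succ n ih =>
    rw [Function.iterate_succ_apply']
    exact contDiff_pderiv i ih

theorem contDiff_mderiv (α : Fin 3 → ℕ) {f : E3 → ℝ} (hf : ContDiff ℝ ∞ f) :
    ContDiff ℝ ∞ (mderiv α f) :=
  contDiff_pderiv_iterate 0 _ (contDiff_pderiv_iterate 1 _ (contDiff_pderiv_iterate 2 _ hf))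

theorem pderiv_iterate_comm (i j : Fin 3) (n : ℕ) {f : E3 → ℝ} (hf : ContDiff ℝ ∞ f) :
    pderiv i ((pderiv j)^[n] f) = (pderiv j)^[n] (pderiv i f) := by
  induction n with
  | zero => rfl
  | succ n ih =>
    rw [Function.iterate_succ_apply', Function.iterate_succ_apply', ← ih,
      pderiv_comm i j (contDiff_pderiv_iterate j n hf)]

theorem pderiv_mderiv (i : Fin 3) (α : Fin 3 → ℕ) {f : E3 → ℝ} (hf : ContDiff ℝ ∞ f) :
    pderiv i (mderiv α f) = mderiv α (pderiv i f) := by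
  unfold mderiv
  rw [pderiv_iterate_comm, pderiv_iterate_comm, pderiv_iterate_comm _ _ _ hf]
  · exact contDiff_pderiv_iterate 2 _ hf
  · exact contDiff_pderiv_iterate 1 _ (contDiff_pderiv_iterate 2 _ hf)

/-- `mderiv` takes the partials in a fixed order, so the extra one is commuted into its block. With
`order_induction` this peels derivatives off one at a time. -/
theorem mderiv_pderiv (i : Fin 3) (α : Fin 3 → ℕ) {f : E3 → ℝ} (hf : ContDiff ℝ ∞ f) :
    mderiv α (pderiv i f) = mderiv (α + Pi.single i 1) f := by
  unfold mderiv
  fin_cases i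
  · simp [← pderiv_iterate_comm, hf, contDiff_pderiv_iterate]
  · simp [← pderiv_iterate_comm, hf]
  · simp

theorem order_add_single (i : Fin 3) (α : Fin 3 → ℕ) :
    order (α + Pi.single i 1) = order α + 1 := by
  simp [order, Finset.sum_add_distrib]

@[simp] theorem order_zero : order 0 = 0 := by simp [order]

@[simp] theorem mderiv_zero (f : E3 → ℝ) : mderiv 0 f = f := rfl

theorem exists_eq_add_single {α : Fin 3 → ℕ} {n : ℕ} (h : order α = n + 1) :
    ∃ (i : Fin 3) (β : Fin 3 → ℕ), α = β + Pi.single i 1 ∧ order β = n := by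
  have : ∃ i, α i ≠ 0 := by
    by_contra! h'
    simp [order, h'] at h
  obtain ⟨i, hi⟩ := this
  have hα : α = (α - Pi.single i 1) + Pi.single i 1 := by
    funext j
    by_cases hj : j = i
    · subst hj
      simp
      omega
    · simp [hj]
  refine ⟨i, _, hα, ?_⟩
  rw [hα, order_add_single] at h
  omega

/-- Induction on the order of a multi-index. -/
theorem order_induction {p : (Fin 3 → ℕ) → Prop} (h0 : p 0)
    (hs : ∀ i α, p α → p (α + Pi.single i 1)) (α : Fin 3 → ℕ) : p α := by
  induction hn : order α generalizing α with
  | zero =>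
    have : α = 0 := by
      funext i
      have := Finset.single_le_sum (f := α) (fun _ _ => Nat.zero_le _) (Finset.mem_univ i)
      simp only [order] at hn
      simp; omega
    exact this ▸ h0
  | succ n ih =>
    obtain ⟨i, β, rfl, hβ⟩ := exists_eq_add_single hn
    exact hs i β (ih β hβ)

/-! ### Fréchet derivatives against iterated partial derivatives. -/

/-- The norm of the `m`-th Fréchet derivative. -/
noncomputable def jet (m : ℕ) (f : E3 → ℝ) (x : E3) : ℝ := ‖iteratedFDeriv ℝ m f x‖

theorem jet_nonneg (m : ℕ) (f : E3 → ℝ) (x : E3) : 0 ≤ jet m f x := norm_nonneg _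

@[simp] theorem jet_zero (f : E3 → ℝ) (x : E3) : jet 0 f x = |f x| := by
  simp [jet]

theorem continuous_jet (m : ℕ) {f : E3 → ℝ} (hf : ContDiff ℝ ∞ f) : Continuous (jet m f) :=
  (hf.continuous_iteratedFDeriv (by exact_mod_cast le_top)).norm

theorem jet_one (f : E3 → ℝ) (x : E3) : jet 1 f x = ‖fderiv ℝ f x‖ := by
  rw [jet, ← norm_iteratedFDeriv_fderiv]
  simp

theorem jet_pderiv_le (m : ℕ) (i : Fin 3) {f : E3 → ℝ} (hf : ContDiff ℝ ∞ f) (x : E3) :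
    jet m (pderiv i f) x ≤ jet (m + 1) f x := by
  have h := norm_iteratedFDeriv_clm_apply_const (𝕜 := ℝ) (f := fderiv ℝ f)
    (c := EuclideanSpace.single i (1 : ℝ)) (x := x) (N := ∞) (n := m)
    (hf.fderiv_right (m := ∞) (by simp)).contDiffAt (by exact_mod_cast le_top)
  rw [norm_iteratedFDeriv_fderiv] at h
  rw [PiLp.norm_single, norm_one, one_mul] at h
  exact h

theorem jet_mderiv_le (α : Fin 3 → ℕ) (m : ℕ) {f : E3 → ℝ} (hf : ContDiff ℝ ∞ f) (x : E3) :
    jet m (mderiv α f) x ≤ jet (m + order α) f x := by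
  induction α using order_induction generalizing m f with
  | h0 => simp
  | hs i α ih =>
    rw [← mderiv_pderiv i α hf, order_add_single]
    exact (ih m (contDiff_pderiv i hf)).trans (jet_pderiv_le _ i hf x)

theorem abs_mderiv_le (α : Fin 3 → ℕ) {f : E3 → ℝ} (hf : ContDiff ℝ ∞ f) (x : E3) :
    |mderiv α f x| ≤ jet (order α) f x := by
  simpa using jet_mderiv_le α 0 hf x

/-- Differentiate `df = ∑ ∂ᵢf dxᵢ` a further `m` times; the coordinate covectors `dxᵢ` have norm at
most one. -/
theorem jet_succ_le (m : ℕ) {f : E3 → ℝ} (hf : ContDiff ℝ ∞ f) (x : E3) :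
    jet (m + 1) f x ≤ ∑ i, jet m (pderiv i f) x := by
  have hrep : fderiv ℝ f = fun y => ∑ i : Fin 3,
      (ContinuousLinearMap.toSpanSingleton ℝ (EuclideanSpace.proj i : E3 →L[ℝ] ℝ))
        (pderiv i f y) := by
    funext y
    ext v
    have hv : v = ∑ i : Fin 3, v i • (EuclideanSpace.single i (1 : ℝ) : E3) := by
      ext j
      simp [Finset.sum_apply, Pi.single_apply]
    conv_lhs => rw [hv]
    simp [pderiv, mul_comm]
  have hc : ∀ i ∈ (Finset.univ : Finset (Fin 3)), ContDiff ℝ m (fun y =>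
      (ContinuousLinearMap.toSpanSingleton ℝ (EuclideanSpace.proj i : E3 →L[ℝ] ℝ))
        (pderiv i f y)) := fun i _ =>
    (ContinuousLinearMap.contDiff _).comp ((contDiff_pderiv i hf).of_le (by exact_mod_cast le_top))
  rw [jet, ← norm_iteratedFDeriv_fderiv, hrep, iteratedFDeriv_sum hc, Finset.sum_apply]
  refine (norm_sum_le _ _).trans (Finset.sum_le_sum fun i _ => ?_)
  refine (ContinuousLinearMap.norm_iteratedFDeriv_comp_left _
    ((contDiff_pderiv i hf).contDiffAt (n := ∞)) (by exact_mod_cast le_top)).trans ?_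
  refine mul_le_of_le_one_left (norm_nonneg _) ?_
  rw [ContinuousLinearMap.norm_toSpanSingleton]
  exact ContinuousLinearMap.opNorm_le_bound _ zero_le_one fun v => by
    simpa using PiLp.norm_apply_le v i

theorem jet_le_of_mderiv_le (m : ℕ) {f : E3 → ℝ} (hf : ContDiff ℝ ∞ f) (x : E3) {B : ℝ}
    (hB : ∀ α, order α = m → |mderiv α f x| ≤ B) : jet m f x ≤ 3 ^ m * B := by
  induction m generalizing f with
  | zero => simpa using hB 0 order_zero
  | succ m ih =>
    refine (jet_succ_le m hf x).trans ?_
    have : ∀ i ∈ (Finset.univ : Finset (Fin 3)), jet m (pderiv i f) x ≤ 3 ^ m * B := fun i _ =>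
      ih (contDiff_pderiv i hf) fun α hα => by
        rw [mderiv_pderiv i α hf]
        exact hB _ (by rw [order_add_single, hα])
    refine (Finset.sum_le_sum this).trans ?_
    simp [pow_succ]
    linarith

theorem jet_sq_le (m : ℕ) {f : E3 → ℝ} (hf : ContDiff ℝ ∞ f) (x : E3) :
    jet m f x ^ 2 ≤ 9 ^ m * ∑ α ∈ multiIdx m with order α = m, mderiv α f x ^ 2 := by
  have h0 : 0 ≤ ∑ α ∈ multiIdx m with order α = m, mderiv α f x ^ 2 :=
    Finset.sum_nonneg fun _ _ => sq_nonneg _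
  have h := jet_le_of_mderiv_le m hf x
    (B := Real.sqrt (∑ α ∈ multiIdx m with order α = m, mderiv α f x ^ 2)) fun α hα => by
      rw [← Real.sqrt_sq_eq_abs]
      refine Real.sqrt_le_sqrt (Finset.single_le_sum (f := fun α => mderiv α f x ^ 2)
        (fun _ _ => sq_nonneg _) ?_)
      simp [mem_multiIdx, hα]
  calc jet m f x ^ 2 ≤ _ := pow_le_pow_left₀ (jet_nonneg _ _ _) h 2
    _ = _ := by
      rw [mul_pow, Real.sq_sqrt h0, ← pow_mul, mul_comm m 2, pow_mul]
      norm_num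

/-! ### Test functions, integration by parts, and their classes in `H^k_δ`. -/

/-- Smooth functions with compact support. -/
def IsTest (f : E3 → ℝ) : Prop := ContDiff ℝ ∞ f ∧ HasCompactSupport f

theorem IsTest.mderiv {f : E3 → ℝ} (hf : IsTest f) (α : Fin 3 → ℕ) :
    IsTest (mderiv α f) := mderiv_test α hf.1 hf.2

theorem IsTest.pderiv {f : E3 → ℝ} (hf : IsTest f) (i : Fin 3) :
    IsTest (pderiv i f) := ⟨contDiff_pderiv i hf.1, hasCompactSupport_pderiv i hf.2⟩

theorem IsTest.mul {f g : E3 → ℝ} (hf : IsTest f) (hg : ContDiff ℝ ∞ g) :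
    IsTest (fun x => f x * g x) := ⟨hf.1.mul hg, hf.2.mul_right⟩

theorem IsTest.sub {f g : E3 → ℝ} (hf : IsTest f) (hg : IsTest g) :
    IsTest (fun x => f x - g x) := by
  refine ⟨hf.1.sub hg.1, ?_⟩
  have := hf.2.add hg.2.neg
  rwa [← sub_eq_add_neg] at this

theorem IsTest.continuous {f : E3 → ℝ} (hf : IsTest f) : Continuous f := hf.1.continuous

theorem IsTest.integrable_mul {f g : E3 → ℝ} (hf : IsTest f) (hg : Continuous g) :
    Integrable (fun x => f x * g x) :=
  (hf.continuous.mul hg).integrable_of_hasCompactSupport hf.2.mul_right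

theorem hasCompactSupport_jet (m : ℕ) {f : E3 → ℝ} (hf : HasCompactSupport f) :
    HasCompactSupport (jet m f) := (hf.iteratedFDeriv (𝕜 := ℝ) m).norm

theorem integral_mul_pderiv {f g : E3 → ℝ} (hf : IsTest f) (hg : ContDiff ℝ ∞ g) (i : Fin 3) :
    ∫ x, f x * pderiv i g x = -∫ x, pderiv i f x * g x :=
  integral_mul_fderiv_eq_neg_fderiv_mul_of_integrable
    ((hf.pderiv i).integrable_mul hg.continuous)
    (hf.integrable_mul (contDiff_pderiv i hg).continuous)
    (hf.integrable_mul hg.continuous)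
    (fun x _ => (hf.1.differentiable (by simp)) x) (fun x _ => (hg.differentiable (by simp)) x)

theorem integral_pderiv_eq_zero {f : E3 → ℝ} (hf : IsTest f) (i : Fin 3) :
    ∫ x, pderiv i f x = 0 := by
  have h := integral_mul_pderiv hf (contDiff_const (c := (1 : ℝ))) i
  have h0 : pderiv i (fun _ : E3 => (1 : ℝ)) = 0 := by
    funext x
    simp [pderiv]
  rw [h0] at h
  simpa using h.symm

theorem integral_mul_mderiv {f g : E3 → ℝ} (hf : IsTest f) (hg : ContDiff ℝ ∞ g)
    (α : Fin 3 → ℕ) :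
    ∫ x, f x * mderiv α g x = (-1) ^ order α * ∫ x, mderiv α f x * g x := by
  induction α using order_induction generalizing g with
  | h0 => simp
  | hs i α ih =>
    rw [← mderiv_pderiv i α hg, ih (contDiff_pderiv i hg), integral_mul_pderiv (hf.mderiv α) hg,
      pderiv_mderiv i α hf.1, mderiv_pderiv i α hf.1, order_add_single]
    ring

theorem IsTest.isWeakDeriv {f : E3 → ℝ} (hf : IsTest f) (α : Fin 3 → ℕ) :
    IsWeakDeriv α f (WeightedSobolev.mderiv α f) :=
  ⟨hf.continuous.locallyIntegrable, (hf.mderiv α).continuous.locallyIntegrable,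
    fun _ hφ _ => integral_mul_mderiv hf hφ α⟩

/-- The element of `H^k_δ` given by a test function. -/
noncomputable def toH (k : ℕ) (δ : ℝ) (f : E3 → ℝ) (hf : IsTest f) : H k δ :=
  ⟨AEEqFun.mk f hf.continuous.aestronglyMeasurable, fun α _ =>
    ⟨AEEqFun.mk _ (hf.mderiv α).continuous.aestronglyMeasurable,
      (hf.isWeakDeriv α).congr (AEEqFun.coeFn_mk _ _).symm (AEEqFun.coeFn_mk _ _).symm, by
        have h : Integrable fun x => WeightedSobolev.mderiv α f x *
            (WeightedSobolev.mderiv α f x * weight δ (order α) x) :=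
          (hf.mderiv α).integrable_mul
            ((hf.mderiv α).continuous.mul (continuous_weight _ _))
        refine h.congr ?_
        filter_upwards [AEEqFun.coeFn_mk (WeightedSobolev.mderiv α f)
          (hf.mderiv α).continuous.aestronglyMeasurable] with x hx
        rw [hx]
        ring⟩⟩

theorem toH_coe (k : ℕ) (δ : ℝ) {f : E3 → ℝ} (hf : IsTest f) :
    (toH k δ f hf : E3 → ℝ) =ᵐ[volume] f := AEEqFun.coeFn_mk _ _

theorem weakDeriv_toH (k : ℕ) (δ : ℝ) {f : E3 → ℝ} (hf : IsTest f) (α : Fin 3 → ℕ) :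
    (weakDeriv α (toH k δ f hf).toAE : E3 → ℝ) =ᵐ[volume] mderiv α f := by
  have h : weakDeriv α (toH k δ f hf).toAE =
      AEEqFun.mk _ (hf.mderiv α).continuous.aestronglyMeasurable := weakDeriv_eq
    ((hf.isWeakDeriv α).congr (AEEqFun.coeFn_mk _ _).symm (AEEqFun.coeFn_mk _ _).symm)
  rw [h]
  exact AEEqFun.coeFn_mk _ _

theorem H.ext {k : ℕ} {δ : ℝ} {u v : H k δ} (h : (u : E3 → ℝ) =ᵐ[volume] v) : u = v :=
  Subtype.ext (AEEqFun.ext h)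

theorem H.coe_add {k : ℕ} {δ : ℝ} (u v : H k δ) :
    ((u + v : H k δ) : E3 → ℝ) =ᵐ[volume] fun x => u x + v x :=
  AEEqFun.coeFn_add u.toAE v.toAE

theorem H.coe_sub {k : ℕ} {δ : ℝ} (u v : H k δ) :
    ((u - v : H k δ) : E3 → ℝ) =ᵐ[volume] fun x => u x - v x :=
  AEEqFun.coeFn_sub u.toAE v.toAE

theorem H.coe_neg {k : ℕ} {δ : ℝ} (u : H k δ) :
    ((-u : H k δ) : E3 → ℝ) =ᵐ[volume] fun x => -u x :=
  AEEqFun.coeFn_neg u.toAE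

theorem H.coe_smul {k : ℕ} {δ : ℝ} (c : ℝ) (u : H k δ) :
    ((c • u : H k δ) : E3 → ℝ) =ᵐ[volume] fun x => c * u x :=
  AEEqFun.coeFn_smul c u.toAE

theorem toH_sub (k : ℕ) (δ : ℝ) {f g : E3 → ℝ} (hf : IsTest f) (hg : IsTest g) :
    toH k δ (fun x => f x - g x) (hf.sub hg) = toH k δ f hf - toH k δ g hg := by
  refine H.ext ?_
  filter_upwards [toH_coe k δ (hf.sub hg), H.coe_sub (toH k δ f hf) (toH k δ g hg),
    toH_coe k δ hf, toH_coe k δ hg] with x h1 h2 h3 h4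
  rw [h1, h2, h3, h4]

theorem norm_toH_sq (k : ℕ) (δ : ℝ) {f : E3 → ℝ} (hf : IsTest f) :
    ‖toH k δ f hf‖ ^ 2 = ∑ α ∈ multiIdx k, ∫ x, mderiv α f x ^ 2 * weight δ (order α) x := by
  rw [H.norm_def, Real.sq_sqrt]
  · refine Finset.sum_congr rfl fun α _ => integral_congr_ae ?_
    filter_upwards [weakDeriv_toH k δ hf α] with x hx
    rw [hx]
  · exact Finset.sum_nonneg fun α _ => integral_nonneg fun x =>
      mul_nonneg (sq_nonneg _) (weight_pos _ _ _).le

/-! ### The weighted norm expressed through Fréchet derivatives. -/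

/-- The weighted `L²` energy of the `m`-th Fréchet derivative. -/
noncomputable def energy (δ : ℝ) (m : ℕ) (f : E3 → ℝ) : ℝ :=
  ∫ x, jet m f x ^ 2 * weight δ m x

theorem energy_nonneg (δ : ℝ) (m : ℕ) (f : E3 → ℝ) : 0 ≤ energy δ m f :=
  integral_nonneg fun _ => mul_nonneg (sq_nonneg _) (weight_pos _ _ _).le

/-- The weighted Sobolev norm of a smooth function, in terms of Fréchet derivatives. -/
noncomputable def snorm (k : ℕ) (δ : ℝ) (f : E3 → ℝ) : ℝ :=
  Real.sqrt (∑ m ∈ Finset.range (k + 1), energy δ m f)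

theorem snorm_nonneg (k : ℕ) (δ : ℝ) (f : E3 → ℝ) : 0 ≤ snorm k δ f := Real.sqrt_nonneg _

theorem snorm_sq (k : ℕ) (δ : ℝ) (f : E3 → ℝ) :
    snorm k δ f ^ 2 = ∑ m ∈ Finset.range (k + 1), energy δ m f :=
  Real.sq_sqrt (Finset.sum_nonneg fun _ _ => energy_nonneg _ _ _)

theorem energy_le_snorm_sq {k m : ℕ} (hm : m ≤ k) (δ : ℝ) (f : E3 → ℝ) :
    energy δ m f ≤ snorm k δ f ^ 2 := by
  rw [snorm_sq]
  exact Finset.single_le_sum (f := fun m => energy δ m f) (fun _ _ => energy_nonneg _ _ _)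
    (Finset.mem_range.2 (by omega))

theorem hasCompactSupport_jet_sq (m : ℕ) {f : E3 → ℝ} (hf : HasCompactSupport f) :
    HasCompactSupport (fun x => jet m f x ^ 2) :=
  HasCompactSupport.comp_left (g := fun t : ℝ => t ^ 2) (hasCompactSupport_jet m hf) (by simp)

theorem IsTest.integrable_jet_sq {f : E3 → ℝ} (hf : IsTest f) (m : ℕ) {w : E3 → ℝ}
    (hw : Continuous w) : Integrable fun x => jet m f x ^ 2 * w x :=
  (((continuous_jet m hf.1).pow 2).mul hw).integrable_of_hasCompactSupport
    (hasCompactSupport_jet_sq m hf.2).mul_right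

theorem IsTest.integrable_mderiv_sq {f : E3 → ℝ} (hf : IsTest f) (α : Fin 3 → ℕ) {w : E3 → ℝ}
    (hw : Continuous w) : Integrable fun x => WeightedSobolev.mderiv α f x ^ 2 * w x := by
  have := (hf.mderiv α).integrable_mul ((hf.mderiv α).continuous.mul hw)
  simpa only [sq, mul_assoc, Pi.mul_apply] using this

/-- This and `snorm_le_norm_toH` exchange the norm of `H k δ` for `snorm`, to which the Leibniz
inequality for Fréchet derivatives applies directly. The comparison is pointwise at each order with
the same weight, so the constants do not depend on `δ`. -/
theorem norm_toH_le (k : ℕ) : ∃ C : ℝ, 0 < C ∧ ∀ (δ : ℝ) (f : E3 → ℝ) (hf : IsTest f),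
    ‖toH k δ f hf‖ ≤ C * snorm k δ f := by
  have hc : (0 : ℝ) < (multiIdx k).card + 1 := by positivity
  refine ⟨Real.sqrt ((multiIdx k).card + 1), Real.sqrt_pos.2 hc, fun δ f hf => ?_⟩
  refine le_of_sq_le_sq ?_ (mul_nonneg (Real.sqrt_nonneg _) (snorm_nonneg k δ f))
  rw [norm_toH_sq, mul_pow, Real.sq_sqrt hc.le]
  have h : ∀ α ∈ multiIdx k, ∫ x, mderiv α f x ^ 2 * weight δ (order α) x ≤ snorm k δ f ^ 2 := by
    intro α hα
    refine le_trans ?_ (energy_le_snorm_sq (mem_multiIdx.1 hα) δ f)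
    refine integral_mono (hf.integrable_mderiv_sq α (continuous_weight _ _))
      (hf.integrable_jet_sq _ (continuous_weight _ _)) fun x => ?_
    refine mul_le_mul_of_nonneg_right ?_ (weight_pos _ _ _).le
    exact sq_le_sq.2 ((abs_mderiv_le α hf.1 x).trans (le_abs_self _))
  refine (Finset.sum_le_sum h).trans ?_
  rw [Finset.sum_const, nsmul_eq_mul]
  nlinarith [sq_nonneg (snorm k δ f)]

theorem snorm_le_norm_toH (k : ℕ) : ∃ C : ℝ, 0 < C ∧ ∀ (δ : ℝ) (f : E3 → ℝ) (hf : IsTest f),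
    snorm k δ f ≤ C * ‖toH k δ f hf‖ := by
  have hc : (0 : ℝ) < (k + 1) * 9 ^ k := by positivity
  refine ⟨Real.sqrt ((k + 1) * 9 ^ k), Real.sqrt_pos.2 hc, fun δ f hf => ?_⟩
  refine le_of_sq_le_sq ?_ (mul_nonneg (Real.sqrt_nonneg _) (norm_nonneg _))
  rw [snorm_sq, mul_pow, Real.sq_sqrt hc.le]
  have h : ∀ m ∈ Finset.range (k + 1), energy δ m f ≤ 9 ^ k * ‖toH k δ f hf‖ ^ 2 := by
    intro m hm
    have hm : m ≤ k := by simpa [Nat.lt_succ_iff] using hm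
    have h1 : energy δ m f ≤ ∫ x, 9 ^ m * ∑ α ∈ multiIdx m with order α = m,
        mderiv α f x ^ 2 * weight δ (order α) x := by
      refine integral_mono (hf.integrable_jet_sq m (continuous_weight _ _)) ?_ fun x => ?_
      · exact (integrable_finsetSum _ fun α _ =>
          hf.integrable_mderiv_sq α (continuous_weight _ _)).const_mul _
      · have := mul_le_mul_of_nonneg_right (jet_sq_le m hf.1 x) (weight_pos δ m x).le
        refine this.trans_eq ?_
        rw [mul_assoc, Finset.sum_mul]
        congr 1
        refine Finset.sum_congr rfl fun α hα => ?_
        rw [(Finset.mem_filter.1 hα).2]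
    rw [integral_const_mul, integral_finsetSum _ fun α _ =>
          hf.integrable_mderiv_sq α (continuous_weight _ _)] at h1
    refine h1.trans (mul_le_mul (pow_le_pow_right₀ (by norm_num) hm) ?_
      (Finset.sum_nonneg fun α _ => integral_nonneg fun x =>
        mul_nonneg (sq_nonneg _) (weight_pos _ _ _).le) (by positivity))
    rw [norm_toH_sq]
    refine Finset.sum_le_sum_of_subset_of_nonneg ?_ fun α _ _ => integral_nonneg fun x =>
        mul_nonneg (sq_nonneg _) (weight_pos _ _ _).le
    intro α hα
    exact mem_multiIdx.2 ((mem_multiIdx.1 (Finset.mem_filter.1 hα).1).trans hm)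
  refine (Finset.sum_le_sum h).trans_eq ?_
  rw [Finset.sum_const, nsmul_eq_mul]
  simp
  ring

/-! ### A weighted inequality along rays -/

/-- Integrate the derivative of `r q F²` over `[0, R]`: the boundary terms vanish, on the left
through the factor `r` and on the right through `F R = 0`. The term with `q'` is absorbed through
`|q'| ≤ q/p`; as `r` and `p` need not be comparable, this costs the zeroth-order term `q (F/p)²`. -/
theorem hardy_interval {F F1 q q1 p : ℝ → ℝ} {R : ℝ} (hR : 0 ≤ R)
    (hF : ∀ r, HasDerivAt F (F1 r) r) (hq : ∀ r, HasDerivAt q (q1 r) r)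
    (hF1 : Continuous F1) (hq1 : Continuous q1) (hp : Continuous p) (hp0 : ∀ r, 0 < p r)
    (hq0 : ∀ r, 0 < q r) (hqp : ∀ r, |q1 r| ≤ q r / p r) (hFR : F R = 0) :
    ∫ r in 0..R, q r * F r ^ 2 ≤
      4 * ∫ r in 0..R, r ^ 2 * (q r * (F r / p r) ^ 2 + 2 * (q r * F1 r ^ 2)) := by
  have cF : Continuous F := continuous_iff_continuousAt.2 fun r => (hF r).continuousAt
  have cq : Continuous q := continuous_iff_continuousAt.2 fun r => (hq r).continuousAt
  have hp0' : ∀ r, p r ≠ 0 := fun r => (hp0 r).ne'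
  have hd : ∀ r ∈ Set.uIcc 0 R, HasDerivAt (fun r => r * (q r * F r ^ 2))
      (q r * F r ^ 2 + r * (q1 r * F r ^ 2 + q r * (2 * F r * F1 r))) r := fun r _ => by
    refine ((hasDerivAt_id r).mul ((hq r).mul ((hF r).pow 2))).congr_deriv ?_
    simp
  have h0 := intervalIntegral.integral_eq_sub_of_hasDerivAt hd
    (Continuous.intervalIntegrable (by fun_prop) _ _)
  have cD : Continuous fun r => F r / p r := cF.div hp hp0'
  have h1 : ∫ r in 0..R, ((1 / 4) * (q r * F r ^ 2) -
      r ^ 2 * (q r * (F r / p r) ^ 2 + 2 * (q r * F1 r ^ 2))) ≤ 0 := by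
    refine le_trans (intervalIntegral.integral_mono_on hR
      (Continuous.intervalIntegrable (by fun_prop) _ _)
      (Continuous.intervalIntegrable (by fun_prop) _ _) fun r hr => ?_)
      (h0.trans (by simp [hFR])).le
    have hr0 : 0 ≤ r := hr.1
    have hqr := (hq0 r).le
    have e1 : -(r * (q1 r * F r ^ 2)) ≤ r / p r * (q r * F r ^ 2) := by
      have := (neg_abs_le (q1 r)).trans' (neg_le_neg (hqp r))
      have h2 : 0 ≤ r * F r ^ 2 := by positivity
      have := mul_le_mul_of_nonneg_left this h2
      have e : r / p r * (q r * F r ^ 2) = r * F r ^ 2 * (q r / p r) := by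
        field_simp
      rw [e]
      linarith
    have e2 : r ^ 2 * (q r * (F r / p r) ^ 2) = q r * ((r / p r) ^ 2 * F r ^ 2) := by
      field_simp
    -- `e3` encodes `r/p ≤ 1/4 + (r/p)²` and `e4` encodes `2rFF' ≥ -F²/2 - 2r²F'²`. They leave `1 -
    -- 1/4 - 1/2 = 1/4` of `q F²`, whence the constant 4.
    have e3 : 0 ≤ q r * ((1 / 2 - r / p r) ^ 2 * F r ^ 2) := by positivity
    have e4 : 0 ≤ q r * (F r + 2 * r * F1 r) ^ 2 := by positivity
    nlinarith
  rw [intervalIntegral.integral_sub (Continuous.intervalIntegrable (by fun_prop) _ _)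
    (Continuous.intervalIntegrable (by fun_prop) _ _), intervalIntegral.integral_const_mul] at h1
  linarith

/-- `G(0)² = -∫ 2GG' ≤ ∫ (G²/p + p G'²)`. The Hardy inequality, for `G` with `q = 1/p` and for `G'`
with `q = p`, supplies the factor `r²`, which is the polar Jacobian in dimension three. -/
theorem sq_le_integral_ray {G G1 G2 p p1 : ℝ → ℝ} {R : ℝ} (hR : 0 ≤ R)
    (hG : ∀ r, HasDerivAt G (G1 r) r) (hG1 : ∀ r, HasDerivAt G1 (G2 r) r)
    (hp : ∀ r, HasDerivAt p (p1 r) r) (cG2 : Continuous G2) (cp1 : Continuous p1)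
    (hp0 : ∀ r, 0 < p r) (hp1 : ∀ r, |p1 r| ≤ 1) (hGR : G R = 0) (hG1R : G1 R = 0) :
    G 0 ^ 2 ≤ 12 * ∫ r in 0..R,
      r ^ 2 * ((p r)⁻¹ ^ 3 * G r ^ 2 + (p r)⁻¹ * G1 r ^ 2 + p r * G2 r ^ 2) := by
  have cG : Continuous G := continuous_iff_continuousAt.2 fun r => (hG r).continuousAt
  have cG1 : Continuous G1 := continuous_iff_continuousAt.2 fun r => (hG1 r).continuousAt
  have cp : Continuous p := continuous_iff_continuousAt.2 fun r => (hp r).continuousAt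
  have hp0' : ∀ r, p r ≠ 0 := fun r => (hp0 r).ne'
  have cpi : Continuous fun r => (p r)⁻¹ := cp.inv₀ hp0'
  have cGp : Continuous fun r => G r / p r := cG.div cp hp0'
  have cG1p : Continuous fun r => G1 r / p r := cG1.div cp hp0'
  have hA := hardy_interval (q := fun r => (p r)⁻¹) (q1 := fun r => -p1 r / p r ^ 2) (p := p) hR
    hG (fun r => (hp r).inv (hp0' r)) cG1 (cp1.neg.div (cp.pow 2) fun r => pow_ne_zero _ (hp0' r))
    cp hp0 (fun r => inv_pos.2 (hp0 r)) (fun r => by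
      have := hp0 r
      rw [abs_div, abs_neg, abs_of_pos (pow_pos this 2), div_eq_mul_inv (p r)⁻¹, ← mul_inv, ← sq,
        div_eq_mul_inv]
      exact mul_le_of_le_one_left (by positivity) (hp1 r)) hGR
  have hB := hardy_interval (q := p) (p := p) hR hG1 hp cG2 cp1 cp hp0 hp0
    (fun r => by rw [div_self (hp0' r)]; exact hp1 r) hG1R
  have hd : ∀ r ∈ Set.uIcc 0 R, HasDerivAt (fun r => G r ^ 2) (2 * G r * G1 r) r := fun r _ => by
    refine ((hG r).pow 2).congr_deriv ?_
    simp
  have h0 := intervalIntegral.integral_eq_sub_of_hasDerivAt hd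
    (Continuous.intervalIntegrable (by fun_prop) _ _)
  have hC : ∫ r in 0..R, -(2 * G r * G1 r) ≤
      ∫ r in 0..R, ((p r)⁻¹ * G r ^ 2 + p r * G1 r ^ 2) := by
    refine intervalIntegral.integral_mono_on hR
      (Continuous.intervalIntegrable (by fun_prop) _ _)
      (Continuous.intervalIntegrable (by fun_prop) _ _) fun r _ => ?_
    have := hp0 r
    have e : 0 ≤ (p r)⁻¹ * (G r + p r * G1 r) ^ 2 := by positivity
    have e' : (p r)⁻¹ * (G r + p r * G1 r) ^ 2 =
        (p r)⁻¹ * G r ^ 2 + 2 * G r * G1 r + p r * G1 r ^ 2 := by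
      field_simp
      ring
    linarith
  rw [intervalIntegral.integral_neg, h0,
    intervalIntegral.integral_add (Continuous.intervalIntegrable (by fun_prop) _ _)
    (Continuous.intervalIntegrable (by fun_prop) _ _)] at hC
  -- The coefficients of the terms in `G`, `G'`, `G''` are 4, 8 + 4 and 8, all at most 12.
  have hD : (4 * ∫ r in 0..R, r ^ 2 * ((p r)⁻¹ * (G r / p r) ^ 2 + 2 * ((p r)⁻¹ * G1 r ^ 2))) +
      4 * ∫ r in 0..R, r ^ 2 * (p r * (G1 r / p r) ^ 2 + 2 * (p r * G2 r ^ 2)) ≤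
      12 * ∫ r in 0..R,
      r ^ 2 * ((p r)⁻¹ ^ 3 * G r ^ 2 + (p r)⁻¹ * G1 r ^ 2 + p r * G2 r ^ 2) := by
    rw [← intervalIntegral.integral_const_mul, ← intervalIntegral.integral_const_mul,
      ← intervalIntegral.integral_const_mul, ← intervalIntegral.integral_add
      (Continuous.intervalIntegrable (by fun_prop) _ _)
      (Continuous.intervalIntegrable (by fun_prop) _ _)]
    refine intervalIntegral.integral_mono_on hR
      (Continuous.intervalIntegrable (by fun_prop) _ _)
      (Continuous.intervalIntegrable (by fun_prop) _ _) fun r _ => ?_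
    have := hp0 r
    have e1 : (p r)⁻¹ * (G r / p r) ^ 2 = (p r)⁻¹ ^ 3 * G r ^ 2 := by
      field_simp
    have e2 : p r * (G1 r / p r) ^ 2 = (p r)⁻¹ * G1 r ^ 2 := by
      field_simp
    rw [e1, e2]
    have f1 : 0 ≤ r ^ 2 * ((p r)⁻¹ ^ 3 * G r ^ 2) := by positivity
    have f2 : 0 ≤ r ^ 2 * ((p r)⁻¹ * G1 r ^ 2) := by positivity
    have f3 : 0 ≤ r ^ 2 * (p r * G2 r ^ 2) := by positivity
    nlinarith
  have hGR2 : G R ^ 2 = 0 := by simp [hGR]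
  simp only [hGR2] at hC
  linarith

/-! ### Integration in polar coordinates -/

theorem lintegral_eq_lintegral_sphere {f : E3 → ENNReal} (hf : Measurable f) :
    ∫⁻ x, f x = ∫⁻ θ, ∫⁻ r in Set.Ioi (0 : ℝ), ENNReal.ofReal (r ^ 2) * f (r • (θ : E3))
      ∂(volume : Measure ℝ) ∂((volume : Measure E3).toSphere) := by
  have h1 : ∫⁻ x, f x = ∫⁻ x : ({0}ᶜ : Set E3), f x ∂((volume : Measure E3).comap (↑)) := by
    rw [lintegral_subtype_comap (measurableSet_singleton _).compl, restrict_compl_singleton]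
  have hmp := (volume : Measure E3).measurePreserving_homeomorphUnitSphereProd
  have h2 := hmp.lintegral_comp_emb (Homeomorph.measurableEmbedding _)
    (fun z : Metric.sphere (0 : E3) 1 × Set.Ioi (0 : ℝ) => f (z.2.1 • (z.1 : E3)))
  have h3 : ∀ x : ({0}ᶜ : Set E3), f ((homeomorphUnitSphereProd E3 x).2.1 •
      ((homeomorphUnitSphereProd E3 x).1 : E3)) = f x := by
    intro x
    congr 1
    have hx : ‖(x : E3)‖ ≠ 0 := norm_ne_zero_iff.2 x.2
    simp [smul_smul, hx]
  simp only [h3] at h2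
  have hm : Measurable fun z : Metric.sphere (0 : E3) 1 × Set.Ioi (0 : ℝ) =>
      f (z.2.1 • (z.1 : E3)) := hf.comp (by fun_prop)
  rw [h1, h2, lintegral_prod _ hm.aemeasurable]
  refine lintegral_congr fun θ => ?_
  have hm' : Measurable fun r : Set.Ioi (0 : ℝ) => f (r.1 • (θ : E3)) := hf.comp (by fun_prop)
  refine (lintegral_withDensity_eq_lintegral_mul _ (by fun_prop) hm').trans ?_
  simp only [finrank_euclideanSpace_fin, Pi.mul_apply]
  exact lintegral_subtype_comap (measurableSet_Ioi)
    (fun r : ℝ => ENNReal.ofReal (r ^ (3 - 1)) * f (r • (θ : E3)))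

/-- Averaging the ray bound over the unit sphere turns `r² dr dθ` into Lebesgue measure; the
constant is the reciprocal of the area of the sphere. -/
theorem exists_le_integral_of_ray :
    ∃ C : ℝ, 0 < C ∧ ∀ (Φ : E3 → ℝ) (c R : ℝ), Continuous Φ → Integrable Φ → (∀ x, 0 ≤ Φ x) →
      0 ≤ R → (∀ θ : E3, ‖θ‖ = 1 → c ≤ ∫ r in 0..R, r ^ 2 * Φ (r • θ)) → c ≤ C * ∫ x, Φ x := by
  set S := (volume : Measure E3).toSphere.real Set.univ with hS
  have hS0 : 0 < S := by
    rw [hS, Measure.real, ENNReal.toReal_pos_iff]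
    exact ⟨pos_iff_ne_zero.2 (Measure.measure_univ_ne_zero.2 (Measure.toSphere_ne_zero _)),
      measure_lt_top _ _⟩
  refine ⟨S⁻¹, inv_pos.2 hS0, fun Φ c R hc hi h0 hR h => ?_⟩
  have h1 : ENNReal.ofReal c * (volume : Measure E3).toSphere Set.univ ≤
      ENNReal.ofReal (∫ x, Φ x) := by
    rw [ofReal_integral_eq_lintegral_ofReal hi (Filter.Eventually.of_forall h0),
      lintegral_eq_lintegral_sphere (by fun_prop), ← lintegral_const]
    refine lintegral_mono fun θ => ?_
    have hθ : ‖(θ : E3)‖ = 1 := by simp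
    refine (ENNReal.ofReal_le_ofReal (h θ hθ)).trans ?_
    rw [intervalIntegral.integral_of_le hR, ofReal_integral_eq_lintegral_ofReal]
    · refine (lintegral_mono_set Set.Ioc_subset_Ioi_self).trans ?_
      refine lintegral_mono fun r => ?_
      rw [ENNReal.ofReal_mul (sq_nonneg r)]
    · exact (Continuous.integrableOn_Icc (by fun_prop)).mono_set Set.Ioc_subset_Icc_self
    · exact Filter.Eventually.of_forall fun r => mul_nonneg (sq_nonneg r) (h0 _)
  rw [← ENNReal.ofReal_toReal (measure_ne_top (volume : Measure E3).toSphere Set.univ),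
    ← ENNReal.ofReal_mul' ENNReal.toReal_nonneg,
    ENNReal.ofReal_le_ofReal_iff (integral_nonneg h0)] at h1
  rw [inv_mul_eq_div, le_div_iff₀ hS0]
  exact h1

/-! ### The weight function and its derivatives -/

/-- The Japanese bracket `⟨x⟩ = (1 + |x|²)^(1/2)`. -/
noncomputable def jap (x : E3) : ℝ := Real.sqrt (1 + ‖x‖ ^ 2)

theorem one_le_jap (x : E3) : 1 ≤ jap x := Real.one_le_sqrt.2 (by linarith [sq_nonneg ‖x‖])

theorem jap_pos (x : E3) : 0 < jap x := zero_lt_one.trans_le (one_le_jap x)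

theorem norm_le_jap (x : E3) : ‖x‖ ≤ jap x := Real.le_sqrt_of_sq_le (by linarith)

theorem jap_le (x : E3) : jap x ≤ 1 + ‖x‖ :=
  Real.sqrt_le_iff.2 ⟨by positivity, by nlinarith [norm_nonneg x]⟩

theorem weight_eq (δ : ℝ) (m : ℕ) (x : E3) :
    weight δ m x = jap x ^ (-3 - 2 * δ + 2 * (m : ℝ)) := rfl

theorem contDiff_jap : ContDiff ℝ ∞ jap :=
  ContDiff.sqrt (contDiff_const.add (contDiff_norm_sq ℝ)) fun x =>
    (add_pos_of_pos_of_nonneg one_pos (sq_nonneg ‖x‖)).ne'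

theorem contDiff_jap_rpow (s : ℝ) : ContDiff ℝ ∞ fun x => jap x ^ s :=
  contDiff_jap.rpow_const_of_ne fun x => (jap_pos x).ne'

theorem hasFDerivAt_jap (x : E3) :
    HasFDerivAt jap ((jap x)⁻¹ • innerSL ℝ x) x := by
  have h := ((hasFDerivAt_const (1 : ℝ) x).add (hasStrictFDerivAt_norm_sq x).hasFDerivAt).sqrt
    (add_pos_of_pos_of_nonneg one_pos (sq_nonneg ‖x‖)).ne'
  refine h.congr_fderiv ?_
  ext v
  simp [jap]
  ring

theorem abs_fderiv_jap_le (x v : E3) : |fderiv ℝ jap x v| ≤ ‖v‖ := by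
  rw [(hasFDerivAt_jap x).fderiv]
  simp only [_root_.smul_apply, innerSL_apply_apply, smul_eq_mul, abs_mul, abs_inv,
    abs_of_pos (jap_pos x)]
  rw [inv_mul_le_iff₀ (jap_pos x)]
  exact (abs_real_inner_le_norm x v).trans
    (mul_le_mul_of_nonneg_right (norm_le_jap x) (norm_nonneg v))

theorem pderiv_jap_rpow (i : Fin 3) (s : ℝ) :
    pderiv i (fun x => jap x ^ s) = fun x => s * (x i * jap x ^ (s - 2)) := by
  funext x
  have h := (hasFDerivAt_jap x).rpow_const (p := s) (Or.inl (jap_pos x).ne')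
  rw [pderiv, h.fderiv]
  have e : jap x ^ (s - 1) = jap x ^ (s - 2) * jap x := by
    rw [← Real.rpow_add_one (jap_pos x).ne']
    congr 1
    ring
  have := (jap_pos x).ne'
  simp only [_root_.smul_apply, innerSL_apply_apply, smul_eq_mul, e,
    EuclideanSpace.inner_single_right]
  simp
  field_simp

theorem jet_coord_le (i : Fin 3) (n : ℕ) (x : E3) :
    jet n (fun x : E3 => x i) x ≤ jap x ^ (1 - n : ℝ) := by
  have hproj : (fun x : E3 => x i) = (EuclideanSpace.proj i : E3 →L[ℝ] ℝ) := rfl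
  have hnorm : ‖(EuclideanSpace.proj i : E3 →L[ℝ] ℝ)‖ ≤ 1 :=
    ContinuousLinearMap.opNorm_le_bound _ zero_le_one fun v => by
      simpa using PiLp.norm_apply_le v i
  have hfd : fderiv ℝ (fun x : E3 => x i) =
      fun _ => (EuclideanSpace.proj i : E3 →L[ℝ] ℝ) := by
    funext y
    rw [hproj]
    exact ContinuousLinearMap.fderiv _
  match n with
  | 0 => simpa using (PiLp.norm_apply_le x i).trans (norm_le_jap x)
  | 1 =>
    rw [jet_one, hfd]
    simpa using hnorm
  | n + 2 =>
    rw [jet, ← norm_iteratedFDeriv_fderiv, hfd, iteratedFDeriv_succ_const]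
    simpa using Real.rpow_nonneg (jap_pos x).le _

theorem contDiff_coord (i : Fin 3) : ContDiff ℝ ∞ fun x : E3 => x i :=
  (EuclideanSpace.proj i : E3 →L[ℝ] ℝ).contDiff

theorem jet_const_mul (m : ℕ) (c : ℝ) {f : E3 → ℝ} (hf : ContDiff ℝ ∞ f) (x : E3) :
    jet m (fun y => c * f y) x = |c| * jet m f x := by
  have := iteratedFDeriv_const_smul_apply (𝕜 := ℝ) (i := m) (a := c) (f := f) (x := x)
    (hf.contDiffAt.of_le (by exact_mod_cast le_top))
  rw [jet, jet, ← Real.norm_eq_abs, ← norm_smul, ← this]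
  rfl

theorem jet_mul_le (m : ℕ) {f g : E3 → ℝ} (hf : ContDiff ℝ ∞ f) (hg : ContDiff ℝ ∞ g) (x : E3) :
    jet m (fun y => f y * g y) x ≤
      ∑ i ∈ Finset.range (m + 1), (m.choose i : ℝ) * jet i f x * jet (m - i) g x :=
  norm_iteratedFDeriv_mul_le hf hg x (by exact_mod_cast le_top)

/-- Each derivative of `⟨x⟩^s` gains one power of decay. The induction uses `∂ᵢ⟨x⟩^s = s xᵢ
⟨x⟩^(s-2)` and the Leibniz rule, with `xᵢ` behaving like a first power of `⟨x⟩`; since `s` becomes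
`s - 2`, all exponents are treated at once. -/
theorem jet_jap_rpow_le (n : ℕ) : ∀ s : ℝ, ∃ C : ℝ, 0 ≤ C ∧ ∀ x,
    jet n (fun x => jap x ^ s) x ≤ C * jap x ^ (s - n) := by
  induction n using Nat.strong_induction_on with
  | _ n ih =>
  match n with
  | 0 =>
    intro s
    refine ⟨1, zero_le_one, fun x => ?_⟩
    simp [abs_of_nonneg (Real.rpow_nonneg (jap_pos x).le s)]
  | n + 1 =>
    intro s
    have ih' : ∀ j, ∃ C : ℝ, 0 ≤ C ∧ ∀ x, j ≤ n →
        jet j (fun x => jap x ^ (s - 2)) x ≤ C * jap x ^ (s - 2 - j) := by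
      intro j
      by_cases hj : j ≤ n
      · obtain ⟨C, h0, h⟩ := ih j (by omega) (s - 2)
        exact ⟨C, h0, fun x _ => h x⟩
      · exact ⟨0, le_rfl, fun x h => absurd h hj⟩
    choose C hC0 hC using ih'
    refine ⟨∑ _i : Fin 3, |s| * ∑ j ∈ Finset.range (n + 1), (n.choose j : ℝ) * C (n - j),
      Finset.sum_nonneg fun _ _ => mul_nonneg (abs_nonneg _) (Finset.sum_nonneg fun j _ =>
        mul_nonneg (Nat.cast_nonneg _) (hC0 _)), fun x => ?_⟩
    refine (jet_succ_le n (contDiff_jap_rpow s) x).trans ?_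
    rw [Finset.sum_mul]
    refine Finset.sum_le_sum fun i _ => ?_
    rw [pderiv_jap_rpow, jet_const_mul n s ((contDiff_coord i).mul (contDiff_jap_rpow _)), mul_assoc]
    refine mul_le_mul_of_nonneg_left ?_ (abs_nonneg _)
    refine (jet_mul_le n (contDiff_coord i) (contDiff_jap_rpow _) x).trans ?_
    rw [Finset.sum_mul]
    refine Finset.sum_le_sum fun j hj => ?_
    have hj : j ≤ n := by simpa [Nat.lt_succ_iff] using hj
    rw [mul_assoc, mul_assoc]
    refine mul_le_mul_of_nonneg_left ?_ (Nat.cast_nonneg _)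
    refine (mul_le_mul (jet_coord_le i j x) (hC (n - j) x (by omega)) (jet_nonneg _ _ _)
      (Real.rpow_nonneg (jap_pos x).le _)).trans_eq ?_
    rw [mul_left_comm, ← Real.rpow_add (jap_pos x)]
    congr 2
    push_cast [Nat.cast_sub hj]
    ring

/-! ### Pointwise bounds -/

/-- Use `sq_le_integral_ray` on every ray from the point, with `p = ⟨·⟩` along the ray, and average
over directions. At `δ = 0` the weights of orders 0, 1, 2 are exactly `p⁻³`, `p⁻¹`, `p`. Polar
coordinates are centred at the arbitrary point while the weight stays centred at the origin, which
is harmless because `⟨·⟩` is 1-Lipschitz. -/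
theorem sq_le_snorm_sq_zero : ∃ C : ℝ, 0 < C ∧ ∀ g : E3 → ℝ, IsTest g → ∀ x,
    g x ^ 2 ≤ C * snorm 2 0 g ^ 2 := by
  obtain ⟨C, hC0, hC⟩ := exists_le_integral_of_ray
  refine ⟨C * 12, by positivity, fun g hg x₀ => ?_⟩
  set Φ : E3 → ℝ := fun x => jet 0 g x ^ 2 * weight 0 0 x + jet 1 g x ^ 2 * weight 0 1 x +
    jet 2 g x ^ 2 * weight 0 2 x with hΦ
  have i0 := hg.integrable_jet_sq 0 (continuous_weight 0 0)
  have i1 := hg.integrable_jet_sq 1 (continuous_weight 0 1)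
  have i2 := hg.integrable_jet_sq 2 (continuous_weight 0 2)
  have hΦi : Integrable Φ := (i0.add i1).add i2
  have hΦc : Continuous Φ := by
    have c := fun m => continuous_jet m hg.1
    have c' := fun m => continuous_weight 0 m
    fun_prop
  have hΦ0 : ∀ x, 0 ≤ Φ x := fun x => by
    have := fun m => (weight_pos 0 m x).le
    have h0 := this 0
    have h1 := this 1
    have h2 := this 2
    positivity
  have hI : ∫ x, Φ x = snorm 2 0 g ^ 2 := by
    refine (integral_add (i0.add i1) i2).trans ?_
    rw [snorm_sq, integral_add' i0 i1]
    simp [Finset.sum_range_succ, energy]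
  obtain ⟨ρ, hρ⟩ := hg.2.isCompact.isBounded.subset_closedBall (0 : E3)
  -- Large enough that the sphere of radius `R` about `x₀` misses the support of `g`, so both
  -- boundary conditions at `R` hold.
  set R := |ρ| + ‖x₀‖ + 1 with hR
  have hR0 : 0 ≤ R := by positivity
  have key := hC (fun x => Φ (x₀ + x)) (g x₀ ^ 2 / 12) R (by fun_prop)
    (hΦi.comp_add_left x₀) (fun x => hΦ0 _) hR0 ?_
  · rw [integral_add_left_eq_self, hI] at key
    linarith
  intro θ hθ
  have hout : x₀ + R • θ ∉ tsupport g := fun hmem => by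
    have h1 := hρ hmem
    rw [mem_closedBall_zero_iff] at h1
    have h2 : ‖R • θ‖ ≤ ‖x₀ + R • θ‖ + ‖x₀‖ := by
      simpa using norm_sub_le (x₀ + R • θ) x₀
    rw [norm_smul, hθ, Real.norm_of_nonneg hR0, mul_one] at h2
    linarith [le_abs_self ρ]
  have hray : ∀ r : ℝ, HasDerivAt (fun r : ℝ => x₀ + r • θ) θ r := fun r => by
    simpa using ((hasDerivAt_id r).smul_const θ).const_add x₀
  have hd : ∀ {f : E3 → ℝ}, ContDiff ℝ ∞ f → ∀ r : ℝ,
      HasDerivAt (fun r : ℝ => f (x₀ + r • θ)) (fderiv ℝ f (x₀ + r • θ) θ) r := fun hf r =>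
    ((hf.differentiable (by simp)) _).hasFDerivAt.comp_hasDerivAt r (hray r)
  have hs : ∀ {f : E3 → ℝ}, ContDiff ℝ ∞ f → ContDiff ℝ ∞ fun y => fderiv ℝ f y θ := fun hf =>
    (hf.fderiv_right (m := ∞) (by simp)).clm_apply contDiff_const
  have hc : ∀ {f : E3 → ℝ}, ContDiff ℝ ∞ f →
      Continuous fun r : ℝ => fderiv ℝ f (x₀ + r • θ) θ := fun hf =>
    (hs hf).continuous.comp (by fun_prop)
  have hb : ∀ (m : ℕ) {f : E3 → ℝ}, ContDiff ℝ ∞ f → ∀ y,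
      jet m (fun y => fderiv ℝ f y θ) y ≤ jet (m + 1) f y := fun m f hf y => by
    have h := norm_iteratedFDeriv_clm_apply_const (𝕜 := ℝ) (f := fderiv ℝ f)
      (c := θ) (x := y) (N := ∞) (n := m)
      (hf.fderiv_right (m := ∞) (by simp)).contDiffAt (by exact_mod_cast le_top)
    rwa [norm_iteratedFDeriv_fderiv, hθ, one_mul] at h
  have ray := sq_le_integral_ray hR0 (hd hg.1) (hd (hs hg.1)) (hd contDiff_jap) (hc (hs hg.1))
    (hc contDiff_jap) (fun r => jap_pos _)
    (fun r => (abs_fderiv_jap_le _ _).trans hθ.le) (image_eq_zero_of_notMem_tsupport hout)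
    (by rw [fderiv_of_notMem_tsupport ℝ hout]; rfl)
  have hGx : g (x₀ + (0 : ℝ) • θ) = g x₀ := by simp
  rw [hGx] at ray
  rw [div_le_iff₀' (by norm_num)]
  refine ray.trans (mul_le_mul_of_nonneg_left ?_ (by norm_num))
  have cj : Continuous fun r : ℝ => jap (x₀ + r • θ) := contDiff_jap.continuous.comp (by fun_prop)
  have cji : Continuous fun r : ℝ => (jap (x₀ + r • θ))⁻¹ := cj.inv₀ fun r => (jap_pos _).ne'
  have cg : Continuous fun r : ℝ => g (x₀ + r • θ) := hg.continuous.comp (by fun_prop)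
  have cg1 := hc hg.1
  have cg2 := hc (hs hg.1)
  refine intervalIntegral.integral_mono_on hR0
    (Continuous.intervalIntegrable ((continuous_id.pow 2).mul ((((cji.pow 3).mul (cg.pow 2)).add
      (cji.mul (cg1.pow 2))).add (cj.mul (cg2.pow 2)))) _ _)
    (Continuous.intervalIntegrable (by fun_prop) _ _) fun r _ => ?_
  refine mul_le_mul_of_nonneg_left ?_ (sq_nonneg r)
  set y := x₀ + r • θ
  have jp := jap_pos y
  have w0 : weight 0 0 y = (jap y)⁻¹ ^ 3 := by
    rw [weight_eq, inv_pow, ← Real.rpow_natCast, ← Real.rpow_neg jp.le]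
    norm_num
  have w1 : weight 0 1 y = (jap y)⁻¹ := by
    rw [weight_eq, ← Real.rpow_neg_one]
    norm_num
  have w2 : weight 0 2 y = jap y := by
    rw [weight_eq]
    norm_num
  have b1 : (fderiv ℝ g y θ) ^ 2 ≤ jet 1 g y ^ 2 := by
    rw [← sq_abs]
    have := hb 0 hg.1 y
    rw [jet_zero] at this
    exact pow_le_pow_left₀ (abs_nonneg _) this 2
  have b2 : (fderiv ℝ (fun y => fderiv ℝ g y θ) y θ) ^ 2 ≤ jet 2 g y ^ 2 := by
    rw [← sq_abs]
    have := (hb 0 (hs hg.1) y).trans (hb 1 hg.1 y)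
    rw [jet_zero] at this
    exact pow_le_pow_left₀ (abs_nonneg _) this 2
  simp only [hΦ, w0, w1, w2, jet_zero, sq_abs]
  have := mul_le_mul_of_nonneg_right b1 (inv_pos.2 jp).le
  have := mul_le_mul_of_nonneg_right b2 jp.le
  linarith

/-- Multiplication by `⟨x⟩^(m-δ)` carries an `m`-th derivative from the scale `δ` to the scale `0`.
In the Leibniz expansion the powers of `⟨x⟩` combine exactly to the weight of order `m + i` at `δ`.
-/
theorem energy_mul_jap_rpow_le (j m : ℕ) (δ s : ℝ) (hs : s = m - δ) : ∃ C : ℝ, 0 ≤ C ∧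
    ∀ (f : E3 → ℝ) (α : Fin 3 → ℕ), IsTest f → order α = m →
      energy 0 j (fun x => mderiv α f x * jap x ^ s) ≤ C * snorm (m + j) δ f ^ 2 := by
  choose C hC0 hC using fun n => jet_jap_rpow_le n s
  set c : ℕ → ℝ := fun i => j.choose i * C (j - i) with hc
  refine ⟨(j + 1) * ∑ i ∈ Finset.range (j + 1), c i ^ 2, by positivity, fun f α hf hα => ?_⟩
  have hint : ∀ i, Integrable fun x => c i ^ 2 * (jet (m + i) f x ^ 2 * weight δ (m + i) x) :=
    fun i => (hf.integrable_jet_sq (m + i) (continuous_weight _ _)).const_mul _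
  have h1 : energy 0 j (fun x => mderiv α f x * jap x ^ s) ≤
      ∫ x, (j + 1) * ∑ i ∈ Finset.range (j + 1),
        c i ^ 2 * (jet (m + i) f x ^ 2 * weight δ (m + i) x) := by
    refine integral_mono (((hf.mderiv α).mul (contDiff_jap_rpow s)).integrable_jet_sq j
      (continuous_weight _ _)) ((integrable_finsetSum _ fun i _ => hint i).const_mul _) fun x => ?_
    have hj := jap_pos x
    have b1 : jet j (fun x => mderiv α f x * jap x ^ s) x ≤
        ∑ i ∈ Finset.range (j + 1), c i * (jet (m + i) f x * jap x ^ (s - (j - i : ℕ))) := by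
      refine (jet_mul_le j (hf.mderiv α).1 (contDiff_jap_rpow s) x).trans ?_
      refine Finset.sum_le_sum fun i _ => ?_
      rw [hc]
      have e1 := jet_mderiv_le α i hf.1 x
      rw [hα, add_comm i m] at e1
      have e2 := mul_le_mul e1 (hC (j - i) x) (jet_nonneg _ _ _) (jet_nonneg _ _ _)
      have e3 := mul_le_mul_of_nonneg_left e2 (Nat.cast_nonneg (α := ℝ) (j.choose i))
      rw [mul_assoc]
      refine e3.trans_eq ?_
      ring
    have b2 := pow_le_pow_left₀ (jet_nonneg _ _ _) b1 2
    have b3 := b2.trans (sq_sum_le_card_mul_sum_sq)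
    have b4 := mul_le_mul_of_nonneg_right b3 (weight_pos 0 j x).le
    refine b4.trans_eq ?_
    rw [Finset.card_range, mul_assoc, Finset.sum_mul]
    push_cast
    congr 1
    refine Finset.sum_congr rfl fun i hi => ?_
    have hi : i ≤ j := by simpa [Nat.lt_succ_iff] using hi
    rw [mul_pow, mul_pow (jet (m + i) f x), mul_assoc, mul_assoc]
    congr 2
    rw [weight_eq, weight_eq, ← Real.rpow_mul_natCast hj.le, ← Real.rpow_add hj, hs]
    congr 1
    push_cast [Nat.cast_sub hi]
    ring
  rw [integral_const_mul, integral_finsetSum _ fun i _ => hint i] at h1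
  refine h1.trans ?_
  rw [mul_assoc, Finset.sum_mul]
  refine mul_le_mul_of_nonneg_left (Finset.sum_le_sum fun i hi => ?_) (by positivity)
  have hi : i ≤ j := by simpa [Nat.lt_succ_iff] using hi
  rw [integral_const_mul]
  exact mul_le_mul_of_nonneg_left (energy_le_snorm_sq (by omega) δ f) (sq_nonneg _)

theorem snorm_mono {k l : ℕ} (h : k ≤ l) (δ : ℝ) (f : E3 → ℝ) : snorm k δ f ≤ snorm l δ f :=
  Real.sqrt_le_sqrt (Finset.sum_le_sum_of_subset_of_nonneg
    (Finset.range_mono (by omega)) fun _ _ _ => energy_nonneg _ _ _)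

/-- The weighted Sobolev embedding into continuous functions. -/
theorem jet_le_snorm (m : ℕ) (δ : ℝ) : ∃ C : ℝ, 0 ≤ C ∧ ∀ f : E3 → ℝ, IsTest f → ∀ x,
    jet m f x * jap x ^ (m - δ) ≤ C * snorm (m + 2) δ f := by
  obtain ⟨C, hC0, hC⟩ := sq_le_snorm_sq_zero
  choose D hD0 hD using fun j => energy_mul_jap_rpow_le j m δ _ rfl
  set A := C * ∑ j ∈ Finset.range 3, D j with hA
  have hA0 : 0 ≤ A := mul_nonneg hC0.le (Finset.sum_nonneg fun j _ => hD0 j)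
  refine ⟨3 ^ m * Real.sqrt A, by positivity, fun f hf x => ?_⟩
  have hj := Real.rpow_pos_of_pos (jap_pos x) (m - δ)
  have hS := snorm_nonneg (m + 2) δ f
  have key : ∀ α, order α = m →
      |mderiv α f x| ≤ Real.sqrt A * snorm (m + 2) δ f / jap x ^ (m - δ) := by
    intro α hα
    rw [le_div_iff₀ hj]
    conv_lhs => rw [← abs_of_pos hj, ← abs_mul]
    refine abs_le_of_sq_le_sq ?_ (by positivity)
    rw [mul_pow (Real.sqrt A), Real.sq_sqrt hA0]
    -- The embedding at `δ = 0` is applied to `⟨x⟩^(m-δ) ∂^α f`; its energies of order at most two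
    -- are controlled by derivatives of `f` of order at most `m + 2`.
    refine (hC _ ((hf.mderiv α).mul (contDiff_jap_rpow (m - δ))) x).trans ?_
    rw [hA, mul_assoc, Finset.sum_mul, snorm_sq]
    refine mul_le_mul_of_nonneg_left (Finset.sum_le_sum fun j hj => ?_) hC0.le
    refine (hD j f α hf hα).trans (mul_le_mul_of_nonneg_left ?_ (hD0 j))
    have hj : j ≤ 2 := by have := Finset.mem_range.1 hj; omega
    exact pow_le_pow_left₀ (snorm_nonneg _ _ _) (snorm_mono (by omega) δ f) 2
  have := jet_le_of_mderiv_le m hf.1 x key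
  rw [← mul_div_assoc, le_div_iff₀ hj] at this
  linarith

/-- A weighted Gagliardo–Nirenberg inequality. With `a = ∂ᵢf`, the integral of `∂ᵢ(f a³ ⟨x⟩^b)` is
zero. This expresses `∫ a⁴⟨x⟩^b` through terms with a factor `f`, and `f` is bounded by the
embedding. It substitutes for a pointwise bound on `a`, which would need three derivatives. -/
theorem integral_pderiv_pow_four_le (δ : ℝ) : ∃ C : ℝ, 0 ≤ C ∧ ∀ (f : E3 → ℝ) (i : Fin 3),
    IsTest f → ∫ x, pderiv i f x ^ 4 * jap x ^ (1 - 4 * δ) ≤ C * snorm 2 δ f ^ 4 := by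
  obtain ⟨C, hC0, hC⟩ := jet_le_snorm 0 δ
  -- Chosen so that `⟨x⟩^(2δ) ⟨x⟩^b`, the first factor coming from the bound on `f²`, is the weight
  -- of order 2.
  set b := 1 - 4 * δ with hb
  refine ⟨2 * (C ^ 2 * (9 + b ^ 2)), by positivity, fun f i hf => ?_⟩
  set a := pderiv i f with ha
  have hat : IsTest a := hf.pderiv i
  set N := snorm 2 δ f with hN
  have hsup : ∀ x, f x ^ 2 ≤ C ^ 2 * N ^ 2 * jap x ^ (2 * δ) := fun x => by
    have h := hC f hf x
    rw [jet_zero, Nat.cast_zero, zero_sub, Real.rpow_neg (jap_pos x).le, ← div_eq_mul_inv,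
      div_le_iff₀ (Real.rpow_pos_of_pos (jap_pos x) _)] at h
    have h2 := pow_le_pow_left₀ (abs_nonneg _) h 2
    rw [sq_abs] at h2
    refine h2.trans_eq ?_
    rw [mul_pow, mul_pow, ← Real.rpow_mul_natCast (jap_pos x).le, mul_comm δ]
    rfl
  have hρ := contDiff_jap_rpow b
  have hT : IsTest fun x => f x * (a x ^ 3 * jap x ^ b) := hf.mul ((hat.1.pow 3).mul hρ)
  have h0 := integral_pderiv_eq_zero hT i
  have hD : ∀ x, pderiv i (fun x => f x * (a x ^ 3 * jap x ^ b)) x =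
      a x ^ 4 * jap x ^ b + f x * (3 * a x ^ 2 * pderiv i a x) * jap x ^ b +
        f x * a x ^ 3 * (b * (x i * jap x ^ (b - 2))) := fun x => by
    have d1 := ((hf.1.differentiable (by simp)) x).hasFDerivAt
    have d2 := ((hat.1.differentiable (by simp)) x).hasFDerivAt
    have d3 := ((hρ.differentiable (by simp)) x).hasFDerivAt
    have d := d1.mul ((d2.pow 3).mul d3)
    have e3 := congrFun (pderiv_jap_rpow i b) x
    have hd : pderiv i (fun x => f x * (a x ^ 3 * jap x ^ b)) x =
      f x * (a x ^ 3 * pderiv i (fun x => jap x ^ b) x + jap x ^ b *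
        (3 * a x ^ 2 * pderiv i a x)) + a x ^ 3 * jap x ^ b * pderiv i f x := by
      unfold pderiv
      rw [HasFDerivAt.fderiv (f := fun x => f x * (a x ^ 3 * jap x ^ b)) d]
      simp
      ring
    rw [hd, e3, ← ha]
    ring
  have i1 : Integrable fun x => a x ^ 4 * jap x ^ b := by
    have := hat.integrable_mul ((hat.continuous.pow 3).mul hρ.continuous)
    refine this.congr (Filter.Eventually.of_forall fun x => ?_)
    simp
    ring
  have i2 := (hat.integrable_jet_sq 1 (continuous_weight δ 2))
  have i3 := hf.integrable_jet_sq 1 (continuous_weight δ 1)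
  have i2' := hf.integrable_jet_sq 2 (continuous_weight δ 2)
  -- Young's inequality spends a quarter of `a⁴` on the term with `∂ᵢa` and a quarter on the term
  -- where the weight is differentiated; half remains.
  have hpt : ∀ x, (1 / 2) * (a x ^ 4 * jap x ^ b) - (9 * (C ^ 2 * N ^ 2) *
      (jet 2 f x ^ 2 * weight δ 2 x) + b ^ 2 * (C ^ 2 * N ^ 2) * (jet 1 f x ^ 2 * weight δ 1 x)) ≤
      pderiv i (fun x => f x * (a x ^ 3 * jap x ^ b)) x := fun x => by
    rw [hD x]
    have jp := jap_pos x
    have hr := Real.rpow_pos_of_pos jp b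
    have p1 : -(1 / 4 * a x ^ 4 + 9 * f x ^ 2 * pderiv i a x ^ 2) * jap x ^ b ≤
        f x * (3 * a x ^ 2 * pderiv i a x) * jap x ^ b := by
      refine mul_le_mul_of_nonneg_right ?_ hr.le
      nlinarith [sq_nonneg (1 / 2 * a x ^ 2 + 3 * f x * pderiv i a x)]
    have hx : |x i / jap x| ≤ 1 := by
      rw [abs_div, abs_of_pos jp, div_le_one jp]
      exact (PiLp.norm_apply_le x i).trans (norm_le_jap x)
    have e2 : jap x ^ (b - 2) = jap x ^ b / jap x ^ 2 := by
      rw [Real.rpow_sub jp]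
      norm_num
    have p2 : -(1 / 4 * a x ^ 4 + b ^ 2 * f x ^ 2 * (a x ^ 2 / jap x ^ 2)) * jap x ^ b ≤
        f x * a x ^ 3 * (b * (x i * jap x ^ (b - 2))) := by
      have : f x * a x ^ 3 * (b * (x i * jap x ^ (b - 2))) =
          (a x ^ 2 * (b * f x * (a x / jap x) * (x i / jap x))) * jap x ^ b := by
        rw [e2]
        field_simp
      rw [this]
      refine mul_le_mul_of_nonneg_right ?_ hr.le
      have q1 : (b * f x * (a x / jap x) * (x i / jap x)) ^ 2 ≤
          b ^ 2 * f x ^ 2 * (a x ^ 2 / jap x ^ 2) := by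
        have : (x i / jap x) ^ 2 ≤ 1 := by
          rw [← sq_abs]
          exact pow_le_one₀ (abs_nonneg _) hx
        calc _ = (b * f x * (a x / jap x)) ^ 2 * (x i / jap x) ^ 2 := by ring
          _ ≤ (b * f x * (a x / jap x)) ^ 2 * 1 := by gcongr
          _ = _ := by ring
      nlinarith [sq_nonneg (1 / 2 * a x ^ 2 + b * f x * (a x / jap x) * (x i / jap x))]
    have w2 : jap x ^ (2 * δ) * jap x ^ b = weight δ 2 x := by
      rw [weight_eq, ← Real.rpow_add jp, hb]
      congr 1
      push_cast
      ring
    have w1 : jap x ^ (2 * δ) * jap x ^ b = weight δ 1 x * jap x ^ 2 := by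
      rw [weight_eq, ← Real.rpow_add jp, ← Real.rpow_natCast (jap x) 2, ← Real.rpow_add jp, hb]
      congr 1
      push_cast
      ring
    have j2 : pderiv i a x ^ 2 ≤ jet 2 f x ^ 2 := by
      refine sq_le_sq.2 ?_
      have h1 := jet_pderiv_le 0 i hat.1 x
      have h2 := jet_pderiv_le 1 i hf.1 x
      rw [jet_zero] at h1
      exact (h1.trans h2).trans (le_abs_self _)
    have j1 : a x ^ 2 ≤ jet 1 f x ^ 2 := by
      refine sq_le_sq.2 ?_
      have h1 := jet_pderiv_le 0 i hf.1 x
      rw [jet_zero] at h1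
      exact h1.trans (le_abs_self _)
    have q2 : f x ^ 2 * pderiv i a x ^ 2 * jap x ^ b ≤
        C ^ 2 * N ^ 2 * (jet 2 f x ^ 2 * weight δ 2 x) := by
      calc _ ≤ C ^ 2 * N ^ 2 * jap x ^ (2 * δ) * jet 2 f x ^ 2 * jap x ^ b := by
            gcongr
            exact hsup x
        _ = _ := by rw [← w2]; ring
    have q1 : f x ^ 2 * (a x ^ 2 / jap x ^ 2) * jap x ^ b ≤
        C ^ 2 * N ^ 2 * (jet 1 f x ^ 2 * weight δ 1 x) := by
      calc _ ≤ C ^ 2 * N ^ 2 * jap x ^ (2 * δ) * (jet 1 f x ^ 2 / jap x ^ 2) * jap x ^ b := by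
            gcongr
            exact hsup x
        _ = C ^ 2 * N ^ 2 * (jet 1 f x ^ 2 / jap x ^ 2) * (jap x ^ (2 * δ) * jap x ^ b) := by ring
        _ = _ := by
            rw [w1]
            field_simp
    nlinarith [mul_le_mul_of_nonneg_left q1 (sq_nonneg b)]
  have hmono := integral_mono ((i1.const_mul _).sub ((i2'.const_mul _).add (i3.const_mul _)))
    ((hT.pderiv i).continuous.integrable_of_hasCompactSupport (hT.pderiv i).2) hpt
  rw [h0, integral_sub' (i1.const_mul _) ((i2'.const_mul _).add (i3.const_mul _)),
    integral_add' (i2'.const_mul _) (i3.const_mul _), integral_const_mul, integral_const_mul,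
    integral_const_mul] at hmono
  have E1 : ∫ x, jet 1 f x ^ 2 * weight δ 1 x ≤ N ^ 2 :=
    energy_le_snorm_sq (k := 2) (by norm_num) δ f
  have E2 : ∫ x, jet 2 f x ^ 2 * weight δ 2 x ≤ N ^ 2 := energy_le_snorm_sq le_rfl δ f
  have F1 := mul_le_mul_of_nonneg_left E1 (by positivity : 0 ≤ b ^ 2 * (C ^ 2 * N ^ 2))
  have F2 := mul_le_mul_of_nonneg_left E2 (by positivity : 0 ≤ 9 * (C ^ 2 * N ^ 2))
  calc _ ≤ 2 * (9 * (C ^ 2 * N ^ 2) * N ^ 2 + b ^ 2 * (C ^ 2 * N ^ 2) * N ^ 2) := by linarith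
    _ = _ := by ring

/-! ### Product estimates. -/

theorem jet_add_le (m : ℕ) {f g : E3 → ℝ} (hf : ContDiff ℝ ∞ f) (hg : ContDiff ℝ ∞ g) (x : E3) :
    jet m (fun y => f y + g y) x ≤ jet m f x + jet m g x := by
  have := iteratedFDeriv_add_apply (𝕜 := ℝ) (i := m) (f := f) (g := g) (x := x)
    (hf.contDiffAt.of_le (by exact_mod_cast le_top)) (hg.contDiffAt.of_le (by exact_mod_cast le_top))
  rw [jet, jet, jet]
  exact (congrArg norm this).trans_le (norm_add_le _ _)

theorem jet_sub_const (m : ℕ) (f : E3 → ℝ) (c : ℝ) (x : E3) :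
    jet (m + 1) (fun y => f y - c) x = jet (m + 1) f x := by
  have : fderiv ℝ (fun y => f y - c) = fderiv ℝ f := by
    funext y
    exact fderiv_sub_const c
  rw [jet, ← norm_iteratedFDeriv_fderiv, this, norm_iteratedFDeriv_fderiv, jet]

/-- The factor `f - f(x)` vanishes at `x`, so the Leibniz term with all derivatives on `g` drops
out. This is the commutator estimate behind both the bound for the inverse and the cutoff. -/
theorem jet_sub_const_mul_le (m : ℕ) {f g : E3 → ℝ} (hf : ContDiff ℝ ∞ f) (hg : ContDiff ℝ ∞ g)
    (x : E3) : jet m (fun y => (f y - f x) * g y) x ≤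
      ∑ i ∈ Finset.range m, (m.choose (i + 1) : ℝ) * (jet (i + 1) f x * jet (m - (i + 1)) g x) := by
  refine (jet_mul_le m (hf.sub contDiff_const) hg x).trans_eq ?_
  rw [Finset.sum_range_succ']
  simp [jet_sub_const, mul_assoc]

theorem IsTest.integrable_jet_mul_jet_sq {f g : E3 → ℝ} (hf : IsTest f) (hg : IsTest g) (i j : ℕ)
    {w : E3 → ℝ} (hw : Continuous w) :
    Integrable fun x => (jet i f x * jet j g x) ^ 2 * w x := by
  simp only [mul_pow, mul_assoc]
  exact hf.integrable_jet_sq i (((continuous_jet j hg.1).pow 2).mul hw)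

/-- A product whose first factor is of low order. -/
theorem integral_jet_mul_jet_le_energy (i j : ℕ) {δ : ℝ} (hδ : δ ≤ 0) :
    ∃ C : ℝ, 0 ≤ C ∧ ∀ f g : E3 → ℝ, IsTest f → IsTest g →
      ∫ x, (jet i f x * jet j g x) ^ 2 * weight δ (i + j) x ≤
        C * snorm (i + 2) δ f ^ 2 * energy δ j g := by
  obtain ⟨C, hC0, hC⟩ := jet_le_snorm i δ
  refine ⟨C ^ 2, sq_nonneg C, fun f g hf hg => ?_⟩
  rw [energy, ← integral_const_mul]
  refine integral_mono (hf.integrable_jet_mul_jet_sq hg i j (continuous_weight _ _))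
    ((hg.integrable_jet_sq j (continuous_weight _ _)).const_mul _) fun x => ?_
  have jp := jap_pos x
  have h1 := pow_le_pow_left₀ (mul_nonneg (jet_nonneg _ _ _) (Real.rpow_nonneg jp.le _))
    (hC f hf x) 2
  -- The exponents differ by `-2δ`: this is where `δ ≤ 0` enters.
  have h2 : weight δ (i + j) x ≤ (jap x ^ (i - δ)) ^ 2 * weight δ j x := by
    rw [weight_eq, weight_eq, ← Real.rpow_mul_natCast jp.le, ← Real.rpow_add jp]
    refine Real.rpow_le_rpow_of_exponent_le (one_le_jap x) ?_
    push_cast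
    linarith
  have h3 := mul_le_mul_of_nonneg_left h2 (sq_nonneg (jet i f x * jet j g x))
  refine h3.trans ?_
  calc _ = (jet i f x * jap x ^ (i - δ)) ^ 2 * (jet j g x ^ 2 * weight δ j x) := by ring
    _ ≤ _ := by
      rw [← mul_pow]
      exact mul_le_mul_of_nonneg_right h1 (mul_nonneg (sq_nonneg _) (weight_pos _ _ _).le)

theorem integral_jet_one_pow_four_le (δ : ℝ) : ∃ C : ℝ, 0 ≤ C ∧ ∀ f : E3 → ℝ,
    IsTest f → ∫ x, jet 1 f x ^ 4 * jap x ^ (1 - 4 * δ) ≤ C * snorm 2 δ f ^ 4 := by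
  obtain ⟨C, hC0, hC⟩ := integral_pderiv_pow_four_le δ
  refine ⟨27 * (3 * C), by positivity, fun f hf => ?_⟩
  have hρ := (contDiff_jap_rpow (1 - 4 * δ)).continuous
  have hi : ∀ i, Integrable fun x => pderiv i f x ^ 4 * jap x ^ (1 - 4 * δ) := fun i => by
    have := (hf.pderiv i).integrable_mul (((hf.pderiv i).continuous.pow 3).mul hρ)
    refine this.congr (Filter.Eventually.of_forall fun x => ?_)
    simp
    ring
  have hj : Integrable fun x => jet 1 f x ^ 4 * jap x ^ (1 - 4 * δ) := by
    refine (hf.integrable_jet_mul_jet_sq hf 1 1 hρ).congr (Filter.Eventually.of_forall fun x => ?_)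
    simp only
    ring
  have h : ∫ x, jet 1 f x ^ 4 * jap x ^ (1 - 4 * δ) ≤
      ∫ x, 27 * ∑ i, pderiv i f x ^ 4 * jap x ^ (1 - 4 * δ) := by
    refine integral_mono hj ((integrable_finsetSum _ fun i _ => hi i).const_mul _) fun x => ?_
    have h1 := jet_succ_le 0 hf.1 x
    simp only [jet_zero] at h1
    have h2 := pow_le_pow_left₀ (jet_nonneg _ _ _) h1 4
    have h4 : (∑ i, |pderiv i f x|) ^ 4 ≤ 27 * ∑ i, pderiv i f x ^ 4 := by
      have := pow_sum_div_card_le_sum_pow (s := Finset.univ) (f := fun i => |pderiv i f x|)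
        (fun i _ => abs_nonneg _) 3
      rw [div_le_iff₀ (by simp)] at this
      simp only [Finset.card_univ, Fintype.card_fin] at this
      have e : ∀ i, |pderiv i f x| ^ 4 = pderiv i f x ^ 4 := fun i => by
        rw [Even.pow_abs (by decide)]
      simp only [e] at this
      refine this.trans_eq ?_
      push_cast
      ring
    rw [← Finset.sum_mul, ← mul_assoc]
    exact mul_le_mul_of_nonneg_right (h2.trans h4) (Real.rpow_nonneg (jap_pos x).le _)
  rw [integral_const_mul, integral_finsetSum _ fun i _ => hi i] at h
  refine h.trans ?_
  rw [mul_assoc, mul_assoc]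
  refine mul_le_mul_of_nonneg_left ((Finset.sum_le_sum fun i _ => hC f i hf).trans_eq ?_)
    (by norm_num)
  simp

/-- A factor with two derivatives to spare is estimated in the sup norm and the other in `L²`. The
only remaining case is a product of two first derivatives with `k = 2`, which is handled by
Cauchy–Schwarz and the `L⁴` bound. -/
theorem integral_jet_mul_jet_le {k : ℕ} (hk : 2 ≤ k) {δ : ℝ} (hδ : δ ≤ 0) {i j : ℕ}
    (hij : i + j ≤ k) : ∃ C : ℝ, 0 ≤ C ∧ ∀ f g : E3 → ℝ, IsTest f → IsTest g →
      ∫ x, (jet i f x * jet j g x) ^ 2 * weight δ (i + j) x ≤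
        C * (snorm k δ f * snorm k δ g) ^ 2 := by
  have sq_mono : ∀ {l : ℕ}, l ≤ k → ∀ f, snorm l δ f ^ 2 ≤ snorm k δ f ^ 2 := fun hl f =>
    pow_le_pow_left₀ (snorm_nonneg _ _ _) (snorm_mono hl δ f) 2
  by_cases hi : i + 2 ≤ k
  · obtain ⟨C, hC0, hC⟩ := integral_jet_mul_jet_le_energy i j hδ
    refine ⟨C, hC0, fun f g hf hg => (hC f g hf hg).trans ?_⟩
    rw [mul_pow, mul_assoc]
    exact mul_le_mul_of_nonneg_left (mul_le_mul (sq_mono hi f) (energy_le_snorm_sq (by omega) δ g)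
      (energy_nonneg _ _ _) (sq_nonneg _)) hC0
  by_cases hj : j + 2 ≤ k
  · obtain ⟨C, hC0, hC⟩ := integral_jet_mul_jet_le_energy j i hδ
    refine ⟨C, hC0, fun f g hf hg => ?_⟩
    have h := hC g f hg hf
    rw [add_comm i j]
    simp only [mul_comm (jet i f _)]
    refine h.trans ?_
    rw [mul_comm (snorm k δ f), mul_pow, mul_assoc]
    exact mul_le_mul_of_nonneg_left (mul_le_mul (sq_mono hj g) (energy_le_snorm_sq (by omega) δ f)
      (energy_nonneg _ _ _) (sq_nonneg _)) hC0
  -- Here `i, j ≥ k - 1` and `i + j ≤ k`, so `k = 2` and `i = j = 1`.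
  obtain rfl : k = 2 := by omega
  obtain rfl : i = 1 := by omega
  obtain rfl : j = 1 := by omega
  obtain ⟨C, hC0, hC⟩ := integral_jet_one_pow_four_le δ
  refine ⟨C, hC0, fun f g hf hg => ?_⟩
  have hρ := (contDiff_jap_rpow (1 - 4 * δ)).continuous
  set q : E3 → ℝ := fun x => Real.sqrt (jap x ^ (1 - 4 * δ)) with hq
  have hqc : Continuous q := hρ.sqrt
  have hq2 : ∀ x, q x ^ 2 = jap x ^ (1 - 4 * δ) := fun x =>
    Real.sq_sqrt (Real.rpow_nonneg (jap_pos x).le _)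
  have hmem : ∀ f : E3 → ℝ, IsTest f →
      MemLp (fun x => jet 1 f x ^ 2 * q x) (ENNReal.ofReal 2) volume := fun f hf =>
    (((continuous_jet 1 hf.1).pow 2).mul hqc).memLp_of_hasCompactSupport
      (hasCompactSupport_jet_sq 1 hf.2).mul_right
  have hval : ∀ f : E3 → ℝ, IsTest f →
      (∫ x, (jet 1 f x ^ 2 * q x) ^ (2 : ℝ)) ^ (1 / 2 : ℝ) ≤
        Real.sqrt C * snorm 2 δ f ^ 2 := fun f hf => by
    rw [← Real.sqrt_eq_rpow]
    refine Real.sqrt_le_iff.2 ⟨by positivity, ?_⟩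
    rw [mul_pow, Real.sq_sqrt hC0, ← pow_mul]
    refine le_trans (le_of_eq ?_) (hC f hf)
    refine integral_congr_ae (Filter.Eventually.of_forall fun x => ?_)
    simp only
    rw [Real.rpow_two, mul_pow, hq2]
    ring
  have hH := integral_mul_le_Lp_mul_Lq_of_nonneg (μ := (volume : Measure E3))
    Real.HolderConjugate.two_two
    (Filter.Eventually.of_forall fun x => mul_nonneg (sq_nonneg (jet 1 f x)) (Real.sqrt_nonneg _))
    (Filter.Eventually.of_forall fun x => mul_nonneg (sq_nonneg (jet 1 g x)) (Real.sqrt_nonneg _))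
    (hmem f hf) (hmem g hg)
  have h1 : ∫ x, (jet 1 f x * jet 1 g x) ^ 2 * weight δ (1 + 1) x ≤
      ∫ x, jet 1 f x ^ 2 * q x * (jet 1 g x ^ 2 * q x) := by
    have e : ∀ x, jet 1 f x ^ 2 * q x * (jet 1 g x ^ 2 * q x) =
        (jet 1 f x * jet 1 g x) ^ 2 * jap x ^ (1 - 4 * δ) := fun x => by
      rw [← hq2]
      ring
    simp only [e]
    refine integral_mono (hf.integrable_jet_mul_jet_sq hg 1 1 (continuous_weight _ _))
      (hf.integrable_jet_mul_jet_sq hg 1 1 hρ) fun x => ?_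
    refine mul_le_mul_of_nonneg_left ?_ (sq_nonneg _)
    rw [weight_eq]
    refine Real.rpow_le_rpow_of_exponent_le (one_le_jap x) ?_
    push_cast
    linarith
  refine h1.trans (hH.trans ?_)
  refine (mul_le_mul (hval f hf) (hval g hg) (by positivity) (by positivity)).trans_eq ?_
  calc _ = Real.sqrt C ^ 2 * (snorm 2 δ f * snorm 2 δ g) ^ 2 := by ring
    _ = _ := by rw [Real.sq_sqrt hC0]

theorem snorm_le_of_energy_le {k : ℕ} {δ : ℝ} {f : E3 → ℝ} {B : ℝ} (hB : 0 ≤ B)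
    (h : ∀ m ≤ k, energy δ m f ≤ B ^ 2) : snorm k δ f ≤ (k + 1) * B := by
  refine Real.sqrt_le_iff.2 ⟨by positivity, ?_⟩
  refine (Finset.sum_le_sum fun m hm => h m (by simpa [Nat.lt_succ_iff] using hm)).trans ?_
  rw [Finset.sum_const, nsmul_eq_mul, Finset.card_range, mul_pow]
  push_cast
  refine mul_le_mul_of_nonneg_right ?_ (sq_nonneg B)
  have : (0 : ℝ) ≤ k := Nat.cast_nonneg k
  nlinarith

theorem snorm_mul_le {k : ℕ} (hk : 2 ≤ k) {δ : ℝ} (hδ : δ ≤ 0) :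
    ∃ C : ℝ, 0 ≤ C ∧ ∀ f g : E3 → ℝ, IsTest f → IsTest g →
      snorm k δ (fun x => f x * g x) ≤ C * snorm k δ f * snorm k δ g := by
  -- The dummy constant `0` outside the range `i + j ≤ k` lets `choose` produce a function of all
  -- pairs.
  have hex : ∀ i j, ∃ C : ℝ, 0 ≤ C ∧ (i + j ≤ k → ∀ f g : E3 → ℝ, IsTest f → IsTest g →
      ∫ x, (jet i f x * jet j g x) ^ 2 * weight δ (i + j) x ≤
        C * (snorm k δ f * snorm k δ g) ^ 2) := fun i j => by
    by_cases h : i + j ≤ k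
    · obtain ⟨C, h0, hC⟩ := integral_jet_mul_jet_le hk hδ h
      exact ⟨C, h0, fun _ => hC⟩
    · exact ⟨0, le_rfl, fun h' => absurd h' h⟩
  choose C hC0 hC using hex
  set D : ℕ → ℝ := fun m => (m + 1) * ∑ i ∈ Finset.range (m + 1),
    (m.choose i : ℝ) ^ 2 * C i (m - i) with hD
  have hD0 : ∀ m, 0 ≤ D m := fun m => mul_nonneg (by positivity)
    (Finset.sum_nonneg fun i _ => mul_nonneg (sq_nonneg _) (hC0 _ _))
  set A := ∑ m ∈ Finset.range (k + 1), D m with hA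
  have hA0 : 0 ≤ A := Finset.sum_nonneg fun m _ => hD0 m
  refine ⟨(k + 1) * Real.sqrt A, by positivity, fun f g hf hg => ?_⟩
  have hN := snorm_nonneg k δ f
  have hN' := snorm_nonneg k δ g
  rw [mul_assoc, mul_assoc]
  refine snorm_le_of_energy_le (by positivity) fun m hm => ?_
  rw [mul_pow, Real.sq_sqrt hA0]
  have hint : ∀ i ≤ m, Integrable fun x =>
      (m.choose i : ℝ) ^ 2 * ((jet i f x * jet (m - i) g x) ^ 2 * weight δ m x) := fun i _ =>
    (hf.integrable_jet_mul_jet_sq hg i (m - i) (continuous_weight _ _)).const_mul _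
  have hle : ∀ {i}, i ∈ Finset.range (m + 1) → i ≤ m := fun hi => by
    simpa [Nat.lt_succ_iff] using hi
  have h1 : energy δ m (fun x => f x * g x) ≤ ∫ x, (m + 1) * ∑ i ∈ Finset.range (m + 1),
      (m.choose i : ℝ) ^ 2 * ((jet i f x * jet (m - i) g x) ^ 2 * weight δ m x) := by
    refine integral_mono ((hf.mul hg.1).integrable_jet_sq m (continuous_weight _ _))
      ((integrable_finsetSum _ fun i hi => hint i (hle hi)).const_mul _) fun x => ?_
    have b := (pow_le_pow_left₀ (jet_nonneg _ _ _) (jet_mul_le m hf.1 hg.1 x) 2).trans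
      sq_sum_le_card_mul_sum_sq
    refine (mul_le_mul_of_nonneg_right b (weight_pos δ m x).le).trans_eq ?_
    rw [Finset.card_range, mul_assoc, Finset.sum_mul]
    push_cast
    congr 1
    refine Finset.sum_congr rfl fun i _ => ?_
    ring
  rw [integral_const_mul, integral_finsetSum _ fun i hi => hint i (hle hi)] at h1
  refine h1.trans ?_
  refine le_trans ?_ (mul_le_mul_of_nonneg_right (Finset.single_le_sum (f := D)
    (fun m _ => hD0 m) (Finset.mem_range.2 (by omega : m < k + 1))) (sq_nonneg _))
  rw [hD, mul_assoc, Finset.sum_mul]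
  refine mul_le_mul_of_nonneg_left (Finset.sum_le_sum fun i hi => ?_) (by positivity)
  rw [integral_const_mul, mul_assoc]
  refine mul_le_mul_of_nonneg_left ?_ (sq_nonneg _)
  have := hC i (m - i) (by have := hle hi; omega) f g hf hg
  rwa [Nat.add_sub_cancel' (hle hi)] at this

/-! ### Estimates for the quasi-inverse of a test function. -/

theorem IsTest.inverse {φ : E3 → ℝ} (hφ : IsTest φ) (h : ∀ x, 0 < 1 + φ x) :
    IsTest fun x => 1 / (1 + φ x) - 1 := by
  -- The factor `φ` makes the compact support visible.
  have he : (fun x => 1 / (1 + φ x) - 1) = fun x => φ x * (-1 / (1 + φ x)) := by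
    funext x
    have := (h x).ne'
    field_simp
    ring
  rw [he]
  exact hφ.mul (contDiff_const.div (contDiff_const.add hφ.1) fun x => (h x).ne')

/-- Freeze the coefficient at `x`: `(1 + φ(x)) w = -φ - (φ - φ(x)) w`. After `m` derivatives at `x`,
the top-order derivative of `w` stands only on the left, and everything else on `w` has lower order.
-/
theorem mul_jet_le_of_inverse {φ w : E3 → ℝ} {c : ℝ} (hc : 0 ≤ c) (hφ : IsTest φ) (hw : IsTest w)
    (hlow : ∀ x, c ≤ 1 + φ x) (hinv : ∀ x, (1 + φ x) * w x = -φ x) (m : ℕ) (x : E3) :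
    c * jet m w x ≤ jet m φ x + ∑ i ∈ Finset.range m,
      (m.choose (i + 1) : ℝ) * (jet (i + 1) φ x * jet (m - (i + 1)) w x) := by
  have he : (fun y => (1 + φ x) * w y) =
      fun y => -1 * φ y + -1 * ((φ y - φ x) * w y) := by
    funext y
    linarith [hinv y]
  have hs : ContDiff ℝ ∞ fun y => (φ y - φ x) * w y := (hφ.1.sub contDiff_const).mul hw.1
  have h1 : jet m (fun y => (1 + φ x) * w y) x ≤ jet m φ x + jet m (fun y => (φ y - φ x) * w y) x := by
    rw [he]
    refine (jet_add_le m (contDiff_const.mul hφ.1) (contDiff_const.mul hs) x).trans_eq ?_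
    rw [jet_const_mul m _ hφ.1, jet_const_mul m _ hs]
    simp
  rw [jet_const_mul m _ hw.1, abs_of_nonneg (hc.trans (hlow x))] at h1
  refine (mul_le_mul_of_nonneg_right (hlow x) (jet_nonneg _ _ _)).trans (h1.trans ?_)
  exact add_le_add le_rfl (jet_sub_const_mul_le m hφ.1 hw.1 x)

/-- A priori bound for the quasi-inverse `w = 1/(1+φ) - 1` in the weighted Sobolev norm. -/
theorem snorm_inverse_le {k : ℕ} (hk : 2 ≤ k) {δ : ℝ} (hδ : δ ≤ 0) {c : ℝ} (hc : 0 < c) (R : ℝ) :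
    ∃ M : ℝ, 0 ≤ M ∧ ∀ φ w : E3 → ℝ, IsTest φ → IsTest w → snorm k δ φ ≤ R →
      (∀ x, c ≤ 1 + φ x) → (∀ x, (1 + φ x) * w x = -φ x) → snorm k δ w ≤ M := by
  wlog hR : 0 ≤ R generalizing R
  · exact ⟨0, le_rfl, fun φ w _ _ h => absurd ((snorm_nonneg _ _ _).trans h) hR⟩
  obtain ⟨S, hS0, hS⟩ := jet_le_snorm 0 δ
  set L := (1 + S * R / c) / c with hL
  have hL0 : 0 ≤ L := by positivity
  -- In orders 0 and 1 the function `w` is dominated pointwise by `φ`; this uses only the sup bound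
  -- `|φ| ≤ S R` and the lower bound `c`.
  have hlow : ∀ n ≤ 1, ∀ φ w : E3 → ℝ, IsTest φ → IsTest w → snorm k δ φ ≤ R →
      (∀ x, c ≤ 1 + φ x) → (∀ x, (1 + φ x) * w x = -φ x) → ∀ x, jet n w x ≤ L * jet n φ x := by
    intro n hn φ w hφ hw hφR hφc hinv x
    have hsup : |φ x| ≤ S * R := by
      have h := hS φ hφ x
      rw [jet_zero] at h
      have h1 : 1 ≤ jap x ^ ((0 : ℕ) - δ) := Real.one_le_rpow (one_le_jap x) (by simpa using hδ)
      have h2 : snorm (0 + 2) δ φ ≤ R := (snorm_mono (by omega) δ φ).trans hφR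
      nlinarith [abs_nonneg (φ x)]
    have h0 := mul_jet_le_of_inverse hc.le hφ hw hφc hinv 0 x
    have h1 := mul_jet_le_of_inverse hc.le hφ hw hφc hinv 1 x
    simp only [Finset.range_zero, Finset.sum_empty, add_zero, jet_zero] at h0
    simp only [Finset.range_one, Finset.sum_singleton, zero_add, Nat.choose_self, Nat.cast_one,
      one_mul, Nat.sub_self, jet_zero] at h1
    have hw0 : |w x| ≤ S * R / c := by
      rw [le_div_iff₀ hc]
      linarith
    rw [hL, div_mul_eq_mul_div, le_div_iff₀ hc]
    interval_cases n
    · simp only [jet_zero]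
      have : 0 ≤ S * R / c * |φ x| := by positivity
      linarith
    · have := mul_le_mul_of_nonneg_left hw0 (jet_nonneg 1 φ x)
      linarith
  have main : ∀ m, m ≤ k → ∃ M : ℝ, 0 ≤ M ∧ ∀ φ w : E3 → ℝ, IsTest φ → IsTest w →
      snorm k δ φ ≤ R → (∀ x, c ≤ 1 + φ x) → (∀ x, (1 + φ x) * w x = -φ x) →
        energy δ m w ≤ M := by
    intro m
    induction m using Nat.strong_induction_on with
    | _ m ih =>
    intro hm
    have hterm : ∀ i, ∃ K : ℝ, 0 ≤ K ∧ (i < m → ∀ φ w : E3 → ℝ, IsTest φ → IsTest w →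
        snorm k δ φ ≤ R → (∀ x, c ≤ 1 + φ x) → (∀ x, (1 + φ x) * w x = -φ x) →
          ∫ x, (jet (i + 1) φ x * jet (m - (i + 1)) w x) ^ 2 * weight δ m x ≤ K) := by
      intro i
      by_cases hi : i < m
      swap
      · exact ⟨0, le_rfl, fun h => absurd h hi⟩
      have him : i + 1 + (m - (i + 1)) = m := by omega
      -- If at most one derivative falls on `w`, too many may fall on `φ` for a sup bound. Then `w`
      -- is replaced by `φ` through `hlow` and the product estimate is used for `φ` with itself.
      by_cases h1 : m - (i + 1) ≤ 1
      · obtain ⟨C, hC0, hC⟩ := integral_jet_mul_jet_le hk hδ (i := i + 1) (j := m - (i + 1))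
          (by omega)
        rw [him] at hC
        refine ⟨L ^ 2 * (C * (R * R) ^ 2), by positivity, fun _ φ w hφ hw hφR hφc hinv => ?_⟩
        have h2 : ∫ x, (jet (i + 1) φ x * jet (m - (i + 1)) w x) ^ 2 * weight δ m x ≤
            ∫ x, L ^ 2 * ((jet (i + 1) φ x * jet (m - (i + 1)) φ x) ^ 2 * weight δ m x) := by
          refine integral_mono (hφ.integrable_jet_mul_jet_sq hw _ _ (continuous_weight _ _))
            ((hφ.integrable_jet_mul_jet_sq hφ _ _ (continuous_weight _ _)).const_mul _)
            fun x => ?_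
          have h3 := mul_le_mul_of_nonneg_left (hlow _ h1 φ w hφ hw hφR hφc hinv x)
            (jet_nonneg (i + 1) φ x)
          have h4 := pow_le_pow_left₀ (mul_nonneg (jet_nonneg _ _ _) (jet_nonneg _ _ _)) h3 2
          refine (mul_le_mul_of_nonneg_right h4 (weight_pos δ m x).le).trans_eq ?_
          ring
        rw [integral_const_mul] at h2
        refine h2.trans (mul_le_mul_of_nonneg_left ((hC φ φ hφ hφ).trans ?_) (sq_nonneg L))
        have := snorm_nonneg k δ φ
        gcongr
      -- At least two derivatives fall on `w`, so `(i + 1) + 2 ≤ m ≤ k`: the derivative of `φ` is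
      -- bounded in the sup norm, and the energy of `w` of order below `m` by induction.
      · obtain ⟨C, hC0, hC⟩ := integral_jet_mul_jet_le_energy (i + 1) (m - (i + 1)) hδ
        obtain ⟨M, hM0, hM⟩ := ih (m - (i + 1)) (by omega) (by omega)
        rw [him] at hC
        refine ⟨C * R ^ 2 * M, by positivity, fun _ φ w hφ hw hφR hφc hinv => ?_⟩
        refine (hC φ w hφ hw).trans ?_
        have h2 : snorm (i + 1 + 2) δ φ ≤ R := (snorm_mono (by omega) δ φ).trans hφR
        have h3 := hM φ w hφ hw hφR hφc hinv
        have := snorm_nonneg (i + 1 + 2) δ φ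
        have := energy_nonneg δ (m - (i + 1)) w
        gcongr
    choose K hK0 hK using hterm
    set T := 2 * R ^ 2 + 2 * (m * ∑ i ∈ Finset.range m, (m.choose (i + 1) : ℝ) ^ 2 * K i) with hT
    have hT0 : 0 ≤ T := by
      have : 0 ≤ ∑ i ∈ Finset.range m, (m.choose (i + 1) : ℝ) ^ 2 * K i :=
        Finset.sum_nonneg fun i _ => mul_nonneg (sq_nonneg _) (hK0 i)
      positivity
    refine ⟨T / c ^ 2, by positivity, fun φ w hφ hw hφR hφc hinv => ?_⟩
    rw [le_div_iff₀ (pow_pos hc 2), mul_comm, energy, ← integral_const_mul]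
    have i1 := hφ.integrable_jet_sq m (continuous_weight δ m)
    have i2 : ∀ i ∈ Finset.range m, Integrable fun x => (m.choose (i + 1) : ℝ) ^ 2 *
        ((jet (i + 1) φ x * jet (m - (i + 1)) w x) ^ 2 * weight δ m x) := fun i _ =>
      (hφ.integrable_jet_mul_jet_sq hw _ _ (continuous_weight _ _)).const_mul _
    have i3 := ((integrable_finsetSum _ i2).const_mul (m : ℝ)).const_mul 2
    have hle : ∫ x, c ^ 2 * (jet m w x ^ 2 * weight δ m x) ≤
        ∫ x, (2 * (jet m φ x ^ 2 * weight δ m x) + 2 * (m * ∑ i ∈ Finset.range m,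
          (m.choose (i + 1) : ℝ) ^ 2 *
            ((jet (i + 1) φ x * jet (m - (i + 1)) w x) ^ 2 * weight δ m x))) := by
      refine integral_mono ((hw.integrable_jet_sq m (continuous_weight _ _)).const_mul _)
        ((i1.const_mul 2).add i3) fun x => ?_
      have h1 := pow_le_pow_left₀ (mul_nonneg hc.le (jet_nonneg _ _ _))
        (mul_jet_le_of_inverse hc.le hφ hw hφc hinv m x) 2
      have h2 := h1.trans add_sq_le
      have h3 := sq_sum_le_card_mul_sum_sq (s := Finset.range m)
        (f := fun i => (m.choose (i + 1) : ℝ) * (jet (i + 1) φ x * jet (m - (i + 1)) w x))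
      rw [Finset.card_range] at h3
      have h4 : (c * jet m w x) ^ 2 ≤ 2 * (jet m φ x ^ 2 + m * ∑ i ∈ Finset.range m,
        ((m.choose (i + 1) : ℝ) * (jet (i + 1) φ x * jet (m - (i + 1)) w x)) ^ 2) := by linarith
      have h5 := mul_le_mul_of_nonneg_right h4 (weight_pos δ m x).le
      simp only
      have e : ∑ i ∈ Finset.range m, (m.choose (i + 1) : ℝ) ^ 2 *
            ((jet (i + 1) φ x * jet (m - (i + 1)) w x) ^ 2 * weight δ m x) =
          (∑ i ∈ Finset.range m, ((m.choose (i + 1) : ℝ) *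
            (jet (i + 1) φ x * jet (m - (i + 1)) w x)) ^ 2) * weight δ m x := by
        rw [Finset.sum_mul]
        exact Finset.sum_congr rfl fun i _ => by ring
      rw [e]
      refine le_trans (le_of_eq ?_) (h5.trans_eq ?_) <;> ring
    refine hle.trans ?_
    rw [integral_add (i1.const_mul 2) i3, integral_const_mul, integral_const_mul,
      integral_const_mul, integral_finsetSum _ i2, hT]
    have h1 : ∫ x, jet m φ x ^ 2 * weight δ m x ≤ R ^ 2 :=
      (energy_le_snorm_sq hm δ φ).trans (pow_le_pow_left₀ (snorm_nonneg _ _ _) hφR 2)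
    have h2 : ∑ i ∈ Finset.range m, ∫ x, (m.choose (i + 1) : ℝ) ^ 2 *
        ((jet (i + 1) φ x * jet (m - (i + 1)) w x) ^ 2 * weight δ m x) ≤
          ∑ i ∈ Finset.range m, (m.choose (i + 1) : ℝ) ^ 2 * K i := by
      refine Finset.sum_le_sum fun i hi => ?_
      rw [integral_const_mul]
      exact mul_le_mul_of_nonneg_left (hK i (Finset.mem_range.1 hi) φ w hφ hw hφR hφc hinv)
        (sq_nonneg _)
    gcongr
  have hex : ∀ m, ∃ M : ℝ, 0 ≤ M ∧ (m ≤ k → ∀ φ w : E3 → ℝ, IsTest φ → IsTest w →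
      snorm k δ φ ≤ R → (∀ x, c ≤ 1 + φ x) → (∀ x, (1 + φ x) * w x = -φ x) →
        energy δ m w ≤ M) := fun m => by
    by_cases h : m ≤ k
    · obtain ⟨M, h0, hM⟩ := main m h
      exact ⟨M, h0, fun _ => hM⟩
    · exact ⟨0, le_rfl, fun h' => absurd h' h⟩
  choose M hM0 hM using hex
  refine ⟨Real.sqrt (∑ m ∈ Finset.range (k + 1), M m), Real.sqrt_nonneg _,
    fun φ w hφ hw hφR hφc hinv => Real.sqrt_le_sqrt (Finset.sum_le_sum fun m hm => ?_)⟩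
  exact hM m (by simpa [Nat.lt_succ_iff] using hm) φ w hφ hw hφR hφc hinv

/-! ### Completeness -/

theorem zero_mem_multiIdx (k : ℕ) : (0 : Fin 3 → ℕ) ∈ multiIdx k := mem_multiIdx.2 (by simp)

theorem H.locallyIntegrable {k : ℕ} {δ : ℝ} (u : H k δ) : LocallyIntegrable u :=
  (u.isWeakDeriv (zero_mem_multiIdx k)).1

theorem H.weakDeriv_zero {k : ℕ} {δ : ℝ} (u : H k δ) : weakDeriv 0 u.toAE = u.toAE :=
  weakDeriv_eq ⟨u.locallyIntegrable, u.locallyIntegrable, fun φ _ _ => by simp⟩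

theorem sqrt_weight_pos (δ : ℝ) (m : ℕ) (x : E3) : 0 < Real.sqrt (weight δ m x) :=
  Real.sqrt_pos.2 (weight_pos δ m x)

/-- A test function divided by the square root of the weight, as an element of `L²`. -/
noncomputable def dualTest (δ : ℝ) (m : ℕ) (φ : E3 → ℝ) (hφ : IsTest φ) :
    Lp ℝ 2 (volume : Measure E3) :=
  (((hφ.continuous.mul ((continuous_weight δ m).sqrt.inv₀
    fun x => (sqrt_weight_pos δ m x).ne')).memLp_of_hasCompactSupport (p := 2)
      hφ.2.mul_right : MemLp (fun x => φ x * (Real.sqrt (weight δ m x))⁻¹) 2 volume)).toLp _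

theorem inner_dualTest (δ : ℝ) (m : ℕ) {φ : E3 → ℝ} (hφ : IsTest φ)
    (g : Lp ℝ 2 (volume : Measure E3)) :
    inner ℝ (dualTest δ m φ hφ) g = ∫ x, (Real.sqrt (weight δ m x))⁻¹ * g x * φ x := by
  rw [L2.inner_def]
  refine integral_congr_ae ?_
  filter_upwards [MemLp.coeFn_toLp (((hφ.continuous.mul ((continuous_weight δ m).sqrt.inv₀
    fun x => (sqrt_weight_pos δ m x).ne')).memLp_of_hasCompactSupport (p := 2)
      hφ.2.mul_right : MemLp (fun x => φ x * (Real.sqrt (weight δ m x))⁻¹) 2 volume))] with x hx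
  simp only [dualTest, hx]
  simp
  ring

theorem H.embed_apply_coe {k : ℕ} {δ : ℝ} (u : H k δ) (α : multiIdx k) :
    ((H.embed u).ofLp α : E3 → ℝ) =ᵐ[volume]
      fun x => Real.sqrt (weight δ (order α.1) x) * weakDeriv α.1 u.toAE x :=
  (memLp_scaled.2 (u.weightedL2 α.2)).coeFn_toLp

/-- Testing a weak derivative against `φ` is thus a continuous functional on the target of `embed`,
so distributional identities pass to limits there. -/
theorem H.inner_dualTest_embed {k : ℕ} {δ : ℝ} (u : H k δ) (α : multiIdx k) {φ : E3 → ℝ}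
    (hφ : IsTest φ) : inner ℝ (dualTest δ (order α.1) φ hφ) ((H.embed u).ofLp α) =
      ∫ x, weakDeriv α.1 u.toAE x * φ x := by
  rw [inner_dualTest]
  refine integral_congr_ae ?_
  filter_upwards [u.embed_apply_coe α] with x hx
  rw [hx, inv_mul_cancel_left₀ (sqrt_weight_pos _ _ x).ne']

theorem locallyIntegrable_inv_sqrt_weight_mul (δ : ℝ) (m : ℕ) (g : Lp ℝ 2 (volume : Measure E3)) :
    LocallyIntegrable fun x => (Real.sqrt (weight δ m x))⁻¹ * g x := by
  have hg : LocallyIntegrable g := (Lp.memLp g).locallyIntegrable one_le_two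
  rw [locallyIntegrable_iff] at hg ⊢
  intro K hK
  exact (hg K hK).continuousOn_mul ((continuous_weight δ m).sqrt.inv₀
    fun x => (sqrt_weight_pos δ m x).ne').continuousOn hK

/-- The isometry `embed` has closed range. Removing the weights from the components of the limit
gives candidates `G α`, and the limit of the tested identities says that `G α` is the weak
derivative of `G 0`. Completeness is inherited from the ambient `L²` sum. -/
theorem H.exists_embed_eq_of_tendsto {k : ℕ} {δ : ℝ} {u : ℕ → H k δ}
    {l : PiLp 2 fun _ : multiIdx k => Lp ℝ 2 (volume : Measure E3)}
    (h : Filter.Tendsto (fun n => H.embed (u n)) Filter.atTop (𝓝 l)) :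
    ∃ v : H k δ, H.embed v = l := by
  have hcomp : ∀ α, Filter.Tendsto (fun n => (H.embed (u n)).ofLp α) Filter.atTop
      (𝓝 (l.ofLp α)) := fun α =>
    ((PiLp.continuous_apply 2 (fun _ : multiIdx k => Lp ℝ 2 (volume : Measure E3)) α).tendsto
      l).comp h
  set G : multiIdx k → E3 → ℝ := fun α x =>
    (Real.sqrt (weight δ (order α.1) x))⁻¹ * l.ofLp α x with hG
  have hGl : ∀ α, LocallyIntegrable (G α) := fun α => locallyIntegrable_inv_sqrt_weight_mul _ _ _
  have hGm : ∀ α, AEStronglyMeasurable (G α) volume := fun α => (hGl α).aestronglyMeasurable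
  have hlim : ∀ (α : multiIdx k) (φ : E3 → ℝ), IsTest φ →
      Filter.Tendsto (fun n => ∫ x, weakDeriv α.1 (u n).toAE x * φ x) Filter.atTop
        (𝓝 (∫ x, G α x * φ x)) := fun α φ hφ => by
    have := (tendsto_const_nhds (x := dualTest δ (order α.1) φ hφ)).inner (𝕜 := ℝ) (hcomp α)
    rw [inner_dualTest] at this
    exact this.congr fun n => (u n).inner_dualTest_embed α hφ
  have hweak : ∀ α : multiIdx k, IsWeakDeriv α.1 (G ⟨0, zero_mem_multiIdx k⟩) (G α) := by
    refine fun α => ⟨hGl _, hGl _, fun φ hφ hc => ?_⟩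
    have h1 := hlim ⟨0, zero_mem_multiIdx k⟩ _ (IsTest.mderiv ⟨hφ, hc⟩ α.1)
    have h2 := (hlim α φ ⟨hφ, hc⟩).const_mul ((-1) ^ order α.1)
    refine tendsto_nhds_unique h1 (h2.congr fun n => ?_)
    rw [H.weakDeriv_zero]
    exact (((u n).isWeakDeriv α.2).2.2 φ hφ hc).symm
  have hweak' : ∀ α : multiIdx k, IsWeakDeriv α.1
      (AEEqFun.mk _ (hGm ⟨0, zero_mem_multiIdx k⟩) : E3 →ₘ[volume] ℝ)
      (AEEqFun.mk _ (hGm α) : E3 →ₘ[volume] ℝ) := fun α =>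
    (hweak α).congr (AEEqFun.coeFn_mk _ _).symm (AEEqFun.coeFn_mk _ _).symm
  have hL2 : ∀ α : multiIdx k, scaled δ (order α.1) (AEEqFun.mk _ (hGm α)) =ᵐ[volume]
      l.ofLp α := fun α => by
    filter_upwards [AEEqFun.coeFn_mk _ (hGm α)] with x hx
    rw [scaled, hx, mul_inv_cancel_left₀ (sqrt_weight_pos _ _ x).ne']
  let v : H k δ := ⟨AEEqFun.mk _ (hGm ⟨0, zero_mem_multiIdx k⟩), fun α hα =>
    ⟨AEEqFun.mk _ (hGm ⟨α, hα⟩), hweak' ⟨α, hα⟩,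
      memLp_scaled.1 ((memLp_congr_ae (hL2 ⟨α, hα⟩)).2 (Lp.memLp _))⟩⟩
  refine ⟨v, ?_⟩
  ext1 α
  refine Lp.ext ((v.embed_apply_coe α).trans ?_)
  have hv : weakDeriv α.1 v.toAE = AEEqFun.mk _ (hGm α) := weakDeriv_eq (hweak' α)
  rw [hv]
  exact hL2 α

instance (k : ℕ) (δ : ℝ) : CompleteSpace (H k δ) := by
  refine Metric.complete_of_cauchySeq_tendsto fun u hu => ?_
  have hnorm : ∀ a b : H k δ, dist (H.embed a) (H.embed b) = dist a b := fun a b => by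
    rw [dist_eq_norm, dist_eq_norm, ← map_sub, H.norm_embed]
  have hc : CauchySeq fun n => H.embed (u n) := by
    rw [Metric.cauchySeq_iff] at hu ⊢
    simpa only [hnorm] using hu
  obtain ⟨l, hl⟩ := cauchySeq_tendsto_of_complete hc
  obtain ⟨v, rfl⟩ := H.exists_embed_eq_of_tendsto hl
  refine ⟨v, ?_⟩
  rw [tendsto_iff_dist_tendsto_zero] at hl ⊢
  simpa only [hnorm] using hl

/-! ### Mollification -/

theorem contDiff_mollify {u η : E3 → ℝ} (hu : LocallyIntegrable u) (hη : IsTest η) :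
    ContDiff ℝ ∞ (u ⋆[ContinuousLinearMap.mul ℝ ℝ, volume] η) :=
  hη.2.contDiff_convolution_right _ hu hη.1

theorem pderiv_mollify {u η : E3 → ℝ} (hu : LocallyIntegrable u) (hη : IsTest η) (i : Fin 3) :
    pderiv i (u ⋆[ContinuousLinearMap.mul ℝ ℝ, volume] η) =
      u ⋆[ContinuousLinearMap.mul ℝ ℝ, volume] pderiv i η := by
  funext x
  have h := hη.2.hasFDerivAt_convolution_right (ContinuousLinearMap.mul ℝ ℝ) hu
    (hη.1.of_le (by exact_mod_cast le_top)) x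
  rw [pderiv, h.fderiv]
  exact convolution_precompR_apply _ hu (hη.2.fderiv ℝ)
    (hη.1.continuous_fderiv (by simp)) x _

theorem mderiv_mollify_eq_convolution {u η : E3 → ℝ} (hu : LocallyIntegrable u) (hη : IsTest η)
    (α : Fin 3 → ℕ) : mderiv α (u ⋆[ContinuousLinearMap.mul ℝ ℝ, volume] η) =
      u ⋆[ContinuousLinearMap.mul ℝ ℝ, volume] mderiv α η := by
  induction α using order_induction generalizing η with
  | h0 => simp
  | hs i α ih =>
    rw [← mderiv_pderiv i α (contDiff_mollify hu hη), pderiv_mollify hu hη, ih (hη.pderiv i),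
      mderiv_pderiv i α hη.1]

theorem mderiv_comp_const_sub {η : E3 → ℝ} (hη : ContDiff ℝ ∞ η) (x : E3) (α : Fin 3 → ℕ) :
    mderiv α (fun t => η (x - t)) = fun t => (-1) ^ order α * mderiv α η (x - t) := by
  have hp : ∀ (i : Fin 3) {f : E3 → ℝ}, ContDiff ℝ ∞ f →
      pderiv i (fun t => f (x - t)) = fun t => -pderiv i f (x - t) := fun i f hf => by
    funext t
    have h := ((hf.differentiable (by simp)) (x - t)).hasFDerivAt.comp t
      ((hasFDerivAt_const x t).sub (hasFDerivAt_id t))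
    rw [pderiv, HasFDerivAt.fderiv (f := fun t => f (x - t)) h]
    simp [pderiv]
  induction α using order_induction generalizing η with
  | h0 => simp
  | hs i α ih =>
    have hs : ContDiff ℝ ∞ fun t => η (x - t) := hη.comp (contDiff_const.sub contDiff_id)
    have hd := contDiff_mderiv α hη
    have hc : ContDiff ℝ ∞ fun t => mderiv α η (x - t) := hd.comp (contDiff_const.sub contDiff_id)
    rw [← mderiv_pderiv i α hs, ← pderiv_mderiv i α hs, ih hη, order_add_single,
      ← mderiv_pderiv i α hη, ← pderiv_mderiv i α hη]
    funext t
    have h1 : pderiv i (fun t => (-1) ^ order α * mderiv α η (x - t)) t =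
        (-1) ^ order α * pderiv i (fun t => mderiv α η (x - t)) t := by
      unfold pderiv
      rw [fderiv_const_mul ((hc.differentiable (by simp)) t)]
      simp
    rw [h1, hp i hd]
    ring

theorem IsTest.comp_const_sub {η : E3 → ℝ} (hη : IsTest η) (x : E3) :
    IsTest fun t => η (x - t) :=
  ⟨hη.1.comp (contDiff_const.sub contDiff_id),
    hη.2.comp_homeomorph (Homeomorph.subLeft x)⟩

/-- Mollification commutes with weak differentiation. -/
theorem IsWeakDeriv.mderiv_mollify {α : Fin 3 → ℕ} {u v η : E3 → ℝ} (h : IsWeakDeriv α u v)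
    (hη : IsTest η) : mderiv α (u ⋆[ContinuousLinearMap.mul ℝ ℝ, volume] η) =
      v ⋆[ContinuousLinearMap.mul ℝ ℝ, volume] η := by
  rw [mderiv_mollify_eq_convolution h.1 hη]
  funext x
  have hx := hη.comp_const_sub x
  -- Tested with `t ↦ η(x - t)`, whose `α`-th derivative carries a sign `(-1)^|α|` that cancels the
  -- one in the definition of weak derivative.
  have h1 := h.2.2 _ hx.1 hx.2
  rw [mderiv_comp_const_sub hη.1] at h1
  have h2 : ∫ t, u t * ((-1) ^ order α * mderiv α η (x - t)) =
      (-1) ^ order α * ∫ t, u t * mderiv α η (x - t) := by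
    rw [← integral_const_mul]
    exact integral_congr_ae (Filter.Eventually.of_forall fun t => by simp only; ring)
  rw [h2] at h1
  exact mul_left_cancel₀ (pow_ne_zero _ (by norm_num)) h1

/-- Translations act continuously on `L²`; this is continuity at `y = 0`, stated with lower
integrals for the use of Tonelli below. -/
theorem exists_translation_bound {f : E3 → ℝ} (hf : MemLp f 2 volume) {ε : ENNReal}
    (hε : 0 < ε) : ∃ r > 0, ∀ y : E3, ‖y‖ < r → ∫⁻ x, ‖f (x - y) - f x‖ₑ ^ 2 ≤ ε := by
  set F := hf.toLp f
  let g : E3 → C(E3, E3) := fun y => ⟨fun x => x - y, by fun_prop⟩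
  have hgm : ∀ y, MeasurePreserving (g y) volume volume := fun y =>
    measurePreserving_sub_right volume y
  have hg : Continuous g := ContinuousMap.continuous_of_continuous_uncurry _
    (by simp only [g]; exact continuous_snd.sub continuous_fst)
  have hc : Continuous fun y => Lp.compMeasurePreserving (g y) (hgm y) F :=
    continuous_const.compMeasurePreservingLp hg hgm (by simp)
  have h0 : Lp.compMeasurePreserving (g 0) (hgm 0) F = F := by
    refine Lp.ext ((Lp.coeFn_compMeasurePreserving F (hgm 0)).trans ?_)
    refine Filter.Eventually.of_forall fun x => ?_
    simp [g]
  have ht := hc.tendsto 0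
  rw [h0] at ht
  obtain ⟨κ, hκ0, hκ⟩ : ∃ κ : ℝ, 0 < κ ∧ ENNReal.ofReal κ ^ 2 ≤ ε := by
    by_cases he : ε = ⊤
    · exact ⟨1, one_pos, by simp [he]⟩
    refine ⟨Real.sqrt ε.toReal, Real.sqrt_pos.2 (ENNReal.toReal_pos hε.ne' he), ?_⟩
    rw [← ENNReal.ofReal_pow (Real.sqrt_nonneg _), Real.sq_sqrt ENNReal.toReal_nonneg,
      ENNReal.ofReal_toReal he]
  obtain ⟨r, hr0, hr⟩ := Metric.tendsto_nhds_nhds.1 ht κ hκ0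
  refine ⟨r, hr0, fun y hy => ?_⟩
  have h1 := hr (x := y) (by simpa using hy)
  rw [dist_eq_norm, Lp.norm_def] at h1
  have h2 : (fun x => f (x - y) - f x) =ᵐ[volume]
      (Lp.compMeasurePreserving (g y) (hgm y) F - F : Lp ℝ 2 volume) := by
    filter_upwards [Lp.coeFn_sub (Lp.compMeasurePreserving (g y) (hgm y) F) F,
      Lp.coeFn_compMeasurePreserving F (hgm y), hf.coeFn_toLp,
      (hgm y).quasiMeasurePreserving.ae_eq_comp hf.coeFn_toLp] with x e1 e2 e3 e4
    rw [e1, Pi.sub_apply, e2, e3, e4]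
    rfl
  have h3 := (ENNReal.lt_ofReal_iff_toReal_lt (Lp.eLpNorm_ne_top _)).2 h1
  rw [← eLpNorm_congr_ae h2] at h3
  refine le_trans (le_of_eq ?_) ((pow_le_pow_left' h3.le 2).trans hκ)
  rw [eLpNorm_eq_lintegral_rpow_enorm_toReal (by norm_num) (by norm_num), ← ENNReal.rpow_natCast,
    ← ENNReal.rpow_mul]
  simp

/-- A mollifier: a nonnegative test function of integral one supported near the origin. -/
structure IsMollifier (η : E3 → ℝ) (r : ℝ) : Prop where
  test : IsTest η
  nonneg : ∀ x, 0 ≤ η x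
  integral_eq_one : ∫ x, η x = 1
  norm_lt : ∀ x, η x ≠ 0 → ‖x‖ < r

theorem exists_isMollifier {r : ℝ} (hr : 0 < r) : ∃ η, IsMollifier η r := by
  let b : ContDiffBump (0 : E3) := ⟨r / 2, r, by linarith, by linarith⟩
  refine ⟨b.normed volume, ⟨b.contDiff_normed, b.hasCompactSupport_normed⟩,
    fun x => b.nonneg_normed x, b.integral_normed, fun x hx => ?_⟩
  have : x ∈ Function.support (b.normed volume) := hx
  rw [b.support_normed_eq] at this
  simpa [b] using this

/-- `η dy` is a probability measure and `f ⋆ η - f` is the average of `f(· - y) - f` against it.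
Cauchy–Schwarz moves the square inside the average, and Tonelli reduces the claim to single
translates. -/
theorem lintegral_mollify_sub_le {f η : E3 → ℝ} {r : ℝ} (hf : MemLp f 2 volume)
    (hfm : Measurable f) (hη : IsMollifier η r) {κ : ENNReal}
    (h : ∀ y : E3, ‖y‖ < r → ∫⁻ x, ‖f (x - y) - f x‖ₑ ^ 2 ≤ κ) :
    ∫⁻ x, ‖(f ⋆[ContinuousLinearMap.mul ℝ ℝ, volume] η) x - f x‖ₑ ^ 2 ≤ κ := by
  have hloc : LocallyIntegrable f := hf.locallyIntegrable one_le_two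
  set ν : Measure E3 := volume.withDensity fun y => ENNReal.ofReal (η y) with hν
  have hηm : Measurable fun y => ENNReal.ofReal (η y) := hη.test.continuous.measurable.ennreal_ofReal
  have hηi : Integrable η := hη.test.continuous.integrable_of_hasCompactSupport hη.test.2
  have hν1 : ν Set.univ = 1 := by
    rw [hν, withDensity_apply _ MeasurableSet.univ, Measure.restrict_univ,
      ← ofReal_integral_eq_lintegral_ofReal hηi (Filter.Eventually.of_forall hη.nonneg),
      hη.integral_eq_one, ENNReal.ofReal_one]
  have : IsProbabilityMeasure ν := ⟨hν1⟩
  have hpt : ∀ x, ‖(f ⋆[ContinuousLinearMap.mul ℝ ℝ, volume] η) x - f x‖ₑ ^ 2 ≤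
      ∫⁻ y, ‖f (x - y) - f x‖ₑ ^ 2 ∂ν := fun x => by
    have hi : Integrable fun y => f (x - y) * η y := by
      have := integrable_mul_test hloc (hη.test.comp_const_sub x).continuous
        (hη.test.comp_const_sub x).2
      have := this.comp_sub_left x
      simpa using this
    have e1 : (f ⋆[ContinuousLinearMap.mul ℝ ℝ, volume] η) x - f x =
        ∫ y, (f (x - y) - f x) * η y := by
      rw [convolution_eq_swap]
      simp only [ContinuousLinearMap.mul_apply', sub_mul]
      rw [integral_sub hi (hηi.const_mul _), integral_const_mul, hη.integral_eq_one, mul_one]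
    have e2 : ‖(f ⋆[ContinuousLinearMap.mul ℝ ℝ, volume] η) x - f x‖ₑ ≤
        ∫⁻ y, ‖f (x - y) - f x‖ₑ ∂ν := by
      rw [e1]
      refine (enorm_integral_le_lintegral_enorm _).trans_eq ?_
      rw [hν, lintegral_withDensity_eq_lintegral_mul _ hηm (by fun_prop)]
      refine lintegral_congr fun y => ?_
      rw [enorm_mul, Pi.mul_apply, mul_comm, Real.enorm_of_nonneg (hη.nonneg y)]
    have e3 := ENNReal.lintegral_mul_le_Lp_mul_Lq ν Real.HolderConjugate.two_two
      (f := fun y => ‖f (x - y) - f x‖ₑ) (g := fun _ => 1) (by fun_prop) (by fun_prop)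
    simp only [Pi.mul_apply, mul_one, ENNReal.one_rpow, lintegral_one, hν1] at e3
    refine (pow_le_pow_left' (e2.trans e3) 2).trans_eq ?_
    rw [← ENNReal.rpow_natCast, ← ENNReal.rpow_mul]
    simp
  refine (lintegral_mono hpt).trans ?_
  rw [lintegral_lintegral_swap (by fun_prop)]
  have hmeas : Measurable fun y => ∫⁻ x, ‖f (x - y) - f x‖ₑ ^ 2 := by
    refine Measurable.lintegral_prod_right' (f := fun z : E3 × E3 => ‖f (z.2 - z.1) - f z.2‖ₑ ^ 2) ?_
    fun_prop
  have : ∀ᵐ y ∂ν, ∫⁻ x, ‖f (x - y) - f x‖ₑ ^ 2 ≤ κ := by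
    rw [hν, ae_withDensity_iff hηm]
    refine Filter.Eventually.of_forall fun y hy => h y (hη.norm_lt y fun h0 => hy ?_)
    simp [h0]
  refine (lintegral_mono_ae this).trans ?_
  simp

/-- Mollifications converge locally in `L²`. -/
theorem exists_mollify_bound {v : E3 → ℝ} (hv : LocallyIntegrable fun x => v x ^ 2)
    (hvm : Measurable v) (ρ : ℝ) {κ : ENNReal} (hκ : 0 < κ) :
    ∃ r > 0, ∀ η, IsMollifier η r → ∫⁻ x in Metric.closedBall (0 : E3) ρ,
      ‖(v ⋆[ContinuousLinearMap.mul ℝ ℝ, volume] η) x - v x‖ₑ ^ 2 ≤ κ := by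
  -- Truncation makes `v` globally square integrable. The margin 1 matches the bound `r ≤ 1` on the
  -- mollifier, so that `f ⋆ η = v ⋆ η` on the ball of radius `ρ`.
  set f : E3 → ℝ := (Metric.closedBall (0 : E3) (ρ + 1)).indicator v with hf
  have hfm : Measurable f := hvm.indicator measurableSet_closedBall
  have hf2 : MemLp f 2 volume := by
    rw [memLp_two_iff_integrable_sq hfm.aestronglyMeasurable]
    have h1 : (fun x => f x ^ 2) =
        (Metric.closedBall (0 : E3) (ρ + 1)).indicator fun x => v x ^ 2 := by
      funext x
      by_cases hx : x ∈ Metric.closedBall (0 : E3) (ρ + 1) <;> simp [hf, hx]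
    rw [h1, integrable_indicator_iff measurableSet_closedBall]
    exact hv.integrableOn_isCompact (isCompact_closedBall _ _)
  obtain ⟨r, hr0, hr⟩ := exists_translation_bound hf2 hκ
  refine ⟨min r 1, by positivity, fun η hη => ?_⟩
  have hη' : IsMollifier η r := ⟨hη.test, hη.nonneg, hη.integral_eq_one,
    fun x hx => (hη.norm_lt x hx).trans_le (min_le_left _ _)⟩
  refine le_trans ?_ (lintegral_mollify_sub_le hf2 hfm hη' hr)
  refine le_trans (le_of_eq ?_) (setLIntegral_le_lintegral (Metric.closedBall (0 : E3) ρ) _)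
  refine setLIntegral_congr_fun measurableSet_closedBall fun x hx => ?_
  rw [mem_closedBall_zero_iff] at hx
  have e1 : f x = v x := Set.indicator_of_mem (by simp; linarith) v
  have e2 : (f ⋆[ContinuousLinearMap.mul ℝ ℝ, volume] η) x =
      (v ⋆[ContinuousLinearMap.mul ℝ ℝ, volume] η) x := by
    rw [convolution_def, convolution_def]
    refine integral_congr_ae (Filter.Eventually.of_forall fun t => ?_)
    simp only [ContinuousLinearMap.mul_apply']
    by_cases h0 : η (x - t) = 0
    · simp [h0]
    · have h1 := (hη.norm_lt _ h0).trans_le (min_le_right _ _)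
      have h2 : ‖t‖ ≤ ‖x‖ + ‖x - t‖ := by
        have := norm_sub_le x (x - t)
        simpa using this
      rw [hf, Set.indicator_of_mem (by simp; linarith)]
  simp only [e1, e2]

/-! ### Density of test functions -/

/-- The cutoffs are dilations `b(x/n)` of one bump. Derivatives of order `j ≥ 1` are of size
`n^(-j)` and live where `n ≤ ‖x‖ ≤ 2n`, so `⟨x⟩ ≤ 3n` there and `⟨x⟩^j |D^jχ|` is bounded uniformly
in `n`. This is the scaling of the weights. -/
theorem exists_cutoff (k : ℕ) : ∃ K : ℝ, 0 ≤ K ∧ ∀ n : ℝ, 1 ≤ n → ∃ χ : E3 → ℝ, IsTest χ ∧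
    (∀ x, 0 ≤ χ x ∧ χ x ≤ 1) ∧ (∀ x, ‖x‖ < n → χ x = 1) ∧ (∀ x, 2 * n < ‖x‖ → χ x = 0) ∧
      ∀ i, i ≤ k → ∀ x, jet (i + 1) χ x * jap x ^ (i + 1) ≤ K ∧
        (jet (i + 1) χ x ≠ 0 → n ≤ ‖x‖ ∧ ‖x‖ ≤ 2 * n) := by
  let b : ContDiffBump (0 : E3) := ⟨1, 2, one_pos, one_lt_two⟩
  have hb : IsTest b := ⟨b.contDiff, b.hasCompactSupport⟩
  have hB : ∀ i, ∃ B, ∀ x, ‖jet i b x‖ ≤ B := fun i =>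
    (hasCompactSupport_jet i hb.2).exists_bound_of_continuous (continuous_jet i hb.1)
  choose B hB using hB
  have hB0 : ∀ i, 0 ≤ B i := fun i => (norm_nonneg _).trans (hB i 0)
  refine ⟨∑ i ∈ Finset.range (k + 1), 3 ^ (i + 1) * B (i + 1), Finset.sum_nonneg fun i _ =>
    mul_nonneg (by positivity) (hB0 _), fun n hn => ?_⟩
  have hn0 : 0 < n := one_pos.trans_le hn
  let L : E3 →L[ℝ] E3 := n⁻¹ • ContinuousLinearMap.id ℝ E3
  have hL : ∀ x, ‖L x‖ = ‖x‖ / n := fun x => by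
    simp [L, norm_smul, abs_of_pos hn0, inv_mul_eq_div]
  have h1 : ∀ x, ‖x‖ < n → (b ∘ L) x = 1 := fun x hx => b.one_of_mem_closedBall (by
    rw [mem_closedBall_zero_iff, hL, div_le_iff₀ hn0]
    simpa [b] using hx.le)
  have h2 : ∀ x, 2 * n < ‖x‖ → (b ∘ L) x = 0 := fun x hx => b.zero_of_le_dist (by
    rw [dist_zero_right, hL, le_div_iff₀ hn0]
    simpa [b] using hx.le)
  have hχ : ContDiff ℝ ∞ (b ∘ L) := hb.1.comp L.contDiff
  have hsupp : HasCompactSupport (b ∘ L) := by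
    refine HasCompactSupport.intro (isCompact_closedBall (0 : E3) (2 * n)) fun x hx => h2 x ?_
    simpa using hx
  refine ⟨b ∘ L, ⟨hχ, hsupp⟩, fun x => ⟨b.nonneg, b.le_one⟩, h1, h2, fun i hi x => ?_⟩
  have hz : jet (i + 1) (b ∘ L) x ≠ 0 → n ≤ ‖x‖ ∧ ‖x‖ ≤ 2 * n := by
    intro h
    by_contra hcon
    have hconst : ∃ c : ℝ, (b ∘ L) =ᶠ[𝓝 x] fun _ => c := by
      by_cases hx : n ≤ ‖x‖
      · have hx2 : 2 * n < ‖x‖ := not_le.1 fun h' => hcon ⟨hx, h'⟩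
        refine ⟨0, ?_⟩
        filter_upwards [(isOpen_lt continuous_const continuous_norm).mem_nhds hx2] with y hy
        exact h2 y hy
      · refine ⟨1, ?_⟩
        filter_upwards [(isOpen_lt continuous_norm continuous_const).mem_nhds (not_le.1 hx)]
          with y hy
        exact h1 y hy
    obtain ⟨c, hc⟩ := hconst
    apply h
    rw [jet, (Filter.EventuallyEq.iteratedFDeriv ℝ hc (i + 1)).eq_of_nhds, iteratedFDeriv_succ_const]
    simp
  refine ⟨?_, hz⟩
  refine le_trans ?_ (Finset.single_le_sum (f := fun i => 3 ^ (i + 1) * B (i + 1))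
    (fun i _ => mul_nonneg (by positivity) (hB0 _)) (Finset.mem_range.2 (by omega : i < k + 1)))
  by_cases h0 : jet (i + 1) (b ∘ L) x = 0
  · rw [h0, zero_mul]
    exact mul_nonneg (by positivity) (hB0 _)
  obtain ⟨-, hx⟩ := hz h0
  have hLn : ‖L‖ ≤ n⁻¹ := ContinuousLinearMap.opNorm_le_bound _ (by positivity) fun x => by
    rw [hL, inv_mul_eq_div]
  have hj : jet (i + 1) (b ∘ L) x ≤ B (i + 1) * n⁻¹ ^ (i + 1) := by
    rw [jet, L.iteratedFDeriv_comp_right hb.1 x (i := i + 1) (by exact_mod_cast le_top)]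
    refine (ContinuousMultilinearMap.norm_compContinuousLinearMap_le _ _).trans ?_
    rw [Finset.prod_const, Finset.card_univ, Fintype.card_fin]
    exact mul_le_mul ((le_abs_self _).trans (hB (i + 1) (L x)))
      (pow_le_pow_left₀ (norm_nonneg _) hLn _) (by positivity) (hB0 _)
  have hjap : jap x ≤ 3 * n := (jap_le x).trans (by linarith)
  have jp := jap_pos x
  calc _ ≤ B (i + 1) * n⁻¹ ^ (i + 1) * (3 * n) ^ (i + 1) :=
        mul_le_mul hj (pow_le_pow_left₀ jp.le hjap _) (by positivity)
          (mul_nonneg (hB0 _) (by positivity))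
    _ = _ := by
      rw [mul_assoc, ← mul_pow, mul_left_comm, inv_mul_cancel₀ hn0.ne']
      ring

/-- In the application `g` is a mollification of `u` and `v β` the value at `x` of the weak
derivative `∂^β u`. The error splits into `χ(∂^αg - v)`, `-(1-χ)v` and a commutator supported in the
annulus. The indicator `a` marks the tail, where integrability of `v` helps; `b` marks the ball,
where closeness of `g` to `u` helps; on the annulus both are 1. -/
theorem cutoff_error_le {k : ℕ} {K n : ℝ} {χ g : E3 → ℝ} (hK : 0 ≤ K)
    (hχ : IsTest χ) (h01 : ∀ x, 0 ≤ χ x ∧ χ x ≤ 1) (h1 : ∀ x, ‖x‖ < n → χ x = 1)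
    (h2 : ∀ x, 2 * n < ‖x‖ → χ x = 0)
    (hj : ∀ i, i ≤ k → ∀ x, jet (i + 1) χ x * jap x ^ (i + 1) ≤ K ∧
        (jet (i + 1) χ x ≠ 0 → n ≤ ‖x‖ ∧ ‖x‖ ≤ 2 * n)) (hg : ContDiff ℝ ∞ g)
    (v : (Fin 3 → ℕ) → ℝ) {α : Fin 3 → ℕ} (hα : α ∈ multiIdx k) (x : E3) {a b : ℝ}
    (ha : a = if n ≤ ‖x‖ then 1 else 0) (hb : b = if ‖x‖ ≤ 2 * n then 1 else 0) :
    |mderiv α (fun y => χ y * g y) x - v α| * jap x ^ order α ≤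
      (2 + 2 ^ k * (K * 3 ^ k)) * ∑ β ∈ multiIdx k,
        jap x ^ order β * (a * |v β| + b * |mderiv β g x - v β|) := by
  set Y := ∑ β ∈ multiIdx k, jap x ^ order β * (a * |v β| + b * |mderiv β g x - v β|) with hY
  have jp := jap_pos x
  have ha0 : 0 ≤ a := by rw [ha]; split_ifs <;> norm_num
  have hb0 : 0 ≤ b := by rw [hb]; split_ifs <;> norm_num
  have hY0 : ∀ β ∈ multiIdx k,
      0 ≤ jap x ^ order β * (a * |v β| + b * |mderiv β g x - v β|) := fun β _ => by positivity
  have hYle : ∀ β ∈ multiIdx k,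
      jap x ^ order β * (a * |v β| + b * |mderiv β g x - v β|) ≤ Y := fun β hβ =>
    Finset.single_le_sum hY0 hβ
  have hYn : 0 ≤ Y := Finset.sum_nonneg hY0
  set m := order α with hm
  have hmk : m ≤ k := mem_multiIdx.1 hα
  have hgχ : ContDiff ℝ ∞ fun y => (χ y - χ x) * g y := (hχ.1.sub contDiff_const).mul hg
  have hlin : mderiv α (fun y => χ y * g y) x =
      χ x * mderiv α g x + mderiv α (fun y => (χ y - χ x) * g y) x := by
    have hadd : ∀ (c : ℝ) (p q : E3 → ℝ), ContDiff ℝ ∞ p → ContDiff ℝ ∞ q →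
        mderiv α (fun y => c * p y + q y) = fun y => c * mderiv α p y + mderiv α q y := by
      intro c p q hp hq
      clear_value Y m
      clear hY hm hα hY0 hYle
      induction α using order_induction generalizing p q with
      | h0 => rfl
      | hs i α ih =>
        have : pderiv i (fun y => c * p y + q y) = fun y => c * pderiv i p y + pderiv i q y := by
          funext y
          have e1 := (hp.differentiable (by simp)) y
          have e2 := (hq.differentiable (by simp)) y
          unfold pderiv
          rw [fderiv_fun_add (e1.const_mul c) e2, fderiv_const_mul e1]
          simp
        rw [← mderiv_pderiv i α ((contDiff_const.mul hp).add hq), this,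
          ih _ _ (contDiff_pderiv i hp) (contDiff_pderiv i hq), mderiv_pderiv i α hp,
          mderiv_pderiv i α hq]
    have := congrFun (hadd (χ x) g _ hg hgχ) x
    rw [← this]
    congr 1
    funext y
    ring
  have hrem : |mderiv α (fun y => (χ y - χ x) * g y) x| * jap x ^ m ≤
      2 ^ k * (K * 3 ^ k) * Y := by
    have e1 := (abs_mderiv_le α hgχ x).trans (jet_sub_const_mul_le m hχ.1 hg x)
    refine (mul_le_mul_of_nonneg_right e1 (by positivity)).trans ?_
    rw [Finset.sum_mul]
    have e2 : ∀ i ∈ Finset.range m, (m.choose (i + 1) : ℝ) *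
        (jet (i + 1) χ x * jet (m - (i + 1)) g x) * jap x ^ m ≤
          (m.choose (i + 1) : ℝ) * ((K * 3 ^ k) * Y) := by
      intro i hi
      have hi := Finset.mem_range.1 hi
      rw [mul_assoc]
      refine mul_le_mul_of_nonneg_left ?_ (Nat.cast_nonneg _)
      by_cases h0 : jet (i + 1) χ x = 0
      · rw [h0, zero_mul, zero_mul]
        positivity
      obtain ⟨hn1, hn2⟩ := (hj i (by omega) x).2 h0
      rw [if_pos hn1] at ha
      rw [if_pos hn2] at hb
      have e3 : jet (m - (i + 1)) g x ≤ 3 ^ (m - (i + 1)) * (Y / jap x ^ (m - (i + 1))) := by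
        refine jet_le_of_mderiv_le _ hg x fun β hβ => ?_
        rw [le_div_iff₀ (by positivity), mul_comm, ← hβ]
        refine le_trans ?_ (hYle β (mem_multiIdx.2 (by omega)))
        refine mul_le_mul_of_nonneg_left ?_ (by positivity)
        rw [ha, hb, one_mul, one_mul]
        have := abs_add_le (v β) (mderiv β g x - v β)
        rwa [add_sub_cancel] at this
      have e4 : jap x ^ m = jap x ^ (i + 1) * jap x ^ (m - (i + 1)) := by
        rw [← pow_add]
        congr 1
        omega
      calc _ = (jet (i + 1) χ x * jap x ^ (i + 1)) *
            (jet (m - (i + 1)) g x * jap x ^ (m - (i + 1))) := by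
            rw [e4]
            ring
        _ ≤ K * (3 ^ k * Y) := by
            refine mul_le_mul (hj i (by omega) x).1 ?_
              (mul_nonneg (jet_nonneg _ _ _) (by positivity)) hK
            rw [← mul_div_assoc, le_div_iff₀ (by positivity)] at e3
            refine e3.trans (mul_le_mul_of_nonneg_right ?_ hYn)
            exact pow_le_pow_right₀ (by norm_num) (by omega)
        _ = _ := by ring
    refine (Finset.sum_le_sum e2).trans ?_
    rw [← Finset.sum_mul, mul_assoc (2 ^ k)]
    refine mul_le_mul_of_nonneg_right ?_ (by positivity)
    have e5 : ∑ i ∈ Finset.range m, (m.choose (i + 1) : ℝ) ≤ 2 ^ m := by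
      have := Nat.sum_range_choose m
      rw [Finset.sum_range_succ'] at this
      have : ∑ i ∈ Finset.range m, m.choose (i + 1) ≤ 2 ^ m := by omega
      exact_mod_cast this
    exact e5.trans (pow_le_pow_right₀ (by norm_num) hmk)
  have hA : |(1 - χ x) * v α| * jap x ^ m ≤ Y := by
    refine le_trans ?_ (hYle α hα)
    rw [mul_comm]
    refine mul_le_mul_of_nonneg_left ?_ (by positivity)
    have : |(1 - χ x) * v α| ≤ a * |v α| := by
      rw [abs_mul]
      refine mul_le_mul_of_nonneg_right ?_ (abs_nonneg _)
      rw [ha]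
      split_ifs with h
      · rw [abs_of_nonneg (by linarith [(h01 x).2])]
        linarith [(h01 x).1]
      · rw [h1 x (not_le.1 h)]
        simp
    have : 0 ≤ b * |mderiv α g x - v α| := by positivity
    linarith
  have hB : |χ x * (mderiv α g x - v α)| * jap x ^ m ≤ Y := by
    refine le_trans ?_ (hYle α hα)
    rw [mul_comm]
    refine mul_le_mul_of_nonneg_left ?_ (by positivity)
    have : |χ x * (mderiv α g x - v α)| ≤ b * |mderiv α g x - v α| := by
      rw [abs_mul]
      refine mul_le_mul_of_nonneg_right ?_ (abs_nonneg _)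
      rw [hb]
      split_ifs with h
      · rw [abs_of_nonneg (h01 x).1]
        exact (h01 x).2
      · rw [h2 x (not_le.1 h)]
        simp
    have : 0 ≤ a * |v α| := by positivity
    linarith
  have hsplit : mderiv α (fun y => χ y * g y) x - v α = χ x * (mderiv α g x - v α) +
      -((1 - χ x) * v α) + mderiv α (fun y => (χ y - χ x) * g y) x := by
    rw [hlin]
    ring
  have htri : |mderiv α (fun y => χ y * g y) x - v α| ≤ |χ x * (mderiv α g x - v α)| +
      |(1 - χ x) * v α| + |mderiv α (fun y => (χ y - χ x) * g y) x| := by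
    rw [hsplit]
    refine (abs_add_le _ _).trans (add_le_add_left ((abs_add_le _ _).trans ?_) _)
    rw [abs_neg]
  have := mul_le_mul_of_nonneg_right htri (by positivity : 0 ≤ jap x ^ m)
  linarith

theorem cutoff_error_sq_le {k : ℕ} {K n : ℝ} {χ g : E3 → ℝ} (hK : 0 ≤ K)
    (hχ : IsTest χ) (h01 : ∀ x, 0 ≤ χ x ∧ χ x ≤ 1) (h1 : ∀ x, ‖x‖ < n → χ x = 1)
    (h2 : ∀ x, 2 * n < ‖x‖ → χ x = 0)
    (hj : ∀ i, i ≤ k → ∀ x, jet (i + 1) χ x * jap x ^ (i + 1) ≤ K ∧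
        (jet (i + 1) χ x ≠ 0 → n ≤ ‖x‖ ∧ ‖x‖ ≤ 2 * n)) (hg : ContDiff ℝ ∞ g) (δ : ℝ)
    (v : (Fin 3 → ℕ) → ℝ) {α : Fin 3 → ℕ} (hα : α ∈ multiIdx k) (x : E3) :
    (mderiv α (fun y => χ y * g y) x - v α) ^ 2 * weight δ (order α) x ≤
      (2 + 2 ^ k * (K * 3 ^ k)) ^ 2 * ((multiIdx k).card * 2) * ∑ β ∈ multiIdx k,
        ((if n ≤ ‖x‖ then v β ^ 2 * weight δ (order β) x else 0) +
          (if ‖x‖ ≤ 2 * n then (mderiv β g x - v β) ^ 2 * weight δ (order β) x else 0)) := by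
  set a : ℝ := if n ≤ ‖x‖ then 1 else 0 with ha
  set b : ℝ := if ‖x‖ ≤ 2 * n then 1 else 0 with hb
  have key := cutoff_error_le hK hχ h01 h1 h2 hj hg v hα x ha hb
  have jp := jap_pos x
  have hw : ∀ m, weight δ m x = (jap x ^ m) ^ 2 * jap x ^ (-3 - 2 * δ) := fun m => by
    rw [weight_eq, ← pow_mul, ← Real.rpow_natCast, ← Real.rpow_add jp]
    congr 1
    push_cast
    ring
  have ha2 : a ^ 2 = a := by rw [ha]; split_ifs <;> norm_num
  have hb2 : b ^ 2 = b := by rw [hb]; split_ifs <;> norm_num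
  have hp := Real.rpow_pos_of_pos jp (-3 - 2 * δ)
  have h3 := pow_le_pow_left₀ (by positivity) key 2
  rw [mul_pow, mul_pow, sq_abs] at h3
  have h4 : (∑ β ∈ multiIdx k, jap x ^ order β * (a * |v β| + b * |mderiv β g x - v β|)) ^ 2 ≤
      ((multiIdx k).card * 2) * ∑ β ∈ multiIdx k,
        (jap x ^ order β) ^ 2 * (a * v β ^ 2 + b * (mderiv β g x - v β) ^ 2) := by
    refine sq_sum_le_card_mul_sum_sq.trans ?_
    rw [mul_assoc, Finset.mul_sum _ _ (2 : ℝ)]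
    refine mul_le_mul_of_nonneg_left (Finset.sum_le_sum fun β _ => ?_) (Nat.cast_nonneg _)
    rw [mul_pow, mul_left_comm]
    refine mul_le_mul_of_nonneg_left (add_sq_le.trans_eq ?_) (by positivity)
    rw [mul_pow, mul_pow, sq_abs, sq_abs, ha2, hb2]
  have h5 := mul_le_mul_of_nonneg_right (h3.trans (mul_le_mul_of_nonneg_left h4 (sq_nonneg _)))
    hp.le
  rw [hw, ← mul_assoc]
  refine h5.trans_eq ?_
  have h6 : (∑ β ∈ multiIdx k, (jap x ^ order β) ^ 2 *
      (a * v β ^ 2 + b * (mderiv β g x - v β) ^ 2)) * jap x ^ (-3 - 2 * δ) =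
      ∑ β ∈ multiIdx k,
        ((if n ≤ ‖x‖ then v β ^ 2 * weight δ (order β) x else 0) +
          (if ‖x‖ ≤ 2 * n then (mderiv β g x - v β) ^ 2 * weight δ (order β) x else 0)) := by
    rw [Finset.sum_mul]
    refine Finset.sum_congr rfl fun β _ => ?_
    rw [hw, ha, hb]
    split_ifs <;> ring
  rw [← h6]
  ring

theorem H.ofReal_norm_sq {k : ℕ} {δ : ℝ} (u : H k δ) : ENNReal.ofReal (‖u‖ ^ 2) =
    ∑ α ∈ multiIdx k, ∫⁻ x, ENNReal.ofReal (weakDeriv α u.toAE x ^ 2 * weight δ (order α) x) := by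
  have h0 : ∀ α ∈ multiIdx k, 0 ≤ ∫ x, weakDeriv α u.toAE x ^ 2 * weight δ (order α) x :=
    fun α _ => integral_nonneg fun x => mul_nonneg (sq_nonneg _) (weight_pos _ _ _).le
  rw [H.norm_def, Real.sq_sqrt (Finset.sum_nonneg h0), ENNReal.ofReal_sum_of_nonneg h0]
  exact Finset.sum_congr rfl fun α hα => ofReal_integral_eq_lintegral_ofReal (u.weightedL2 hα)
    (Filter.Eventually.of_forall fun x => mul_nonneg (sq_nonneg _) (weight_pos _ _ _).le)

theorem H.weakDeriv_sub {k : ℕ} {δ : ℝ} (u v : H k δ) {α : Fin 3 → ℕ} (hα : α ∈ multiIdx k) :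
    (weakDeriv α (u - v).toAE : E3 → ℝ) =ᵐ[volume]
      fun x => weakDeriv α u.toAE x - weakDeriv α v.toAE x := by
  have h := isWeakDeriv_add (u.isWeakDeriv hα) (isWeakDeriv_smul (-1) (v.isWeakDeriv hα))
  have e : u.toAE + (-1 : ℝ) • v.toAE = (u - v).toAE := by
    rw [neg_one_smul, ← sub_eq_add_neg]
    rfl
  rw [e] at h
  rw [weakDeriv_eq h, neg_one_smul, ← sub_eq_add_neg]
  exact AEEqFun.coeFn_sub _ _

theorem weight_mul_locallyIntegrable {δ : ℝ} {m : ℕ} {v : E3 →ₘ[volume] ℝ}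
    (h : WeightedL2 δ m v) : LocallyIntegrable fun x => v x ^ 2 := by
  have h1 : LocallyIntegrable fun x => v x ^ 2 * weight δ m x := Integrable.locallyIntegrable h
  rw [locallyIntegrable_iff] at h1 ⊢
  intro K hK
  refine ((h1 K hK).mul_continuousOn ((continuous_weight δ m).inv₀
    fun x => (weight_pos δ m x).ne').continuousOn hK).congr
    (Filter.Eventually.of_forall fun x => ?_)
  exact mul_inv_cancel_right₀ (weight_pos δ m x).ne' _

theorem exists_tail_le {f : E3 → ℝ} (hf : Integrable f) (h0 : ∀ x, 0 ≤ f x) {τ : ℝ} (hτ : 0 < τ) :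
    ∀ᶠ n : ℕ in Filter.atTop,
      ∫⁻ x, ENNReal.ofReal (if (n : ℝ) ≤ ‖x‖ then f x else 0) ≤ ENNReal.ofReal τ := by
  have hmeas : ∀ n : ℕ, MeasurableSet {x : E3 | (n : ℝ) ≤ ‖x‖} := fun n =>
    measurableSet_le measurable_const measurable_norm
  have hanti : Antitone fun n : ℕ => {x : E3 | (n : ℝ) ≤ ‖x‖} := fun m n hmn x hx =>
    (Nat.cast_le.2 hmn).trans (show (n : ℝ) ≤ ‖x‖ from hx)
  have ht := tendsto_setIntegral_of_antitone hmeas hanti ⟨0, hf.integrableOn⟩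
  have hempty : ⋂ n : ℕ, {x : E3 | (n : ℝ) ≤ ‖x‖} = ∅ := by
    refine Set.eq_empty_of_forall_notMem fun x hx => ?_
    obtain ⟨n, hn⟩ := exists_nat_gt ‖x‖
    have : (n : ℝ) ≤ ‖x‖ := Set.mem_iInter.1 hx n
    linarith
  rw [hempty, setIntegral_empty] at ht
  filter_upwards [ht.eventually (gt_mem_nhds hτ)] with n hn
  refine le_trans (le_of_eq ?_) (ENNReal.ofReal_le_ofReal hn.le)
  rw [ofReal_integral_eq_lintegral_ofReal hf.integrableOn (Filter.Eventually.of_forall h0),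
    ← lintegral_indicator (hmeas n)]
  refine lintegral_congr fun x => ?_
  by_cases hx : (n : ℝ) ≤ ‖x‖
  · rw [Set.indicator_of_mem (show x ∈ {x : E3 | (n : ℝ) ≤ ‖x‖} from hx), if_pos hx]
  · rw [Set.indicator_of_notMem (show x ∉ {x : E3 | (n : ℝ) ≤ ‖x‖} from hx), if_neg hx,
      ENNReal.ofReal_zero]

theorem exists_mollify_weight_bound {δ : ℝ} {m : ℕ} {v : E3 →ₘ[volume] ℝ}
    (h : WeightedL2 δ m v) (ρ : ℝ) {τ : ℝ} (hτ : 0 < τ) :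
    ∃ r > 0, ∀ η, IsMollifier η r → ∫⁻ x, ENNReal.ofReal (if ‖x‖ ≤ ρ then
      ((v ⋆[ContinuousLinearMap.mul ℝ ℝ, volume] η) x - v x) ^ 2 * weight δ m x else 0) ≤
        ENNReal.ofReal τ := by
  obtain ⟨W, hW⟩ := (isCompact_closedBall (0 : E3) ρ).exists_bound_of_continuousOn
    (continuous_weight δ m).continuousOn
  have hW1 : 0 < max W 1 := lt_max_of_lt_right one_pos
  obtain ⟨r, hr0, hr⟩ := exists_mollify_bound (weight_mul_locallyIntegrable h)
    v.measurable ρ (κ := ENNReal.ofReal (τ / max W 1))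
    (ENNReal.ofReal_pos.2 (by positivity))
  refine ⟨r, hr0, fun η hη => ?_⟩
  have hpt : ∀ x, ENNReal.ofReal (if ‖x‖ ≤ ρ then
      ((v ⋆[ContinuousLinearMap.mul ℝ ℝ, volume] η) x - v x) ^ 2 * weight δ m x else 0) ≤
      ENNReal.ofReal (max W 1) * (Metric.closedBall (0 : E3) ρ).indicator
        (fun x => ‖(v ⋆[ContinuousLinearMap.mul ℝ ℝ, volume] η) x - v x‖ₑ ^ 2) x := fun x => by
    by_cases hx : ‖x‖ ≤ ρ
    · have hx' : x ∈ Metric.closedBall (0 : E3) ρ := by simpa using hx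
      rw [if_pos hx, Set.indicator_of_mem hx', Real.enorm_eq_ofReal_abs,
        ← ENNReal.ofReal_pow (abs_nonneg _), sq_abs, ← ENNReal.ofReal_mul hW1.le]
      refine ENNReal.ofReal_le_ofReal ?_
      rw [mul_comm]
      refine mul_le_mul_of_nonneg_right ?_ (sq_nonneg _)
      exact ((le_abs_self _).trans (hW x hx')).trans (le_max_left _ _)
    · rw [if_neg hx, ENNReal.ofReal_zero]
      exact zero_le
  refine (lintegral_mono hpt).trans ?_
  rw [lintegral_const_mul' _ _ ENNReal.ofReal_ne_top, lintegral_indicator measurableSet_closedBall]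
  refine (mul_le_mul_right (hr η hη) _).trans_eq ?_
  rw [← ENNReal.ofReal_mul hW1.le, mul_div_cancel₀ _ hW1.ne']

/-- Test functions are dense in `H^k_δ`. -/
theorem exists_test_near {k : ℕ} {δ : ℝ} (u : H k δ) {ε : ℝ} (hε : 0 < ε) :
    ∃ (φ : E3 → ℝ) (hφ : IsTest φ), ‖u - toH k δ φ hφ‖ < ε := by
  obtain ⟨K, hK0, hK⟩ := exists_cutoff k
  set N : ℝ := ((multiIdx k).card : ℝ) with hN
  have hN0 : 0 ≤ N := Nat.cast_nonneg _
  set A := (2 + 2 ^ k * (K * 3 ^ k)) ^ 2 * (N * 2) with hA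
  have hA0 : 0 ≤ A := by positivity
  -- The final estimate is `‖u - φ‖² ≤ 2 N² A τ`; the added 1 makes it strict and keeps the
  -- denominator positive.
  set τ := ε ^ 2 / (2 * N ^ 2 * A + 1) with hτ
  have hτ0 : 0 < τ := by positivity
  set v : (Fin 3 → ℕ) → E3 → ℝ := fun α x => weakDeriv α u.toAE x with hv
  have htail : ∀ᶠ n : ℕ in Filter.atTop, ∀ β ∈ multiIdx k, ∫⁻ x, ENNReal.ofReal
      (if (n : ℝ) ≤ ‖x‖ then v β x ^ 2 * weight δ (order β) x else 0) ≤ ENNReal.ofReal τ := by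
    rw [Filter.eventually_all_finset]
    exact fun β hβ => exists_tail_le (u.weightedL2 hβ)
      (fun x => mul_nonneg (sq_nonneg _) (weight_pos _ _ _).le) hτ0
  -- The cutoff radius is fixed by the tails first; the mollification radius, chosen afterwards,
  -- depends on it.
  obtain ⟨n, hn, hn1⟩ := (htail.and (Filter.eventually_ge_atTop 1)).exists
  have hn1' : (1 : ℝ) ≤ n := by exact_mod_cast hn1
  obtain ⟨χ, hχ, h01, h1, h2, hj⟩ := hK n hn1'
  have hmoll : ∀ᶠ r in 𝓝[>] (0 : ℝ), ∀ β ∈ multiIdx k, ∀ η, IsMollifier η r →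
      ∫⁻ x, ENNReal.ofReal (if ‖x‖ ≤ 2 * n then
        ((v β ⋆[ContinuousLinearMap.mul ℝ ℝ, volume] η) x - v β x) ^ 2 * weight δ (order β) x
          else 0) ≤ ENNReal.ofReal τ := by
    rw [Filter.eventually_all_finset]
    intro β hβ
    obtain ⟨r₀, hr₀, h⟩ := exists_mollify_weight_bound (u.weightedL2 hβ) (2 * n) hτ0
    filter_upwards [Ioc_mem_nhdsGT hr₀] with r hr η hη
    exact h η ⟨hη.test, hη.nonneg, hη.integral_eq_one,
      fun x hx => (hη.norm_lt x hx).trans_le hr.2⟩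
  obtain ⟨r, hr, hr0⟩ := (hmoll.and self_mem_nhdsWithin).exists
  obtain ⟨η, hη⟩ := exists_isMollifier (r := r) hr0
  set g := (u : E3 → ℝ) ⋆[ContinuousLinearMap.mul ℝ ℝ, volume] η with hg
  have hgs : ContDiff ℝ ∞ g := contDiff_mollify u.locallyIntegrable hη.test
  have hgd : ∀ β ∈ multiIdx k, mderiv β g = v β ⋆[ContinuousLinearMap.mul ℝ ℝ, volume] η :=
    fun β hβ => (u.isWeakDeriv hβ).mderiv_mollify hη.test
  have hφ : IsTest fun x => χ x * g x := hχ.mul hgs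
  refine ⟨_, hφ, ?_⟩
  refine lt_of_pow_lt_pow_left₀ 2 hε.le ?_
  have hbound : ENNReal.ofReal (‖u - toH k δ _ hφ‖ ^ 2) ≤
      ENNReal.ofReal (N * (A * (N * (τ + τ)))) := by
    rw [H.ofReal_norm_sq, ENNReal.ofReal_mul hN0, hN, ENNReal.ofReal_natCast, ← nsmul_eq_mul,
      ← Finset.sum_const]
    refine Finset.sum_le_sum fun α hα => ?_
    have hae : (fun x => ENNReal.ofReal
        (weakDeriv α (u - toH k δ _ hφ).toAE x ^ 2 * weight δ (order α) x)) =ᵐ[volume]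
        fun x => ENNReal.ofReal
          ((mderiv α (fun x => χ x * g x) x - v α x) ^ 2 * weight δ (order α) x) := by
      filter_upwards [u.weakDeriv_sub (toH k δ _ hφ) hα, weakDeriv_toH k δ hφ α] with x e1 e2
      rw [e1, e2, ← neg_sub, neg_sq]
    rw [lintegral_congr_ae hae]
    have hnn1 : ∀ β x, 0 ≤ if (n : ℝ) ≤ ‖x‖ then v β x ^ 2 * weight δ (order β) x else 0 :=
      fun β x => by
        split_ifs
        · exact mul_nonneg (sq_nonneg _) (weight_pos _ _ _).le
        · exact le_rfl
    have hnn2 : ∀ β x, 0 ≤ if ‖x‖ ≤ 2 * (n : ℝ) then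
        (mderiv β g x - v β x) ^ 2 * weight δ (order β) x else 0 :=
      fun β x => by
        split_ifs
        · exact mul_nonneg (sq_nonneg _) (weight_pos _ _ _).le
        · exact le_rfl
    have hm1 : ∀ β, Measurable fun x => ENNReal.ofReal
        (if (n : ℝ) ≤ ‖x‖ then v β x ^ 2 * weight δ (order β) x else 0) := fun β =>
      (Measurable.ite (measurableSet_le measurable_const measurable_norm)
        (((weakDeriv β u.toAE).measurable.pow_const 2).mul
          (continuous_weight _ _).measurable) measurable_const).ennreal_ofReal
    have hm2 : ∀ β, Measurable fun x => ENNReal.ofReal (if ‖x‖ ≤ 2 * (n : ℝ) then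
        (mderiv β g x - v β x) ^ 2 * weight δ (order β) x else 0) := fun β =>
      (Measurable.ite (measurableSet_le measurable_norm measurable_const)
        ((((contDiff_mderiv β hgs).continuous.measurable.sub
          (weakDeriv β u.toAE).measurable).pow_const 2).mul
          (continuous_weight _ _).measurable) measurable_const).ennreal_ofReal
    have hpt : ∀ x, ENNReal.ofReal
        ((mderiv α (fun x => χ x * g x) x - v α x) ^ 2 * weight δ (order α) x) ≤
        ENNReal.ofReal A * ∑ β ∈ multiIdx k,
          (ENNReal.ofReal (if (n : ℝ) ≤ ‖x‖ then v β x ^ 2 * weight δ (order β) x else 0) +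
            ENNReal.ofReal (if ‖x‖ ≤ 2 * (n : ℝ) then
              (mderiv β g x - v β x) ^ 2 * weight δ (order β) x else 0)) := fun x => by
      refine (ENNReal.ofReal_le_ofReal (cutoff_error_sq_le hK0 hχ h01 h1 h2 hj hgs δ
        (fun β => v β x) hα x)).trans_eq ?_
      rw [ENNReal.ofReal_mul hA0, ENNReal.ofReal_sum_of_nonneg
        fun β _ => add_nonneg (hnn1 β x) (hnn2 β x)]
      congr 1
      exact Finset.sum_congr rfl fun β _ => ENNReal.ofReal_add (hnn1 β x) (hnn2 β x)
    refine (lintegral_mono hpt).trans ?_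
    rw [lintegral_const_mul' _ _ ENNReal.ofReal_ne_top, ENNReal.ofReal_mul hA0]
    refine mul_le_mul_right ((lintegral_finsetSum _
      fun β _ => (hm1 β).add (hm2 β)).trans_le ?_) _
    rw [ENNReal.ofReal_mul hN0, hN, ENNReal.ofReal_natCast, ← nsmul_eq_mul, ← Finset.sum_const,
      ENNReal.ofReal_add hτ0.le hτ0.le]
    refine Finset.sum_le_sum fun β hβ => ?_
    refine (lintegral_add_left (hm1 β) _).trans_le (add_le_add (hn β hβ) ?_)
    rw [hgd β hβ]
    exact hr β hβ η hη
  rw [ENNReal.ofReal_le_ofReal_iff (by positivity)] at hbound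
  refine hbound.trans_lt ?_
  have : τ * (2 * N ^ 2 * A + 1) = ε ^ 2 := div_mul_cancel₀ _ (by positivity)
  nlinarith

/-! ### Continuous representatives -/

theorem exists_seq_test {k : ℕ} {δ : ℝ} (u : H k δ) : ∃ (φ : ℕ → E3 → ℝ) (hφ : ∀ n, IsTest (φ n)),
    Filter.Tendsto (fun n => toH k δ (φ n) (hφ n)) Filter.atTop (𝓝 u) := by
  choose φ hφ h using fun n : ℕ => exists_test_near u (Nat.one_div_pos_of_nat (α := ℝ) (n := n))
  refine ⟨φ, hφ, ?_⟩
  rw [tendsto_iff_norm_sub_tendsto_zero]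
  refine squeeze_zero (fun _ => norm_nonneg _) (fun n => ?_) tendsto_one_div_add_atTop_nhds_zero_nat
  rw [norm_sub_rev]
  exact (h n).le

theorem abs_test_le {k : ℕ} (hk : 2 ≤ k) {δ : ℝ} (hδ : δ ≤ 0) : ∃ C : ℝ, 0 ≤ C ∧
    ∀ (f : E3 → ℝ) (hf : IsTest f) (x : E3), |f x| ≤ C * ‖toH k δ f hf‖ := by
  obtain ⟨C, hC0, hC⟩ := jet_le_snorm 0 δ
  obtain ⟨D, hD0, hD⟩ := snorm_le_norm_toH k
  refine ⟨C * D, by positivity, fun f hf x => ?_⟩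
  have h := hC f hf x
  rw [jet_zero] at h
  have h1 : 1 ≤ jap x ^ ((0 : ℕ) - δ) := Real.one_le_rpow (one_le_jap x) (by simpa using hδ)
  have h2 : snorm (0 + 2) δ f ≤ D * ‖toH k δ f hf‖ := (snorm_mono (by omega) δ f).trans (hD δ f hf)
  have h3 := mul_le_mul_of_nonneg_left h2 hC0
  nlinarith [abs_nonneg (f x)]

/-- A test function as a continuous function vanishing at infinity. -/
noncomputable def toC0 (f : E3 → ℝ) (hf : IsTest f) : ZeroAtInftyContinuousMap E3 ℝ :=
  ⟨⟨f, hf.continuous⟩, hf.2.is_zero_at_infty⟩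

/-- By the sup bound, test functions approximating `u` form a Cauchy sequence in `C₀(ℝ³)`, so their
uniform limit is continuous and vanishes at infinity. It represents `u` because a subsequence also
converges to `u` almost everywhere. -/
theorem exists_continuous_rep {k : ℕ} (hk : 2 ≤ k) {δ : ℝ} (hδ : δ ≤ 0) : ∃ C : ℝ, 0 ≤ C ∧
    ∀ u : H k δ, ∃ f : E3 → ℝ, Continuous f ∧ (u : E3 → ℝ) =ᵐ[volume] f ∧
      (∀ x, |f x| ≤ C * ‖u‖) ∧ Filter.Tendsto f (Filter.cocompact E3) (𝓝 0) := by
  obtain ⟨C, hC0, hC⟩ := abs_test_le hk hδ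
  refine ⟨C, hC0, fun u => ?_⟩
  obtain ⟨φ, hφ, hu⟩ := exists_seq_test u
  have hdist : ∀ m n, dist (toC0 (φ m) (hφ m)) (toC0 (φ n) (hφ n)) ≤
      C * dist (toH k δ (φ m) (hφ m)) (toH k δ (φ n) (hφ n)) := fun m n => by
    rw [← ZeroAtInftyContinuousMap.dist_toBCF_eq_dist,
      BoundedContinuousFunction.dist_le (by positivity)]
    intro x
    rw [dist_eq_norm (toH k δ (φ m) (hφ m)), ← toH_sub]
    exact hC _ ((hφ m).sub (hφ n)) x
  have hcauchy : CauchySeq fun n => toC0 (φ n) (hφ n) := by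
    rw [cauchySeq_iff_tendsto_dist_atTop_0]
    refine squeeze_zero (fun _ => dist_nonneg) (fun p => hdist p.1 p.2) ?_
    simpa using (cauchySeq_iff_tendsto_dist_atTop_0.1 hu.cauchySeq).const_mul C
  obtain ⟨f, hf⟩ := cauchySeq_tendsto_of_complete hcauchy
  have hpt : ∀ x, Filter.Tendsto (fun n => φ n x) Filter.atTop (𝓝 (f x)) := fun x => by
    rw [tendsto_iff_dist_tendsto_zero] at hf ⊢
    refine squeeze_zero (fun _ => dist_nonneg) (fun n => ?_) hf
    rw [← ZeroAtInftyContinuousMap.dist_toBCF_eq_dist]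
    exact (toC0 (φ n) (hφ n)).toBCF.dist_coe_le_dist (g := f.toBCF) x
  refine ⟨f, f.continuous, ?_, fun x => ?_, f.zero_at_infty'⟩
  · have h0 := zero_mem_multiIdx k
    have hemb : Filter.Tendsto (fun n => (H.embed (toH k δ (φ n) (hφ n))).ofLp ⟨0, h0⟩)
        Filter.atTop (𝓝 ((H.embed u).ofLp ⟨0, h0⟩)) := by
      rw [tendsto_iff_norm_sub_tendsto_zero] at hu ⊢
      refine squeeze_zero (fun _ => norm_nonneg _) (fun n => ?_) hu
      rw [← H.norm_embed, map_sub]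
      exact PiLp.norm_apply_le (H.embed (toH k δ (φ n) (hφ n)) - H.embed u) ⟨0, h0⟩
    obtain ⟨ns, hns, hae⟩ := (tendstoInMeasure_of_tendsto_Lp hemb).exists_seq_tendsto_ae
    have hall : ∀ᵐ x, ∀ n, (H.embed (toH k δ (φ n) (hφ n))).ofLp ⟨0, h0⟩ x =
        Real.sqrt (weight δ (order 0) x) * φ n x := by
      rw [ae_all_iff]
      intro n
      filter_upwards [(toH k δ (φ n) (hφ n)).embed_apply_coe ⟨0, h0⟩,
        weakDeriv_toH k δ (hφ n) 0] with x e1 e2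
      rw [e1, e2, mderiv_zero]
    filter_upwards [hae, hall, u.embed_apply_coe ⟨0, h0⟩] with x e1 e2 e3
    simp only [e2] at e1
    rw [e3, H.weakDeriv_zero] at e1
    have e4 := ((hpt x).comp hns.tendsto_atTop).const_mul (Real.sqrt (weight δ (order 0) x))
    exact mul_left_cancel₀ (sqrt_weight_pos _ _ x).ne' (tendsto_nhds_unique e1 e4)
  · exact le_of_tendsto_of_tendsto ((hpt x).abs) (hu.norm.const_mul C)
      (Filter.Eventually.of_forall fun n => hC (φ n) (hφ n) x)

theorem ae_tendsto_of_tendsto {k : ℕ} (hk : 2 ≤ k) {δ : ℝ} (hδ : δ ≤ 0) {u : ℕ → H k δ} {v : H k δ}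
    (h : Filter.Tendsto u Filter.atTop (𝓝 v)) :
    ∀ᵐ x, Filter.Tendsto (fun n => u n x) Filter.atTop (𝓝 (v x)) := by
  obtain ⟨C, hC0, hC⟩ := exists_continuous_rep hk hδ
  have hall : ∀ᵐ x, ∀ n, |u n x - v x| ≤ C * ‖u n - v‖ := by
    rw [ae_all_iff]
    intro n
    obtain ⟨f, -, hf, hb, -⟩ := hC (u n - v)
    filter_upwards [hf, H.coe_sub (u n) v] with x e1 e2
    rw [← e2, e1]
    exact hb x
  rw [tendsto_iff_norm_sub_tendsto_zero] at h
  filter_upwards [hall] with x hx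
  rw [tendsto_iff_norm_sub_tendsto_zero]
  exact squeeze_zero (fun _ => norm_nonneg _) hx (by simpa using h.const_mul C)

/-! ### The algebra structure -/

theorem norm_toH_mul_le {k : ℕ} (hk : 2 ≤ k) {δ : ℝ} (hδ : δ ≤ 0) : ∃ C : ℝ, 0 ≤ C ∧
    ∀ (f g : E3 → ℝ) (hf : IsTest f) (hg : IsTest g),
      ‖toH k δ (fun x => f x * g x) (hf.mul hg.1)‖ ≤ C * ‖toH k δ f hf‖ * ‖toH k δ g hg‖ := by
  obtain ⟨A, hA0, hA⟩ := norm_toH_le k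
  obtain ⟨B, hB0, hB⟩ := snorm_le_norm_toH k
  obtain ⟨C, hC0, hC⟩ := snorm_mul_le hk hδ
  refine ⟨A * C * B * B, by positivity, fun f g hf hg => ?_⟩
  have hf' := hB δ f hf
  have hg' := hB δ g hg
  have := snorm_nonneg k δ f
  have := snorm_nonneg k δ g
  calc _ ≤ A * (C * snorm k δ f * snorm k δ g) :=
        (hA δ _ _).trans (mul_le_mul_of_nonneg_left (hC f g hf hg) hA0.le)
    _ ≤ A * (C * (B * ‖toH k δ f hf‖) * (B * ‖toH k δ g hg‖)) := by gcongr
    _ = _ := by ring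

/-- Products of approximating test functions form a Cauchy sequence by the bilinear bound. Its limit
is the pointwise product because convergence in `H k δ` implies convergence almost everywhere. -/
theorem exists_mul {k : ℕ} (hk : 2 ≤ k) {δ : ℝ} (hδ : δ ≤ 0) : ∃ C : ℝ, 0 ≤ C ∧
    ∀ u v : H k δ, ∃ w : H k δ, (w : E3 → ℝ) =ᵐ[volume] (fun x => u x * v x) ∧
      ‖w‖ ≤ C * ‖u‖ * ‖v‖ := by
  obtain ⟨C, hC0, hC⟩ := norm_toH_mul_le hk hδ
  refine ⟨C, hC0, fun u v => ?_⟩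
  obtain ⟨φ, hφ, hu⟩ := exists_seq_test u
  obtain ⟨ψ, hψ, hv⟩ := exists_seq_test v
  set a := fun n => toH k δ (φ n) (hφ n) with ha
  set b := fun n => toH k δ (ψ n) (hψ n) with hb
  set p := fun n => toH k δ (fun x => φ n x * ψ n x) ((hφ n).mul (hψ n).1) with hp
  have hdist : ∀ m n, dist (p m) (p n) ≤ C * ‖a m‖ * dist (b m) (b n) +
      C * dist (a m) (a n) * ‖b n‖ := fun m n => by
    have h1 := hC _ _ (hφ m) ((hψ m).sub (hψ n))
    have h2 := hC _ _ ((hφ m).sub (hφ n)) (hψ n)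
    rw [toH_sub k δ (hψ m) (hψ n)] at h1
    rw [toH_sub k δ (hφ m) (hφ n)] at h2
    have e : p m - p n = toH k δ (fun x => φ m x * (ψ m x - ψ n x))
        ((hφ m).mul ((hψ m).sub (hψ n)).1) + toH k δ (fun x => (φ m x - φ n x) * ψ n x)
          (((hφ m).sub (hφ n)).mul (hψ n).1) := by
      refine H.ext ?_
      filter_upwards [H.coe_sub (p m) (p n), H.coe_add (toH k δ (fun x => φ m x * (ψ m x - ψ n x))
        ((hφ m).mul ((hψ m).sub (hψ n)).1)) (toH k δ (fun x => (φ m x - φ n x) * ψ n x)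
          (((hφ m).sub (hφ n)).mul (hψ n).1)), toH_coe k δ ((hφ m).mul (hψ m).1),
        toH_coe k δ ((hφ n).mul (hψ n).1), toH_coe k δ ((hφ m).mul ((hψ m).sub (hψ n)).1),
        toH_coe k δ (((hφ m).sub (hφ n)).mul (hψ n).1)] with x e1 e2 e3 e4 e5 e6
      rw [e1, e2, e3, e4, e5, e6]
      ring
    rw [dist_eq_norm, e, dist_eq_norm, dist_eq_norm]
    exact (norm_add_le _ _).trans (add_le_add h1 h2)
  have hcauchy : CauchySeq p := by
    rw [cauchySeq_iff_tendsto_dist_atTop_0]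
    refine squeeze_zero (fun _ => dist_nonneg) (fun q => hdist q.1 q.2) ?_
    have h1 := cauchySeq_iff_tendsto_dist_atTop_0.1 hu.cauchySeq
    have h2 := cauchySeq_iff_tendsto_dist_atTop_0.1 hv.cauchySeq
    rw [← Filter.prod_atTop_atTop_eq] at h1 h2 ⊢
    have h3 := (hu.norm.comp Filter.tendsto_fst :
      Filter.Tendsto (fun q : ℕ × ℕ => ‖a q.1‖) (Filter.atTop ×ˢ Filter.atTop) _)
    have h4 := (hv.norm.comp Filter.tendsto_snd :
      Filter.Tendsto (fun q : ℕ × ℕ => ‖b q.2‖) (Filter.atTop ×ˢ Filter.atTop) _)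
    simpa using ((h3.const_mul C).mul h2).add ((h1.const_mul C).mul h4)
  obtain ⟨w, hw⟩ := cauchySeq_tendsto_of_complete hcauchy
  refine ⟨w, ?_, ?_⟩
  · have hcoe : ∀ᵐ x, ∀ n, a n x = φ n x ∧ b n x = ψ n x ∧ p n x = φ n x * ψ n x := by
      rw [ae_all_iff]
      intro n
      filter_upwards [toH_coe k δ (hφ n), toH_coe k δ (hψ n),
        toH_coe k δ ((hφ n).mul (hψ n).1)] with x e1 e2 e3
      exact ⟨e1, e2, e3⟩
    filter_upwards [hcoe, ae_tendsto_of_tendsto hk hδ hu, ae_tendsto_of_tendsto hk hδ hv,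
      ae_tendsto_of_tendsto hk hδ hw] with x e1 e2 e3 e4
    refine tendsto_nhds_unique e4 ((e2.mul e3).congr fun n => ?_)
    obtain ⟨h1, h2, h3⟩ := e1 n
    rw [h1, h2, h3]
  · exact le_of_tendsto_of_tendsto hw.norm ((hu.norm.const_mul C).mul hv.norm)
      (Filter.Eventually.of_forall fun n => hC _ _ (hφ n) (hψ n))

/-- Pointwise multiplication is a continuous bilinear map on `H^k_δ`. -/
theorem exists_mulL {k : ℕ} (hk : 2 ≤ k) {δ : ℝ} (hδ : δ ≤ 0) :
    ∃ B : H k δ →L[ℝ] H k δ →L[ℝ] H k δ,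
      ∀ u v, (B u v : E3 → ℝ) =ᵐ[volume] fun x => u x * v x := by
  obtain ⟨C, -, hC⟩ := exists_mul hk hδ
  choose w hw hn using hC
  refine ⟨LinearMap.mkContinuous₂ (LinearMap.mk₂ ℝ w ?_ ?_ ?_ ?_) C hn, fun u v => hw u v⟩
  · intro u u' v
    refine H.ext ?_
    filter_upwards [hw (u + u') v, H.coe_add (w u v) (w u' v), hw u v, hw u' v,
      H.coe_add u u'] with x e1 e2 e3 e4 e5
    rw [e1, e2, e3, e4, e5]
    ring
  · intro c u v
    refine H.ext ?_
    filter_upwards [hw (c • u) v, H.coe_smul c (w u v), hw u v, H.coe_smul c u]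
      with x e1 e2 e3 e4
    rw [e1, e2, e3, e4]
    ring
  · intro u v v'
    refine H.ext ?_
    filter_upwards [hw u (v + v'), H.coe_add (w u v) (w u v'), hw u v, hw u v',
      H.coe_add v v'] with x e1 e2 e3 e4 e5
    rw [e1, e2, e3, e4, e5]
    ring
  · intro c u v
    refine H.ext ?_
    filter_upwards [hw u (c • v), H.coe_smul c (w u v), hw u v, H.coe_smul c v]
      with x e1 e2 e3 e4
    rw [e1, e2, e3, e4]
    ring

/-! ### The set `P` and the quasi-inverse -/

/-- A continuous function tending to zero at infinity attains its minimum if it is negative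
somewhere; otherwise `c = 1` works. -/
theorem exists_lower_bound {f : E3 → ℝ} (hf : Continuous f)
    (h0 : Filter.Tendsto f (Filter.cocompact E3) (𝓝 0)) (h : ∀ x, -1 < f x) :
    ∃ c > 0, ∀ x, c ≤ 1 + f x := by
  by_cases hneg : ∃ x₀, f x₀ < 0
  · obtain ⟨x₀, hx₀⟩ := hneg
    obtain ⟨y, hy⟩ := hf.exists_forall_le' x₀ ((h0.eventually (lt_mem_nhds hx₀)).mono
      fun x hx => hx.le)
    exact ⟨1 + f y, by linarith [h y], fun x => by linarith [hy x]⟩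
  · push Not at hneg
    exact ⟨1, one_pos, fun x => by linarith [hneg x]⟩

theorem isOpen_P {k : ℕ} (hk : 2 ≤ k) {δ : ℝ} (hδ : δ ≤ 0) : IsOpen (P k δ) := by
  obtain ⟨C, hC0, hC⟩ := exists_continuous_rep hk hδ
  rw [Metric.isOpen_iff]
  rintro u ⟨f, hf, huf, hlow⟩
  obtain ⟨f', hf', huf', -, h0⟩ := hC u
  -- Continuous representatives are unique, so the one witnessing `u > -1` also decays at infinity.
  obtain rfl : f = f' := (hf.ae_eq_iff_eq volume hf').1 (huf.symm.trans huf')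
  obtain ⟨c, hc, hcf⟩ := exists_lower_bound hf h0 hlow
  refine ⟨c / (C + 1), by positivity, fun v hv => ?_⟩
  obtain ⟨g, hg, hvg, hb, -⟩ := hC (v - u)
  refine ⟨fun x => f x + g x, hf.add hg, ?_, fun x => ?_⟩
  · filter_upwards [huf, hvg, H.coe_sub v u] with x e1 e2 e3
    rw [← e1, ← e2, e3]
    ring
  · rw [Metric.mem_ball, dist_eq_norm, lt_div_iff₀ (by positivity)] at hv
    have h1 := (abs_le.1 (hb x)).1
    have h2 := hcf x
    have h3 := norm_nonneg (v - u)
    nlinarith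

/-- For `u > -1`, multiplication by `1 + u` is invertible on `H^k_δ`. -/
theorem isUnit_one_add_mulL {k : ℕ} (hk : 2 ≤ k) {δ : ℝ} (hδ : δ ≤ 0)
    {B : H k δ →L[ℝ] H k δ →L[ℝ] H k δ}
    (hB : ∀ u v, (B u v : E3 → ℝ) =ᵐ[volume] fun x => u x * v x) {u : H k δ} (hu : u ∈ P k δ) :
    IsUnit (1 + B u) := by
  obtain ⟨C, hC0, hC⟩ := exists_continuous_rep hk hδ
  obtain ⟨f, hf, huf, hlow⟩ := hu
  obtain ⟨f', hf', huf', -, h0⟩ := hC u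
  obtain rfl : f = f' := (hf.ae_eq_iff_eq volume hf').1 (huf.symm.trans huf')
  obtain ⟨c, hc, hcf⟩ := exists_lower_bound hf h0 hlow
  obtain ⟨D, hD0, hD⟩ := norm_toH_le k
  obtain ⟨D', hD'0, hD'⟩ := snorm_le_norm_toH k
  -- `M` depends only on `c` and `‖u‖`, and is fixed before `φ`; otherwise the Neumann argument
  -- would be circular.
  obtain ⟨M, hM0, hM⟩ := snorm_inverse_le hk hδ (half_pos hc) (D' * (‖u‖ + 1))
  set L := ‖B‖ * (1 + ‖B‖ * (D * M)) with hL
  have hL0 : 0 ≤ L := by positivity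
  -- The three entries give `‖φ‖ ≤ ‖u‖ + 1`, the lower bound `1 + φ ≥ c/2`, and a Neumann
  -- perturbation of norm below 1.
  set ε := min 1 (min (c / 2 / (C + 1)) (1 / (L + 1))) with hε
  have hε0 : 0 < ε := by positivity
  obtain ⟨φ, hφ, hφu⟩ := exists_test_near u hε0
  have hφlow : ∀ x, c / 2 ≤ 1 + φ x := by
    obtain ⟨g, hg, hvg, hb, -⟩ := hC (u - toH k δ φ hφ)
    have heq : (fun x => f x - φ x) = g := by
      refine ((hf.sub hφ.continuous).ae_eq_iff_eq volume hg).1 ?_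
      filter_upwards [huf, hvg, H.coe_sub u (toH k δ φ hφ), toH_coe k δ hφ] with x e1 e2 e3 e4
      rw [← e2, e3, e4, e1]
      rfl
    intro x
    have h1 := (abs_le.1 (hb x)).2
    rw [← heq] at h1
    have h2 := hφu.le.trans ((min_le_right _ _).trans (min_le_left _ _))
    rw [le_div_iff₀ (by positivity)] at h2
    have h3 := norm_nonneg (u - toH k δ φ hφ)
    have h4 := hcf x
    nlinarith
  have hpos : ∀ x, 0 < 1 + φ x := fun x => (half_pos hc).trans_le (hφlow x)
  have hw := hφ.inverse hpos
  set w : E3 → ℝ := fun x => 1 / (1 + φ x) - 1 with hwdef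
  have hinv : ∀ x, (1 + φ x) * w x = -φ x := fun x => by
    rw [hwdef]
    have := (hpos x).ne'
    field_simp
    ring
  have hφn : snorm k δ φ ≤ D' * (‖u‖ + 1) := by
    refine (hD' δ φ hφ).trans (mul_le_mul_of_nonneg_left ?_ hD'0.le)
    have h1 := norm_sub_norm_le (toH k δ φ hφ) u
    rw [norm_sub_rev] at h1
    linarith [hφu.le.trans (min_le_left _ _)]
  have hwn : ‖toH k δ w hw‖ ≤ D * M :=
    (hD δ w hw).trans (mul_le_mul_of_nonneg_left (hM φ w hφ hw hφn hφlow hinv) hD0.le)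
  set a := toH k δ φ hφ
  set b := toH k δ w hw
  have hab : (1 + B a) * (1 + B b) = 1 := by
    have h1 : B a + B b + B a * B b = 0 := by
      ext v
      refine H.ext ?_
      filter_upwards [hB a v, hB b v, hB a (B b v), toH_coe k δ hφ, toH_coe k δ hw,
        H.coe_add (B a v + B b v) (B a (B b v)), H.coe_add (B a v) (B b v),
        (AEEqFun.coeFn_zero : ((0 : E3 →ₘ[volume] ℝ) : E3 → ℝ) =ᵐ[volume] 0)]
        with x e1 e2 e3 e4 e5 e6 e7 e8
      refine (e6.trans ?_).trans e8.symm
      rw [e7, e3, e1, e2, e4, e5, Pi.zero_apply]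
      linear_combination (hinv x) * v x
    calc _ = 1 + (B a + B b + B a * B b) := by noncomm_ring
      _ = 1 := by rw [h1, add_zero]
  -- For commuting factors, invertibility of the product gives invertibility of each.
  have hcomm : Commute (1 + B u) (1 + B b) := by
    have h1 : Commute (B u) (B b) := by
      refine ContinuousLinearMap.ext fun v => H.ext ?_
      filter_upwards [hB u (B b v), hB b (B u v), hB u v, hB b v] with x e1 e2 e3 e4
      refine e1.trans ((?_ : _ = _).trans e2.symm)
      rw [e3, e4]
      ring
    exact ((Commute.one_left _).add_left ((Commute.one_right _).add_right h1))
  have hunit : IsUnit ((1 + B u) * (1 + B b)) := by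
    have hsub : (1 + B u) * (1 + B b) = 1 - (B (a - u)) * (1 + B b) := by
      calc _ = (1 + B a) * (1 + B b) - (B a - B u) * (1 + B b) := by noncomm_ring
        _ = _ := by rw [hab, map_sub]
    rw [hsub]
    refine isUnit_one_sub_of_norm_lt_one ?_
    have h1 : ‖B (a - u)‖ ≤ ‖B‖ * ε :=
      (B.le_opNorm _).trans (mul_le_mul_of_nonneg_left (by rw [norm_sub_rev]; exact hφu.le)
        (norm_nonneg B))
    have h2 : ‖1 + B b‖ ≤ 1 + ‖B‖ * (D * M) :=
      (norm_add_le _ _).trans (add_le_add ContinuousLinearMap.norm_id_le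
        ((B.le_opNorm b).trans (mul_le_mul_of_nonneg_left hwn (norm_nonneg B))))
    have h3 : ε ≤ 1 / (L + 1) := (min_le_right _ _).trans (min_le_right _ _)
    rw [le_div_iff₀ (by positivity)] at h3
    calc _ ≤ ‖B (a - u)‖ * ‖1 + B b‖ := norm_mul_le _ _
      _ ≤ ‖B‖ * ε * (1 + ‖B‖ * (D * M)) := by gcongr
      _ = ε * L := by rw [hL]; ring
      _ < 1 := by linarith
  exact (hcomm.isUnit_mul_iff.1 hunit).1

end WeightedSobolev

/-! ### The main theorem. -/

theorem lemma6p5 (k : ℕ) (hk : 2 ≤ k) (δ : ℝ) (hδ : δ ≤ 0) :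
    IsOpen (WeightedSobolev.P k δ) ∧
    ∃ F : WeightedSobolev.H k δ → WeightedSobolev.H k δ,
      (∀ u ∈ WeightedSobolev.P k δ, ∀ᵐ x, F u x = 1 / (1 + u x) - 1) ∧
      ContDiffOn ℝ 1 F (WeightedSobolev.P k δ) := by
  open WeightedSobolev in
  obtain ⟨B, hB⟩ := exists_mulL hk hδ
  -- `Ring.inverse` is zero at non-units, so the formula is total; its values outside `P` play no
  -- role.
  refine ⟨isOpen_P hk hδ, fun u => -(Ring.inverse (1 + B u) u), fun u hu => ?_, fun u hu => ?_⟩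
  · have hunit := isUnit_one_add_mulL hk hδ hB hu
    obtain ⟨f, -, huf, hlow⟩ := hu
    set w := Ring.inverse (1 + B u) u
    -- From `(1 + u) w = u` follows `-w = 1/(1+u) - 1` wherever `1 + u ≠ 0`.
    have hw : w + B u w = u := by
      have := congrArg (fun T : H k δ →L[ℝ] H k δ => T u) (Ring.mul_inverse_cancel _ hunit)
      simpa using this
    filter_upwards [huf, hB u w, H.coe_add w (B u w), H.coe_neg w] with x e1 e2 e3 e4
    rw [hw, e2] at e3
    have hne : 1 + u x ≠ 0 := by
      rw [e1]
      linarith [hlow x]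
    rw [e4]
    field_simp
    linarith
  · obtain ⟨U, hU⟩ := isUnit_one_add_mulL hk hδ hB hu
    have h1 : ContDiffAt ℝ 1 (fun u => Ring.inverse (1 + B u)) u := by
      refine ContDiffAt.comp u (g := Ring.inverse) ?_ (contDiffAt_const.add B.contDiff.contDiffAt)
      rw [← hU]
      exact contDiffAt_ringInverse ℝ U
    exact ((h1.clm_apply contDiffAt_id).neg).contDiffWithinAt
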